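/- Let $\mathbb T=\mathbb R/2\pi\mathbb Z$, let $0<\kappa_0\le\frac1{10}$, $K>1$ and $\frac12<s\le s_0<1$, and let $u,\theta$ be smooth real functions on $[0,1]$ such that, for some $c_0>0$, $u'\ge c_0$ and $\theta\ge c_0$ on $[0,1]$, $\operatorname{supp}u''$ and $\operatorname{supp}\theta'$ are contained in $[4\kappa_0,1-4\kappa_0]$, and for all integers $m\ge0$ $$\sup_{[0,1]}|\partial_y^m\theta'|+\sup_{[0,1]}|\partial_y^mu''|\le K^m(m!)^{1/s_0}(m+1)^{-2}.$$ For $v\in[u(0),u(1)]$ write $\widetilde\theta(v)=\theta(u^{-1}(v))$ and $\widetilde{u'}(v)=u'(u^{-1}(v))$. Let $\Upsilon$ be a smooth real function with $\operatorname{supp}\Upsilon\subset(u(0),u(1))$ and $\sup|\partial_v^m\Upsilon|\le LM^m(m!)^{1/s}(m+1)^{-2}$ for all $m\ge0$ and some constants $L,M$. For $t\in\mathbb R$ consider on $\mathbb T\times[u(0),u(1)]$ the Neumann problem $$\mathcal T_2[\Pi]:=\widetilde\theta\,\partial_{zz}\Pi+\widetilde{u'}(\partial_v-t\partial_z)\big(\widetilde\theta\,\widetilde{u'}(\partial_v-t\partial_z)\Pi\big)=F,\qquad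 (\partial_v-t\partial_z)\Pi\big|_{v=u(0)}=(\partial_v-t\partial_z)\Pi\big|_{v=u(1)}=0. \tag{N}$$ Solutions are classical: complex valued, $C^2$ on $\mathbb T\times(u(0),u(1))$ and $C^1$ on $\mathbb T\times[u(0),u(1)]$. Write $\widehat f(k,\eta)=\frac1{2\pi}\int_{\mathbb T\times\mathbb R}f(z,v)e^{-izk-iv\eta}\,dz\,dv$ and $\langle x\rangle=(1+x^2)^{1/2}$. Sources $\Xi$ are continuous complex functions on $\mathbb T\times\mathbb R$, and $\Upsilon\Pi$ is extended by zero. (a) There are constants $C,\lambda_\Delta>0$ and a kernel $\mathcal G_N(t,k,\xi,\eta)$, depending only on $u,\theta,s,\Upsilon$, such that for all $t,\xi,\eta\in\mathbb R$ and all $k\in\mathbb Z\setminus\{0\}$ $$|\mathcal G_N(t,k,\xi,\eta)|\le C\min\left\{\frac{e^{-\lambda_\Delta\langle\xi-\eta\rangle^s}}{1+k^2+(\xi-kt)^2},\ \frac{e^{-\lambda_\Delta\langle\xi-\eta\rangle^s}}{1+k^2+(\eta-kt)^2}\right\},$$ and such that, for every $t\in\mathbb R$, every $\Xi$ with compact support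 in $\mathbb T\times(u(0),u(1))$ and every solution $\Pi$ of (N) at time $t$ with $F=\Xi\Upsilon$, $$\widehat{(\Upsilon\Pi)}(k,\xi)=\int_{\mathbb R}\mathcal G_N(t,k,\xi,\eta)\,\widehat\Xi(k,\eta)\,d\eta\qquad(k\in\mathbb Z\setminus\{0\},\ \xi\in\mathbb R),$$ the integral being absolutely convergent. (b) For every compact interval $[a,b]\subset(u(0),u(1))$ there are $C,\lambda_\Delta>0$ and a kernel $\mathcal G_N$, depending only on $u,\theta,s,\Upsilon,a,b$, with the same bound and the same representation formula for every $t\in\mathbb R$, every $\Xi$ supported in $\mathbb T\times[a,b]$ and every solution $\Pi$ of (N) at time $t$ with $F=\Xi$; that is, for the cut-off inverse operator $\Upsilon\,\mathcal T_N^{-1}[\Xi]$. -/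

import Mathlib

open Set MeasureTheory
open scoped ContDiff

noncomputable section

namespace PressureKernel

/-- The Gevrey weight `Γ_s(m) = (m!)^{1/s} (m+1)^{-2}`. -/
def gevreyWeight (s : ℝ) (m : ℕ) : ℝ :=
  (Nat.factorial m : ℝ) ^ (1 / s) / ((m : ℝ) + 1) ^ 2

/-- The Japanese bracket `⟨x⟩ = (1 + x^2)^{1/2}`. -/
def bracket (x : ℝ) : ℝ := Real.sqrt (1 + x ^ 2)

/-- The assumptions on the background shear flow `u` and the background (inverse) density `θ`,
both defined on `[0,1]`: smooth, `u` strictly monotone, `θ` positive, `u''` and `θ'` supported in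
`[4κ₀, 1-4κ₀]` and of Gevrey class with the constants `K`, `s₀`. -/
structure Background (u θ : ℝ → ℝ) (κ₀ K s₀ : ℝ) : Prop where
  smooth_u : ContDiffOn ℝ ∞ u (Icc 0 1)
  smooth_θ : ContDiffOn ℝ ∞ θ (Icc 0 1)
  monotone : ∃ c₀ : ℝ, 0 < c₀ ∧ ∀ y ∈ Icc (0 : ℝ) 1, c₀ ≤ derivWithin u (Icc 0 1) y
  positive : ∃ c₀ : ℝ, 0 < c₀ ∧ ∀ y ∈ Icc (0 : ℝ) 1, c₀ ≤ θ y
  supp_u : ∀ y ∈ Icc (0 : ℝ) 1, y ∉ Icc (4 * κ₀) (1 - 4 * κ₀) →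
    iteratedDerivWithin 2 u (Icc 0 1) y = 0
  supp_θ : ∀ y ∈ Icc (0 : ℝ) 1, y ∉ Icc (4 * κ₀) (1 - 4 * κ₀) →
    derivWithin θ (Icc 0 1) y = 0
  gevrey : ∀ m : ℕ, ∀ y₁ ∈ Icc (0 : ℝ) 1, ∀ y₂ ∈ Icc (0 : ℝ) 1,
    |iteratedDerivWithin (m + 1) θ (Icc 0 1) y₁| + |iteratedDerivWithin (m + 2) u (Icc 0 1) y₂|
      ≤ K ^ m * gevreyWeight s₀ m

/-- A Gevrey-`1/s` cut-off function with (compact) support inside the open interval `(α, β)`. -/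
structure IsGevreyCutoff (s α β : ℝ) (Υ : ℝ → ℝ) : Prop where
  smooth : ContDiff ℝ ∞ Υ
  gevrey : ∃ L M : ℝ, ∀ (m : ℕ) (v : ℝ), |iteratedDeriv m Υ v| ≤ L * M ^ m * gevreyWeight s m
  supp : tsupport Υ ⊆ Ioo α β

/-- `φ̃ = φ ∘ u⁻¹` on `[u(0), u(1)]`, where `u⁻¹` is the inverse of `u` on `[0,1]`. -/
def tilde (u φ : ℝ → ℝ) (v : ℝ) : ℝ := φ (Function.invFunOn u (Icc 0 1) v)

/-- `ũ'`, that is `u' ∘ u⁻¹` on `[u(0), u(1)]`. -/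
def tildeDeriv (u : ℝ → ℝ) : ℝ → ℝ := tilde u (derivWithin u (Icc 0 1))

/-- `∂_z f`, for a function `f(z, v)`. -/
def dz (f : ℝ → ℝ → ℂ) (z v : ℝ) : ℂ := deriv (fun z₁ => f z₁ v) z

/-- `∂_v f`, for a function `f(z, v)` on `v ∈ [u(0), u(1)]` (one-sided at the two endpoints). -/
def dv (u : ℝ → ℝ) (f : ℝ → ℝ → ℂ) (z v : ℝ) : ℂ :=
  derivWithin (fun v₁ => f z v₁) (Icc (u 0) (u 1)) v

/-- The sheared derivative `(∂_v - t ∂_z) f`. -/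
def shearDeriv (u : ℝ → ℝ) (t : ℝ) (f : ℝ → ℝ → ℂ) (z v : ℝ) : ℂ :=
  dv u f z v - (t : ℂ) * dz f z v

/-- The linearized pressure operator
`P ↦ θ̃ ∂_zz P + ũ' (∂_v - t ∂_z) (θ̃ ũ' (∂_v - t ∂_z) P)`. -/
def pressureOp (u θ : ℝ → ℝ) (t : ℝ) (P : ℝ → ℝ → ℂ) (z v : ℝ) : ℂ :=
  (tilde u θ v : ℂ) * dz (dz P) z v +
    (tildeDeriv u v : ℂ) *
      shearDeriv u t
        (fun z₁ v₁ => (tilde u θ v₁ : ℂ) * (tildeDeriv u v₁ : ℂ) * shearDeriv u t P z₁ v₁) z v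

/-- `P` is a classical solution on `𝕋 × [u(0), u(1)]`, `𝕋 = ℝ/2πℤ`, at the time `t`, of the
linearized pressure equation with source `F` and homogeneous Neumann boundary conditions. -/
structure IsNeumannSolution (u θ : ℝ → ℝ) (t : ℝ) (F P : ℝ → ℝ → ℂ) : Prop where
  periodic : ∀ v ∈ Icc (u 0) (u 1), Function.Periodic (fun z => P z v) (2 * Real.pi)
  contDiff_closed : ContDiffOn ℝ 1 (fun p : ℝ × ℝ => P p.1 p.2) (univ ×ˢ Icc (u 0) (u 1))
  contDiff_open : ContDiffOn ℝ 2 (fun p : ℝ × ℝ => P p.1 p.2) (univ ×ˢ Ioo (u 0) (u 1))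
  equation : ∀ z : ℝ, ∀ v ∈ Ioo (u 0) (u 1), pressureOp u θ t P z v = F z v
  boundary_left : ∀ z : ℝ, shearDeriv u t P z (u 0) = 0
  boundary_right : ∀ z : ℝ, shearDeriv u t P z (u 1) = 0

/-- `Ξ` is a continuous function on `𝕋 × ℝ`, supported in `𝕋 × [a, b]`. -/
structure IsSource (a b : ℝ) (Ξ : ℝ → ℝ → ℂ) : Prop where
  periodic : ∀ v : ℝ, Function.Periodic (fun z => Ξ z v) (2 * Real.pi)
  continuous : Continuous (fun p : ℝ × ℝ => Ξ p.1 p.2)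
  supp : ∀ z v : ℝ, v ∉ Icc a b → Ξ z v = 0

/-- The Fourier coefficient in `z`: `(2π)⁻¹ ∫_𝕋 f(z, v) e^{-izk} dz`. -/
def fourierZ (f : ℝ → ℝ → ℂ) (k : ℤ) (v : ℝ) : ℂ :=
  (1 / (2 * Real.pi) : ℂ) *
    ∫ z in (0 : ℝ)..(2 * Real.pi), f z v * Complex.exp (-(Complex.I * (z : ℂ) * (k : ℂ)))

/-- The Fourier transform `(2π)⁻¹ ∫_{𝕋 × ℝ} f(z, v) e^{-izk - ivη} dz dv`. -/
def fourier (f : ℝ → ℝ → ℂ) (k : ℤ) (η : ℝ) : ℂ :=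
  ∫ v : ℝ, fourierZ f k v * Complex.exp (-(Complex.I * (v : ℂ) * (η : ℂ)))

/-- The kernel bound
`|𝒢(t,k,ξ,η)| ≤ C min { e^{-λ⟨ξ-η⟩^s}/(1+k²+(ξ-kt)²), e^{-λ⟨ξ-η⟩^s}/(1+k²+(η-kt)²) }`
for all times `t`, all nonzero `k` and all frequencies `ξ`, `η`. -/
def KernelBound (C lam s : ℝ) (𝒢 : ℝ → ℤ → ℝ → ℝ → ℂ) : Prop :=
  ∀ (t : ℝ) (k : ℤ) (ξ η : ℝ), k ≠ 0 →
    ‖𝒢 t k ξ η‖ ≤ C * min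
      (Real.exp (-lam * bracket (ξ - η) ^ s) / (1 + (k : ℝ) ^ 2 + (ξ - (k : ℝ) * t) ^ 2))
      (Real.exp (-lam * bracket (ξ - η) ^ s) / (1 + (k : ℝ) ^ 2 + (η - (k : ℝ) * t) ^ 2))

/-- `ĝ(k, ξ) = ∫_ℝ 𝒢(t,k,ξ,η) f̂(k, η) dη` (absolutely convergent) for all nonzero `k` and
all `ξ`. -/
def KernelRepresents (𝒢 : ℝ → ℤ → ℝ → ℝ → ℂ) (t : ℝ) (f g : ℝ → ℝ → ℂ) : Prop :=
  ∀ (k : ℤ) (ξ : ℝ), k ≠ 0 →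
    Integrable (fun η : ℝ => 𝒢 t k ξ η * fourier f k η) ∧
      fourier g k ξ = ∫ η : ℝ, 𝒢 t k ξ η * fourier f k η

end PressureKernel

end

namespace PressureKernel

/-! ### The Gevrey weight -/

/-! Take the `k`-th Fourier coefficient in z and multiply it by e^{-iktv}. The sheared derivative
becomes d/dv, and time survives only as a translation of both frequencies by kt. With κ = |k|, q the
conjugated mode of the solution and Y the conjugated mode of θ̃ũ'(∂_v - t∂_z)Π, the problem reads q'
= ρY, Y' = κ²pq + bf, with Y = 0 at both endpoints, where p = θ̃/ũ', ρ = 1/(θ̃ũ'), b = 1/ũ'.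

This system factorizes. Let X₁' = κ(p - ρX₁²) with X₁ = 0 at the left endpoint, and let X₂ solve the
mirrored equation from the right. Then N₁ = Y - κX₁q and N₂ = Y + κX₂q solve scalar first order
equations, each damped in the direction leading away from the endpoint where it vanishes, and q =
(N₂ - N₁)/(κ(X₁ + X₂)); see `IsNeumannSolution.exists_isFactorPair`.

What remains is Gevrey regularity uniform in κ ≥ 1. X₁ starts away from its equilibrium, so it has a
boundary layer in which each derivative costs a factor κ. The coefficients are constant near the
endpoints, so at a fixed interior point the deviation from equilibrium is of size e^{-γκ}, and κ^m
e^{-γκ} is at most m!γ^{-m} (`riccati_initial`). From that point the maximum principle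
`norm_le_of_damped`, applied to every derivative in turn, propagates the bounds: the commutators are
of size κ, but so is the damping (`riccati_gevrey`).

For the source he^{iηv} the conjugated factors e^{-iηv}N solve equations such as n' = -(κμ + iη)n +
h. They are Gevrey with amplitude 1/(κ + |η|); in their difference the source cancels, which gains a
second such factor. Decay of Fourier transforms of Gevrey functions then bounds the localized
response at ξ by e^{-λ⟨ξ-η⟩^s}/(κ + |η|)² (`exists_resolvent_bound`), and half of the exponential
turns this into both bounds of the minimum (`exists_kernel_weight_bound`).

To pass to general sources, the adjoint first order equations (`exists_adjoint`) write the localized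
response as integration of the source against a fixed continuous function. As a function of η the
kernel is therefore an inverse Fourier transform; the bound makes it integrable, and Parseval gives
the representation (`exists_kernel`). Neither existence nor uniqueness for the Neumann problem is
needed. For (b), a Gevrey cut-off equal to one on [a, b] is manufactured from Υ itself. -/

lemma gevreyWeight_pos (s : ℝ) (m : ℕ) : 0 < gevreyWeight s m := by
  unfold gevreyWeight
  have : (0 : ℝ) < (Nat.factorial m : ℝ) := by exact_mod_cast Nat.factorial_pos m
  positivity

lemma gevreyWeight_zero (s : ℝ) : gevreyWeight s 0 = 1 := by simp [gevreyWeight]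

lemma gevreyWeight_anti {s s₀ : ℝ} (hs : 0 < s) (h : s ≤ s₀) (m : ℕ) :
    gevreyWeight s₀ m ≤ gevreyWeight s m := by
  unfold gevreyWeight
  have h1 : (1 : ℝ) ≤ (Nat.factorial m : ℝ) := by exact_mod_cast Nat.factorial_pos m
  gcongr

/-- Telescoping: 1/(N+2)² ≤ 1/(N+1) - 1/(N+2). -/
lemma sum_inv_sq_le (N : ℕ) :
    ∑ i ∈ Finset.range (N + 1), 1 / ((i : ℝ) + 1) ^ 2 ≤ 2 - 1 / ((N : ℝ) + 1) := by
  induction N with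
  | zero => norm_num
  | succ N ih =>
    rw [Finset.sum_range_succ]
    have h : (0 : ℝ) < (N : ℝ) + 1 := by positivity
    have : 1 / (((N + 1 : ℕ) : ℝ) + 1) ^ 2 ≤ 1 / ((N : ℝ) + 1) - 1 / (((N + 1 : ℕ) : ℝ) + 1) := by
      push_cast
      rw [div_sub_div _ _ (by positivity) (by positivity), div_le_div_iff₀ (by positivity)
        (by positivity)]
      nlinarith
    linarith

/-- 1/(a²b²) = (1/a² + 1/b²)/(a² + b²), and a + b ≥ N + 1 forces a² + b² ≥ (N+1)²/2. This is why the
weight carries the factor (m+1)^{-2}. -/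
lemma sum_inv_sq_mul_le (N : ℕ) :
    ∑ i ∈ Finset.range (N + 1), 1 / (((i : ℝ) + 1) ^ 2 * (((N - i : ℕ) : ℝ) + 1) ^ 2)
      ≤ 8 / ((N : ℝ) + 1) ^ 2 := by
  have hN : (0 : ℝ) < (N : ℝ) + 1 := by positivity
  have h1 : ∀ i ∈ Finset.range (N + 1),
      1 / (((i : ℝ) + 1) ^ 2 * (((N - i : ℕ) : ℝ) + 1) ^ 2)
        ≤ 2 / ((N : ℝ) + 1) ^ 2 * (1 / ((i : ℝ) + 1) ^ 2 + 1 / (((N - i : ℕ) : ℝ) + 1) ^ 2) := by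
    intro i hi
    have hiN : i ≤ N := Nat.lt_succ_iff.mp (Finset.mem_range.mp hi)
    rw [Nat.cast_sub hiN]
    have hiN' : (i : ℝ) ≤ N := by exact_mod_cast hiN
    set a : ℝ := (i : ℝ) + 1 with ha
    set b : ℝ := (N : ℝ) - i + 1 with hb
    have ha0 : 0 < a := by positivity
    have hb0 : 0 < b := by linarith
    have hab : (N : ℝ) + 1 ≤ a + b := by simp only [ha, hb]; linarith
    rw [div_add_div _ _ (by positivity) (by positivity), div_mul_div_comm,
      div_le_div_iff₀ (by positivity) (by positivity)]
    have h2 : ((N : ℝ) + 1) ^ 2 ≤ 2 * (a ^ 2 + b ^ 2) := by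
      nlinarith [sq_nonneg (a - b), mul_self_le_mul_self hN.le hab]
    have : 0 < a ^ 2 * b ^ 2 := by positivity
    nlinarith
  refine (Finset.sum_le_sum h1).trans ?_
  rw [← Finset.mul_sum, Finset.sum_add_distrib]
  have h3 := sum_inv_sq_le N
  have h4 : ∑ i ∈ Finset.range (N + 1), 1 / (((N - i : ℕ) : ℝ) + 1) ^ 2
      = ∑ i ∈ Finset.range (N + 1), 1 / ((i : ℝ) + 1) ^ 2 := by
    have := Finset.sum_range_reflect (fun i : ℕ => 1 / ((i : ℝ) + 1) ^ 2) (N + 1)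
    rw [← this]
    refine Finset.sum_congr rfl fun i _ => ?_
    simp
  rw [h4]
  have h5 : 0 < 1 / ((N : ℝ) + 1) := by positivity
  calc _ ≤ 2 / ((N : ℝ) + 1) ^ 2 * 4 := by gcongr; linarith
    _ = _ := by ring

/-- Since 1/s ≥ 1, the binomial coefficient is at most its own power 1/s, and then N! = (N choose i)
i! (N-i)! applies. -/
lemma choose_mul_factorial_rpow_le {s : ℝ} (hs : 0 < s) (hs1 : s ≤ 1) {N i : ℕ} (hi : i ≤ N) :
    (N.choose i : ℝ) * ((Nat.factorial i : ℝ) ^ (1 / s) * (Nat.factorial (N - i) : ℝ) ^ (1 / s))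
      ≤ (Nat.factorial N : ℝ) ^ (1 / s) := by
  have h1 : (1 : ℝ) ≤ (N.choose i : ℝ) := by exact_mod_cast Nat.choose_pos hi
  have h2 : (1 : ℝ) ≤ 1 / s := by rw [le_div_iff₀ hs]; linarith
  have h3 : (Nat.factorial N : ℝ) = (N.choose i : ℝ) * Nat.factorial i * Nat.factorial (N - i) := by
    exact_mod_cast (Nat.choose_mul_factorial_mul_factorial hi).symm
  rw [h3, Real.mul_rpow (by positivity) (by positivity), Real.mul_rpow (by positivity)
    (by positivity), mul_assoc]
  gcongr
  calc (N.choose i : ℝ) = (N.choose i : ℝ) ^ (1 : ℝ) := (Real.rpow_one _).symm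
    _ ≤ _ := Real.rpow_le_rpow_of_exponent_le h1 h2

/-- Gevrey weights are almost closed under binomial convolution. -/
lemma sum_choose_mul_gevreyWeight_le {s : ℝ} (hs : 0 < s) (hs1 : s ≤ 1) (n j : ℕ) :
    ∑ i ∈ Finset.range (j + 1), (j.choose i : ℝ) * gevreyWeight s i * gevreyWeight s (n + (j - i))
      ≤ 8 * gevreyWeight s (n + j) := by
  have key : ∀ N i : ℕ, i ≤ N → (N.choose i : ℝ) * gevreyWeight s i * gevreyWeight s (N - i)
      ≤ (Nat.factorial N : ℝ) ^ (1 / s) *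
        (1 / (((i : ℝ) + 1) ^ 2 * (((N - i : ℕ) : ℝ) + 1) ^ 2)) := by
    intro N i hi
    unfold gevreyWeight
    have := choose_mul_factorial_rpow_le hs hs1 hi
    calc _ = ((N.choose i : ℝ) *
          ((Nat.factorial i : ℝ) ^ (1 / s) * (Nat.factorial (N - i) : ℝ) ^ (1 / s))) *
          (1 / (((i : ℝ) + 1) ^ 2 * (((N - i : ℕ) : ℝ) + 1) ^ 2)) := by field_simp
      _ ≤ _ := by gcongr
  calc _ ≤ ∑ i ∈ Finset.range (j + 1), (Nat.factorial (n + j) : ℝ) ^ (1 / s) *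
        (1 / (((i : ℝ) + 1) ^ 2 * (((n + j - i : ℕ) : ℝ) + 1) ^ 2)) := by
        refine Finset.sum_le_sum fun i hi => ?_
        have hi' : i ≤ j := Nat.lt_succ_iff.mp (Finset.mem_range.mp hi)
        refine le_trans ?_ (key (n + j) i (by omega))
        -- The shifted sum is part of the full convolution of order n + j, because (j choose i) ≤
        -- (n+j choose i).
        rw [show n + (j - i) = n + j - i by omega]
        have : (j.choose i : ℝ) ≤ ((n + j).choose i : ℝ) := by
          exact_mod_cast Nat.choose_le_choose i (by omega)
        have h1 := gevreyWeight_pos s i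
        have h2 := gevreyWeight_pos s (n + j - i)
        gcongr
    _ ≤ ∑ i ∈ Finset.range (n + j + 1), (Nat.factorial (n + j) : ℝ) ^ (1 / s) *
        (1 / (((i : ℝ) + 1) ^ 2 * (((n + j - i : ℕ) : ℝ) + 1) ^ 2)) := by
        refine Finset.sum_le_sum_of_subset_of_nonneg ?_ fun i _ _ => by positivity
        intro i hi
        simp only [Finset.mem_range] at hi ⊢
        omega
    _ ≤ (Nat.factorial (n + j) : ℝ) ^ (1 / s) * (8 / (((n + j : ℕ) : ℝ) + 1) ^ 2) := by
        rw [← Finset.mul_sum]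
        gcongr
        exact sum_inv_sq_mul_le (n + j)
    _ = _ := by unfold gevreyWeight; ring

lemma sum_choose_gevreyWeight_le {s : ℝ} (hs : 0 < s) (hs1 : s ≤ 1) (j : ℕ) :
    ∑ i ∈ Finset.range (j + 1), (j.choose i : ℝ) * gevreyWeight s i * gevreyWeight s (j - i)
      ≤ 8 * gevreyWeight s j := by
  simpa using sum_choose_mul_gevreyWeight_le hs hs1 0 j

lemma gevreyWeight_succ (s : ℝ) (m : ℕ) :
    gevreyWeight s (m + 1) =
      ((m : ℝ) + 1) ^ (1 / s) * (((m : ℝ) + 1) ^ 2 / ((m : ℝ) + 2) ^ 2) * gevreyWeight s m := by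
  unfold gevreyWeight
  rw [Nat.factorial_succ]
  push_cast
  rw [Real.mul_rpow (by positivity) (by positivity)]
  have : ((m : ℝ) + 1 + 1) = (m : ℝ) + 2 := by ring
  rw [this]
  field_simp

lemma succ_mul_gevreyWeight_le {s : ℝ} (hs : 0 < s) (hs1 : s ≤ 1) (m : ℕ) :
    ((m : ℝ) + 1) * gevreyWeight s m ≤ 4 * gevreyWeight s (m + 1) := by
  rw [gevreyWeight_succ]
  have h2 : (1 : ℝ) ≤ 1 / s := by rw [le_div_iff₀ hs]; linarith
  have h3 : ((m : ℝ) + 1) ≤ ((m : ℝ) + 1) ^ (1 / s) := by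
    calc ((m : ℝ) + 1) = ((m : ℝ) + 1) ^ (1 : ℝ) := (Real.rpow_one _).symm
      _ ≤ _ := Real.rpow_le_rpow_of_exponent_le (by linarith [Nat.cast_nonneg (α := ℝ) m]) h2
  have h4 : (1 / 4 : ℝ) ≤ ((m : ℝ) + 1) ^ 2 / ((m : ℝ) + 2) ^ 2 := by
    rw [div_le_div_iff₀ (by positivity) (by positivity)]
    nlinarith [Nat.cast_nonneg (α := ℝ) m]
  have h5 := gevreyWeight_pos s m
  calc ((m : ℝ) + 1) * gevreyWeight s m
      = 4 * (((m : ℝ) + 1) * (1 / 4) * gevreyWeight s m) := by ring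
    _ ≤ _ := by gcongr

lemma gevreyWeight_le_succ {s : ℝ} (hs : 0 < s) (hs1 : s ≤ 1) (m : ℕ) :
    gevreyWeight s m ≤ 4 * gevreyWeight s (m + 1) := by
  refine le_trans ?_ (succ_mul_gevreyWeight_le hs hs1 m)
  have := gevreyWeight_pos s m
  nlinarith [Nat.cast_nonneg (α := ℝ) m]

/-- With s > 1/2 the ratio of consecutive weights is at most (m+1)² ≤ 4^m, so one derivative only
replaces M by 4M. -/
lemma gevreyWeight_succ_le {s : ℝ} (hs : 1 / 2 < s) (m : ℕ) :
    gevreyWeight s (m + 1) ≤ 4 ^ m * gevreyWeight s m := by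
  rw [gevreyWeight_succ]
  have h0 : (0 : ℝ) < s := by linarith
  have h2 : 1 / s ≤ (2 : ℝ) := by rw [div_le_iff₀ h0]; linarith
  have h5 := gevreyWeight_pos s m
  have h1 : ((m : ℝ) + 1) ≤ 2 ^ m := by
    exact_mod_cast (Nat.lt_two_pow_self (n := m))
  have h3 : ((m : ℝ) + 1) ^ (1 / s) ≤ 4 ^ m := by
    calc ((m : ℝ) + 1) ^ (1 / s) ≤ ((m : ℝ) + 1) ^ (2 : ℝ) :=
          Real.rpow_le_rpow_of_exponent_le (by linarith [Nat.cast_nonneg (α := ℝ) m]) h2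
      _ = ((m : ℝ) + 1) ^ 2 := by norm_cast
      _ ≤ (2 ^ m) ^ 2 := by gcongr
      _ = 4 ^ m := by rw [← pow_mul, mul_comm, pow_mul]; norm_num
  have h4 : ((m : ℝ) + 1) ^ 2 / ((m : ℝ) + 2) ^ 2 ≤ 1 := by
    rw [div_le_one (by positivity)]; gcongr; norm_num
  calc _ ≤ 4 ^ m * 1 * gevreyWeight s m := by gcongr
    _ = _ := by ring

/-! ### Functions with Gevrey bounds -/

variable {𝔸 : Type*} [NormedField 𝔸] [NormedAlgebra ℝ 𝔸]

/-- `f` is smooth at the points of `S`, with `|f^{(m)}| ≤ A M^m Γ_s(m)` on `S`. -/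
structure GevreyOn (s : ℝ) (S : Set ℝ) (A M : ℝ) (f : ℝ → 𝔸) : Prop where
  smooth : ∀ v ∈ S, ContDiffAt ℝ ∞ f v
  bound : ∀ (m : ℕ), ∀ v ∈ S, ‖iteratedDeriv m f v‖ ≤ A * M ^ m * gevreyWeight s m

namespace GevreyOn

variable {s A M B : ℝ} {S : Set ℝ} {f g : ℝ → 𝔸}

lemma mono (hf : GevreyOn s S A M f) {A' M' : ℝ} (hA : 0 ≤ A) (hM : 0 ≤ M) (hA' : A ≤ A')
    (hM' : M ≤ M') : GevreyOn s S A' M' f :=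
  ⟨hf.smooth, fun m v hv => (hf.bound m v hv).trans (by
    have := gevreyWeight_pos s m
    have := hA.trans hA'
    gcongr)⟩

lemma mono_set (hf : GevreyOn s S A M f) {S' : Set ℝ} (h : S' ⊆ S) : GevreyOn s S' A M f :=
  ⟨fun v hv => hf.smooth v (h hv), fun m v hv => hf.bound m v (h hv)⟩

lemma add (hf : GevreyOn s S A M f) (hg : GevreyOn s S B M g) :
    GevreyOn s S (A + B) M (fun v => f v + g v) :=
  ⟨fun v hv => (hf.smooth v hv).add (hg.smooth v hv), fun m v hv => by
    rw [iteratedDeriv_fun_add ((hf.smooth v hv).of_le (by exact_mod_cast le_top))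
      ((hg.smooth v hv).of_le (by exact_mod_cast le_top))]
    refine (norm_add_le _ _).trans ((add_le_add (hf.bound m v hv) (hg.bound m v hv)).trans ?_)
    apply le_of_eq; ring⟩

lemma neg (hf : GevreyOn s S A M f) : GevreyOn s S A M (fun v => - f v) :=
  ⟨fun v hv => (hf.smooth v hv).neg, fun m v hv => by
    rw [iteratedDeriv_fun_neg, norm_neg]
    exact hf.bound m v hv⟩

lemma sub (hf : GevreyOn s S A M f) (hg : GevreyOn s S B M g) :
    GevreyOn s S (A + B) M (fun v => f v - g v) := by
  simpa only [sub_eq_add_neg] using hf.add hg.neg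

lemma const_mul (hf : GevreyOn s S A M f) (c : 𝔸) :
    GevreyOn s S (‖c‖ * A) M (fun v => c * f v) :=
  ⟨fun v hv => contDiffAt_const.mul (hf.smooth v hv), fun m v hv => by
    rw [iteratedDeriv_const_mul_field, norm_mul]
    calc _ ≤ ‖c‖ * (A * M ^ m * gevreyWeight s m) := by gcongr; exact hf.bound m v hv
      _ = _ := by ring⟩

/-- Derivatives of a product, for bounds with a shifted weight in the second factor. -/
lemma norm_iteratedDeriv_mul_le (hs : 0 < s) (hs1 : s ≤ 1) (hA : 0 ≤ A) (hB : 0 ≤ B) (hM : 0 ≤ M)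
    (hf : GevreyOn s S A M f) {v : ℝ} (hv : v ∈ S) (hg : ContDiffAt ℝ ∞ g v) {n m : ℕ}
    (hgb : ∀ j ≤ m, ‖iteratedDeriv j g v‖ ≤ B * M ^ j * gevreyWeight s (n + j)) :
    ‖iteratedDeriv m (fun x => f x * g x) v‖ ≤ 8 * A * B * M ^ m * gevreyWeight s (n + m) := by
  rw [iteratedDeriv_fun_mul ((hf.smooth v hv).of_le (by exact_mod_cast le_top))
    (hg.of_le (by exact_mod_cast le_top))]
  calc _ ≤ ∑ i ∈ Finset.range (m + 1), A * B * M ^ m *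
        ((m.choose i : ℝ) * gevreyWeight s i * gevreyWeight s (n + (m - i))) := by
        refine (norm_sum_le _ _).trans (Finset.sum_le_sum fun i hi => ?_)
        have hi' : i ≤ m := Nat.lt_succ_iff.mp (Finset.mem_range.mp hi)
        rw [norm_mul, norm_mul]
        have h1 : ‖((m.choose i : ℕ) : 𝔸)‖ ≤ (m.choose i : ℝ) := by
          refine (Nat.norm_cast_le _).trans ?_
          simp
        have h2 := hf.bound i v hv
        have h3 := hgb (m - i) (by omega)
        have h4 := gevreyWeight_pos s i
        calc _ ≤ (m.choose i : ℝ) * (A * M ^ i * gevreyWeight s i) *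
              (B * M ^ (m - i) * gevreyWeight s (n + (m - i))) := by gcongr
          _ = A * B * (M ^ i * M ^ (m - i)) *
              ((m.choose i : ℝ) * gevreyWeight s i * gevreyWeight s (n + (m - i))) := by ring
          _ = _ := by rw [← pow_add, Nat.add_sub_cancel' hi']
    _ ≤ A * B * M ^ m * (8 * gevreyWeight s (n + m)) := by
        rw [← Finset.mul_sum]
        gcongr
        exact sum_choose_mul_gevreyWeight_le hs hs1 n m
    _ = _ := by ring

lemma mul (hs : 0 < s) (hs1 : s ≤ 1) (hA : 0 ≤ A) (hB : 0 ≤ B) (hM : 0 ≤ M)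
    (hf : GevreyOn s S A M f) (hg : GevreyOn s S B M g) :
    GevreyOn s S (8 * A * B) M (fun v => f v * g v) :=
  ⟨fun v hv => (hf.smooth v hv).mul (hg.smooth v hv), fun m v hv => by
    have := norm_iteratedDeriv_mul_le (n := 0) (m := m) hs hs1 hA hB hM hf hv (hg.smooth v hv)
      (fun j _ => by simpa using hg.bound j v hv)
    simpa using this⟩

protected lemma deriv (hs : 1 / 2 < s) (hA : 0 ≤ A) (hM : 0 ≤ M) (hf : GevreyOn s S A M f) :
    GevreyOn s S (A * M) (4 * M) (deriv f) :=
  ⟨fun v hv => (hf.smooth v hv).derivWithin (by simp), fun m v hv => by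
    rw [← iteratedDeriv_succ']
    calc _ ≤ _ := hf.bound (m + 1) v hv
      _ ≤ A * M ^ (m + 1) * (4 ^ m * gevreyWeight s m) := by
        gcongr
        exact gevreyWeight_succ_le hs m
      _ = _ := by rw [mul_pow]; ring⟩

lemma comp_neg (hf : GevreyOn s S A M f) : GevreyOn s (Neg.neg ⁻¹' S) A M (fun v => f (-v)) :=
  ⟨fun v hv => (hf.smooth (-v) hv).comp v contDiff_neg.contDiffAt, fun m v hv => by
    rw [iteratedDeriv_comp_neg, norm_smul, norm_pow, norm_neg, norm_one, one_pow, one_mul]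
    exact hf.bound m (-v) hv⟩

lemma congr (hf : GevreyOn s S A M f) (hS : IsOpen S) (h : EqOn f g S) : GevreyOn s S A M g := by
  have key : ∀ v ∈ S, f =ᶠ[nhds v] g := fun v hv => Filter.eventuallyEq_of_mem (hS.mem_nhds hv) h
  exact ⟨fun v hv => (hf.smooth v hv).congr_of_eventuallyEq (key v hv).symm, fun m v hv => by
    rw [← (key v hv).iteratedDeriv_eq m]
    exact hf.bound m v hv⟩

end GevreyOn

lemma iteratedDeriv_complex_ofReal (f : ℝ → ℝ) {m : ℕ} {v : ℝ} (hf : ContDiffAt ℝ m f v) :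
    iteratedDeriv m (fun x => (f x : ℂ)) v = ((iteratedDeriv m f v : ℝ) : ℂ) := by
  have := Complex.ofRealCLM.iteratedFDeriv_comp_left (i := m) (n := m) hf le_rfl
  rw [iteratedDeriv_eq_iteratedFDeriv, iteratedDeriv_eq_iteratedFDeriv]
  exact congrArg (fun L => L fun _ => (1 : ℝ)) this

lemma GevreyOn.ofReal {s A M : ℝ} {S : Set ℝ} {f : ℝ → ℝ} (hf : GevreyOn s S A M f) :
    GevreyOn s S A M (fun v => (f v : ℂ)) :=
  ⟨fun v hv => Complex.ofRealCLM.contDiff.contDiffAt.comp v (hf.smooth v hv), fun m v hv => by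
    rw [iteratedDeriv_complex_ofReal f ((hf.smooth v hv).of_le (by exact_mod_cast le_top)),
      Complex.norm_real]
    exact hf.bound m v hv⟩

/-! ### Bootstrapping of regularity and the damped maximum principle. -/

/-- Bootstrap for differential equations: the right-hand side is as regular as the solution, so each
pass gains one derivative. -/
lemma contDiffOn_infty_of_deriv {F : Type*} [NormedAddCommGroup F] [NormedSpace ℝ F] {f : ℝ → F}
    {S : Set ℝ} (hS : IsOpen S) (hd : DifferentiableOn ℝ f S)
    (h : ∀ k : ℕ, ContDiffOn ℝ k f S → ContDiffOn ℝ k (deriv f) S) : ContDiffOn ℝ ∞ f S := by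
  rw [contDiffOn_infty]
  intro k
  induction k with
  | zero => exact_mod_cast contDiffOn_zero.mpr hd.continuousOn
  | succ k ih =>
    push_cast
    rw [contDiffOn_succ_iff_deriv_of_isOpen hS]
    exact ⟨hd, by simp, h k ih⟩

lemma contDiffAt_iteratedDeriv {F : Type*} [NormedAddCommGroup F] [NormedSpace ℝ F] {f : ℝ → F}
    {v : ℝ} (h : ContDiffAt ℝ ∞ f v) (m : ℕ) : ContDiffAt ℝ ∞ (iteratedDeriv m f) v := by
  induction m with
  | zero => simpa using h
  | succ m ih =>
    rw [iteratedDeriv_succ]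
    exact ih.derivWithin (by simp)

/-- Smoothness of the solutions of a linear first order equation with smooth coefficients. -/
lemma contDiffAt_of_linear_ode {Φ h n : ℝ → ℂ} {S : Set ℝ} (hS : IsOpen S)
    (hΦ : ∀ v ∈ S, ContDiffAt ℝ ∞ Φ v) (hh : ∀ v ∈ S, ContDiffAt ℝ ∞ h v)
    (hn : ∀ v ∈ S, HasDerivAt n (Φ v * n v + h v) v) : ∀ v ∈ S, ContDiffAt ℝ ∞ n v := by
  have : ContDiffOn ℝ ∞ n S := by
    refine contDiffOn_infty_of_deriv hS
      (fun v hv => (hn v hv).differentiableAt.differentiableWithinAt) fun k hk => ?_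
    have h1 : ContDiffOn ℝ k (fun v => Φ v * n v + h v) S :=
      fun v hv => (((hΦ v hv).of_le (by exact_mod_cast le_top)).contDiffWithinAt.mul
        (hk v hv)).add ((hh v hv).of_le (by exact_mod_cast le_top)).contDiffWithinAt
    exact h1.congr fun v hv => (hn v hv).deriv
  exact fun v hv => this.contDiffAt (hS.mem_nhds hv)

/-- A maximum principle for damped first order equations. -/
lemma norm_le_of_damped {F : Type*} [NormedAddCommGroup F] [InnerProductSpace ℝ F]
    {E E' : ℝ → F} {a b Λ B : ℝ} (hΛ : 0 < Λ) (hB : 0 ≤ B) (hc : ContinuousOn E (Icc a b))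
    (hd : ∀ x ∈ Ico a b, HasDerivAt E (E' x) x)
    (h : ∀ x ∈ Ico a b, inner ℝ (E x) (E' x) ≤ -Λ * ‖E x‖ ^ 2 + Λ * B * ‖E x‖)
    (h0 : ‖E a‖ ≤ B) : ∀ x ∈ Icc a b, ‖E x‖ ≤ B := by
  intro x hx
  refine le_of_forall_pos_le_add fun ε hε => ?_
  have hBε : 0 < B + ε := by linarith
  -- The barrier is raised from B to B + ε because the comparison needs a strict inequality: at norm
  -- B + ε the derivative of ‖E‖² is at most -2Λ(B + ε)ε.
  have key := image_le_of_deriv_right_lt_deriv_boundary' (f := fun x => ‖E x‖ ^ 2)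
    (f' := fun x => 2 * inner ℝ (E x) (E' x)) (a := a) (b := b)
    (hc.norm.pow 2) (fun x hx => (hd x hx).hasDerivWithinAt.norm_sq) (B := fun _ => (B + ε) ^ 2)
    (B' := fun _ => 0) (by gcongr; linarith) continuousOn_const
    (fun x _ => hasDerivWithinAt_const _ _ _)
    (fun y hy hyB => by
      have h1 : ‖E y‖ = B + ε := (pow_left_inj₀ (norm_nonneg _) hBε.le two_ne_zero).mp hyB
      have h2 := h y hy
      rw [h1] at h2
      have : 0 < Λ * (B + ε) * ε := by positivity
      nlinarith) hx
  exact (pow_le_pow_iff_left₀ (norm_nonneg _) hBε.le two_ne_zero).mp key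

namespace GevreyOn

section Leibniz

variable {𝔸 : Type*} [NormedField 𝔸] [NormedAlgebra ℝ 𝔸]
  {s A M B : ℝ} {S : Set ℝ} {f g : ℝ → 𝔸}

/-- The terms of the Leibniz rule in which the first factor is differentiated. -/
lemma norm_iteratedDeriv_mul_sub_le (hs : 0 < s) (hs1 : s ≤ 1) (hA : 0 ≤ A) (hB : 0 ≤ B)
    (hM : 0 ≤ M) (hf : GevreyOn s S A M f) {v : ℝ} (hv : v ∈ S) (hg : ContDiffAt ℝ ∞ g v) {m : ℕ}
    {M' τ : ℝ} (hτ : 0 ≤ τ) (hM' : M ≤ M') (hMτ : M ≤ τ * M')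
    (hgb : ∀ j < m, ‖iteratedDeriv j g v‖ ≤ B * M' ^ j * gevreyWeight s j) :
    ‖iteratedDeriv m (fun x => f x * g x) v - f v * iteratedDeriv m g v‖
      ≤ 8 * A * B * τ * M' ^ m * gevreyWeight s m := by
  have hM'0 : 0 ≤ M' := hM.trans hM'
  rw [iteratedDeriv_fun_mul ((hf.smooth v hv).of_le (by exact_mod_cast le_top))
    (hg.of_le (by exact_mod_cast le_top)), Finset.sum_range_succ']
  simp only [Nat.choose_zero_right, Nat.cast_one, one_mul, iteratedDeriv_zero, Nat.sub_zero,
    add_sub_cancel_right]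
  calc _ ≤ ∑ i ∈ Finset.range m, A * B * τ * M' ^ m *
        ((m.choose (i + 1) : ℝ) * gevreyWeight s (i + 1) * gevreyWeight s (m - (i + 1))) := by
        refine (norm_sum_le _ _).trans (Finset.sum_le_sum fun i hi => ?_)
        have hi' : i < m := Finset.mem_range.mp hi
        rw [norm_mul, norm_mul]
        have h1 : ‖((m.choose (i + 1) : ℕ) : 𝔸)‖ ≤ (m.choose (i + 1) : ℝ) := by
          refine (Nat.norm_cast_le _).trans ?_
          simp
        have h2 := hf.bound (i + 1) v hv
        have h3 := hgb (m - (i + 1)) (by omega)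
        have h4 := gevreyWeight_pos s (i + 1)
        have h5 := gevreyWeight_pos s (m - (i + 1))
        -- At least one derivative falls on f, so one factor M can be traded for τM'. A small τ is
        -- what later makes these terms absorbable.
        have h6 : M ^ (i + 1) ≤ τ * M' ^ (i + 1) := by
          calc M ^ (i + 1) = M ^ i * M := pow_succ _ _
            _ ≤ M' ^ i * (τ * M') := by gcongr
            _ = _ := by ring
        calc _ ≤ (m.choose (i + 1) : ℝ) * (A * (τ * M' ^ (i + 1)) * gevreyWeight s (i + 1)) *
              (B * M' ^ (m - (i + 1)) * gevreyWeight s (m - (i + 1))) := by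
              gcongr
              exact h2.trans (by gcongr)
          _ = A * B * τ * (M' ^ (i + 1) * M' ^ (m - (i + 1))) *
              ((m.choose (i + 1) : ℝ) * gevreyWeight s (i + 1) *
                gevreyWeight s (m - (i + 1))) := by ring
          _ = _ := by rw [← pow_add, Nat.add_sub_cancel' (show i + 1 ≤ m by omega)]
    _ ≤ A * B * τ * M' ^ m * (8 * gevreyWeight s m) := by
        rw [← Finset.mul_sum]
        gcongr
        refine le_trans ?_ (sum_choose_gevreyWeight_le hs hs1 m)
        rw [Finset.sum_range_succ' _ m]
        have h1 := gevreyWeight_pos s 0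
        have h2 := gevreyWeight_pos s m
        simp only [Nat.choose_zero_right, Nat.cast_one, one_mul, Nat.sub_zero,
          le_add_iff_nonneg_right]
        positivity
    _ = _ := by ring

/-- Differentiating f·f⁻¹ = 1 leaves f(f⁻¹)^{(m)} equal to minus the Leibniz terms with a derivative
on f. Enlarging M by the factor (8A + c)/c corresponds to τ = c/(8A + c), small enough for strong
induction to close with the same constant 1/c. -/
lemma inv (hs : 0 < s) (hs1 : s ≤ 1) (hS : IsOpen S) (hA : 0 ≤ A) (hM : 0 ≤ M) {c : ℝ}
    (hc : 0 < c) (hf : GevreyOn s S A M f) (hfc : ∀ v ∈ S, c ≤ ‖f v‖) :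
    GevreyOn s S (1 / c) (M * ((8 * A + c) / c)) (fun v => (f v)⁻¹) := by
  have hne : ∀ v ∈ S, f v ≠ 0 := fun v hv => norm_pos_iff.mp (hc.trans_le (hfc v hv))
  have hsm : ∀ v ∈ S, ContDiffAt ℝ ∞ (fun v => (f v)⁻¹) v := fun v hv =>
    (hf.smooth v hv).inv (hne v hv)
  refine ⟨hsm, fun m v hv => ?_⟩
  induction m using Nat.strong_induction_on with
  | _ m ih =>
  rcases Nat.eq_zero_or_pos m with rfl | hm
  · simp only [iteratedDeriv_zero, pow_zero, gevreyWeight_zero, mul_one, norm_inv, one_div]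
    exact inv_anti₀ hc (hfc v hv)
  have h1 : iteratedDeriv m (fun x => f x * (f x)⁻¹) v = 0 := by
    have : (fun x => f x * (f x)⁻¹) =ᶠ[nhds v] fun _ => 1 :=
      Filter.eventuallyEq_of_mem (hS.mem_nhds hv) fun x hx => mul_inv_cancel₀ (hne x hx)
    rw [this.iteratedDeriv_eq m, iteratedDeriv_const, if_neg hm.ne']
  have hq : 1 ≤ (8 * A + c) / c := by rw [le_div_iff₀ hc]; linarith
  have h2 := norm_iteratedDeriv_mul_sub_le hs hs1 hA (B := 1 / c) (by positivity) hM hf hv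
    (hsm v hv) (m := m) (M' := M * ((8 * A + c) / c)) (τ := c / (8 * A + c)) (by positivity)
    (le_mul_of_one_le_right hM hq) (le_of_eq (by field_simp)) ih
  rw [h1, zero_sub, norm_neg, norm_mul] at h2
  have hw := gevreyWeight_pos s m
  have h3 : 8 * A * (1 / c) * (c / (8 * A + c)) ≤ 1 := by
    have : 8 * A * (1 / c) * (c / (8 * A + c)) = 8 * A / (8 * A + c) := by field_simp
    rw [this, div_le_one (by positivity)]
    linarith
  have h4 : c * ‖iteratedDeriv m (fun x => (f x)⁻¹) v‖ ≤
      c * (1 / c * (M * ((8 * A + c) / c)) ^ m * gevreyWeight s m) := by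
    calc _ ≤ ‖f v‖ * ‖iteratedDeriv m (fun x => (f x)⁻¹) v‖ := by gcongr; exact hfc v hv
      _ ≤ _ := h2
      _ = (8 * A * (1 / c) * (c / (8 * A + c))) *
          ((M * ((8 * A + c) / c)) ^ m * gevreyWeight s m) := by ring
      _ ≤ 1 * ((M * ((8 * A + c) / c)) ^ m * gevreyWeight s m) := by gcongr
      _ = _ := by field_simp
  exact le_of_mul_le_mul_left h4 hc

end Leibniz

/-- Gevrey bounds, uniform in the parameters `κ > 0` and `η`, for the solution of
`n' = -(κμ + iη)n + h` which vanishes near the left endpoint. -/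
lemma of_damped_ode {s A M H c : ℝ} (hs : 0 < s) (hs1 : s ≤ 1) (hA : 0 ≤ A) (hM : 0 ≤ M)
    (hH : 0 ≤ H) (hc : 0 < c) {a b a' : ℝ} (ha' : a < a') {μ h n : ℝ → ℂ}
    (hμ : GevreyOn s (Ioo a b) A M μ) (hμc : ∀ v ∈ Ioo a b, c ≤ (μ v).re)
    (hh : GevreyOn s (Ioo a b) H M h) {κ η : ℝ} (hκ : 0 < κ)
    (hn : ∀ v ∈ Ioo a b, HasDerivAt n (-((κ : ℂ) * μ v + Complex.I * η) * n v + h v) v)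
    (hn0 : ∀ v ∈ Ioo a a', n v = 0) :
    GevreyOn s (Ioo a b) (2 * H / (c * κ)) (M * ((16 * A + c) / c)) n := by
  have hsm : ∀ v ∈ Ioo a b, ContDiffAt ℝ ∞ n v :=
    contDiffAt_of_linear_ode isOpen_Ioo
      (fun v hv => ((contDiffAt_const.mul (hμ.smooth v hv)).add contDiffAt_const).neg)
      hh.smooth hn
  set M' := M * ((16 * A + c) / c) with hM'
  have hq : 1 ≤ (16 * A + c) / c := by rw [le_div_iff₀ hc]; linarith
  have hMM' : M ≤ M' := le_mul_of_one_le_right hM hq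
  have hM'0 : 0 ≤ M' := hM.trans hMM'
  refine ⟨hsm, fun m => ?_⟩
  induction m using Nat.strong_induction_on with
  | _ m ih =>
  have hw := gevreyWeight_pos s m
  have hder : ∀ x ∈ Ioo a b, HasDerivAt (iteratedDeriv m n) (iteratedDeriv (m + 1) n x) x := by
    intro x hx
    rw [iteratedDeriv_succ]
    exact ((contDiffAt_iteratedDeriv (hsm x hx) m).differentiableAt (by simp)).hasDerivAt
  have hderiv : ∀ x ∈ Ioo a b, ∃ R : ℂ, ‖R‖ ≤ 2 * H * M' ^ m * gevreyWeight s m ∧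
      iteratedDeriv (m + 1) n x = -((κ : ℂ) * μ x + Complex.I * η) * iteratedDeriv m n x + R := by
    intro x hx
    have e1 : deriv n =ᶠ[nhds x] fun v => (-(κ : ℂ)) * (μ v * n v) +
        ((-(Complex.I * η)) * n v + h v) :=
      Filter.eventuallyEq_of_mem (isOpen_Ioo.mem_nhds hx) fun v hv => by
        rw [(hn v hv).deriv]; ring
    have hm1 : ((m : ℕ∞) : WithTop ℕ∞) ≤ ∞ := by exact_mod_cast le_top
    have c1 := (hμ.smooth x hx).of_le hm1
    have c2 := (hsm x hx).of_le hm1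
    have c3 := (hh.smooth x hx).of_le hm1
    have e2 : iteratedDeriv (m + 1) n x = (-(κ : ℂ)) * iteratedDeriv m (fun v => μ v * n v) x +
        ((-(Complex.I * η)) * iteratedDeriv m n x + iteratedDeriv m h x) := by
      rw [iteratedDeriv_succ', e1.iteratedDeriv_eq m,
        iteratedDeriv_fun_add (contDiffAt_const.mul (c1.mul c2))
          ((contDiffAt_const.mul c2).add c3),
        iteratedDeriv_fun_add (contDiffAt_const.mul c2) c3, iteratedDeriv_const_mul_field,
        iteratedDeriv_const_mul_field]
    -- The factor κ of the commutator with κμ is cancelled by the 1/κ of the inductive bound, and τ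
    -- = c/(16A + c) makes the result at most the size of h. Hence the constant 2H.
    have e3 := norm_iteratedDeriv_mul_sub_le hs hs1 hA (B := 2 * H / (c * κ)) (by positivity) hM
      hμ hx (hsm x hx) (m := m) (M' := M') (τ := c / (16 * A + c)) (by positivity) hMM'
      (le_of_eq (by rw [hM']; field_simp)) (fun j hj => ih j hj x hx)
    refine ⟨(-(κ : ℂ)) * (iteratedDeriv m (fun v => μ v * n v) x - μ x * iteratedDeriv m n x) +
      iteratedDeriv m h x, ?_, by rw [e2]; ring⟩
    refine (norm_add_le _ _).trans ?_
    rw [norm_mul, norm_neg, Complex.norm_real, Real.norm_of_nonneg hκ.le]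
    have e4 : ‖iteratedDeriv m h x‖ ≤ H * M' ^ m * gevreyWeight s m :=
      (hh.bound m x hx).trans (by gcongr)
    have e5 : κ * (8 * A * (2 * H / (c * κ)) * (c / (16 * A + c))) ≤ H := by
      have : κ * (8 * A * (2 * H / (c * κ)) * (c / (16 * A + c))) = H * (16 * A / (16 * A + c)) := by
        field_simp; ring
      rw [this]
      refine mul_le_of_le_one_right hH ?_
      rw [div_le_one (by positivity)]; linarith
    calc _ ≤ κ * (8 * A * (2 * H / (c * κ)) * (c / (16 * A + c)) * M' ^ m * gevreyWeight s m) +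
          H * M' ^ m * gevreyWeight s m := by gcongr
      _ = (κ * (8 * A * (2 * H / (c * κ)) * (c / (16 * A + c)))) * (M' ^ m * gevreyWeight s m) +
          H * M' ^ m * gevreyWeight s m := by ring
      _ ≤ H * (M' ^ m * gevreyWeight s m) + H * M' ^ m * gevreyWeight s m := by gcongr
      _ = _ := by ring
  intro v hv
  -- The comparison starts where n vanishes in a neighbourhood, hence with all its derivatives.
  obtain ⟨a₁, ha₁, ha₁'⟩ := exists_between (lt_min ha' hv.1)
  have hsub : ∀ x ∈ Icc a₁ v, x ∈ Ioo a b := fun x hx => ⟨ha₁.trans_le hx.1, hx.2.trans_lt hv.2⟩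
  refine norm_le_of_damped (E := iteratedDeriv m n) (E' := iteratedDeriv (m + 1) n) (a := a₁)
    (b := v) (Λ := c * κ) (by positivity) (by positivity)
    (fun x hx => (hder x (hsub x hx)).continuousAt.continuousWithinAt)
    (fun x hx => hder x (hsub x (Ico_subset_Icc_self hx))) (fun x hx => ?_) ?_ v
    ⟨(ha₁'.trans_le (min_le_right _ _)).le, le_rfl⟩
  · have hx' := hsub x (Ico_subset_Icc_self hx)
    obtain ⟨R, hR, hRe⟩ := hderiv x hx'
    rw [hRe]
    set E := iteratedDeriv m n x
    -- The term iηE is orthogonal to E over the reals and drops out; this gives uniformity in η.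
    have i1 : inner ℝ E (-((κ : ℂ) * μ x + Complex.I * η) * E + R) =
        -(κ * (μ x).re) * ‖E‖ ^ 2 + inner ℝ E R := by
      rw [inner_add_right]
      congr 1
      rw [Complex.inner, ← Complex.normSq_eq_norm_sq, Complex.normSq_apply]
      simp
      ring
    rw [i1]
    have i2 : inner ℝ E R ≤ ‖E‖ * (2 * H * M' ^ m * gevreyWeight s m) :=
      (real_inner_le_norm E R).trans (by gcongr)
    have i3 : c * κ * ‖E‖ ^ 2 ≤ κ * (μ x).re * ‖E‖ ^ 2 := by
      have := hμc x hx'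
      rw [mul_comm c κ]
      gcongr
    have i4 : c * κ * (2 * H / (c * κ) * M' ^ m * gevreyWeight s m) * ‖E‖ =
        ‖E‖ * (2 * H * M' ^ m * gevreyWeight s m) := by field_simp
    rw [i4]
    linarith
  · have : n =ᶠ[nhds a₁] fun _ => 0 := Filter.eventuallyEq_of_mem
      (isOpen_Ioo.mem_nhds (⟨ha₁, ha₁'.trans_le (min_le_left _ _)⟩ : a₁ ∈ Ioo a a')) hn0
    rw [this.iteratedDeriv_eq m, iteratedDeriv_const]
    simp only [ite_self, norm_zero]
    positivity

end GevreyOn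

/-! ### The Riccati equation, uniformly in the large parameter. -/

/-- Global solvability of `X' = κ(p - ρX²)`, `X(α) = 0`, with bounds that do not depend on the
large parameter `κ`. -/
lemma exists_riccati {α β c A : ℝ} (hαβ : α < β) (hc : 0 < c) :
    ∃ e L : ℝ, 0 < e ∧ 0 < L ∧ ∀ (p ρ : ℝ → ℝ), Continuous p → Continuous ρ →
      (∀ v, p v ∈ Icc c A) → (∀ v, ρ v ∈ Icc c A) → ∀ κ : ℝ, 1 ≤ κ →
      ∃ X : ℝ → ℝ, Continuous X ∧ X α = 0 ∧
        (∀ v ∈ Ioo α β, HasDerivAt X (κ * (p v - ρ v * X v ^ 2)) v) ∧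
        ∀ v ∈ Icc α β, e * (v - α) ≤ X v ∧ X v ≤ L := by
  -- e is the slope of a lower barrier e(v - α): along it κ(p - ρX²) ≥ c - A(e(β - α))² > e, because
  -- κ ≥ 1.
  obtain ⟨e, he, hec⟩ : ∃ e : ℝ, 0 < e ∧ e + A * (e * (β - α)) ^ 2 < c := by
    have h1 : Filter.Tendsto (fun e : ℝ => e + A * (e * (β - α)) ^ 2) (nhdsWithin 0 (Ioi 0))
        (nhds (0 + A * (0 * (β - α)) ^ 2)) :=
      ((by fun_prop : Continuous fun e : ℝ => e + A * (e * (β - α)) ^ 2).tendsto 0).mono_left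
        nhdsWithin_le_nhds
    have h2 := (h1.eventually_lt_const (u := c) (by simpa using hc)).and self_mem_nhdsWithin
    obtain ⟨e, h3, h4⟩ := h2.exists
    exact ⟨e, h4, h3⟩
  refine ⟨e, |A| / c + 1, he, by positivity, fun p ρ hp hρ hpm hρm κ hκ => ?_⟩
  -- cL² > A makes the constant L a strict upper barrier.
  set L : ℝ := |A| / c + 1 with hL
  have hA : 0 < A := hc.trans_le ((hpm 0).1.trans (hpm 0).2)
  have hκ0 : 0 < κ := by linarith
  have hL1 : 1 ≤ L := by rw [hL]; have : 0 ≤ |A| / c := by positivity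
                         linarith
  have hLA : A < c * L ^ 2 := by
    have : A < c * L := by rw [hL, mul_add, mul_div_cancel₀ _ hc.ne', abs_of_pos hA]; linarith
    nlinarith
  -- Clipping the unknown to [0, L] makes the right-hand side bounded and Lipschitz, so
  -- Picard–Lindelöf reaches the whole interval; the two barriers then show that the clip is never
  -- active.
  let cl : ℝ → ℝ := fun x => max 0 (min x L)
  have hcl0 : ∀ x, 0 ≤ cl x := fun x => le_max_left _ _
  have hclL : ∀ x, cl x ≤ L := fun x => max_le (by linarith) (min_le_right _ _)
  have hclip : ∀ x y, |cl x - cl y| ≤ |x - y| := fun x y => by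
    have := abs_max_sub_max_le_abs (min x L) (min y L) 0
    simp only [cl, max_comm (0 : ℝ)]
    refine this.trans ?_
    have := abs_inf_sub_inf_le_abs x y L
    exact this
  have hcleq : ∀ x, 0 ≤ x → x ≤ L → cl x = x := fun x h1 h2 => by simp [cl, h1, h2]
  let f : ℝ → ℝ → ℝ := fun v x => κ * (p v - ρ v * cl x ^ 2)
  obtain ⟨Lb, hLb⟩ : ∃ x : NNReal, (x : ℝ) = κ * (A + A * L ^ 2) := ⟨⟨_, by positivity⟩, rfl⟩
  obtain ⟨D, hD⟩ : ∃ x : NNReal, (x : ℝ) = β - α := ⟨⟨_, by linarith⟩, rfl⟩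
  obtain ⟨Kl, hKl⟩ : ∃ x : NNReal, (x : ℝ) = κ * (A * (2 * L)) := ⟨⟨_, by positivity⟩, rfl⟩
  have hPL : IsPicardLindelof f (⟨α, left_mem_Icc.mpr hαβ.le⟩ : Icc α β) 0 (Lb * D) 0 Lb
      Kl := by
    refine ⟨fun t _ => ?_, fun x _ => ?_, fun t _ x _ => ?_, ?_⟩
    · refine LipschitzWith.lipschitzOnWith (LipschitzWith.of_dist_le_mul fun x y => ?_)
      simp only [f, Real.dist_eq, hKl]
      have h1 : κ * (p t - ρ t * cl x ^ 2) - κ * (p t - ρ t * cl y ^ 2)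
          = κ * (ρ t * ((cl x + cl y) * (cl y - cl x))) := by ring
      rw [h1, abs_mul, abs_mul, abs_mul, abs_of_pos hκ0, abs_of_pos (hc.trans_le (hρm t).1),
        abs_of_nonneg (add_nonneg (hcl0 x) (hcl0 y))]
      have h2 := hclip y x
      rw [abs_sub_comm y x] at h2
      have h3 := (hρm t).2
      have h4 := (hρm t).1
      calc _ ≤ κ * (A * ((L + L) * |x - y|)) := by
            have := hcl0 x; have := hcl0 y; have := hclL x; have := hclL y
            gcongr
        _ = _ := by ring
    · exact (by fun_prop : Continuous fun t => κ * (p t - ρ t * cl x ^ 2)).continuousOn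
    · simp only [f, hLb, norm_mul, Real.norm_eq_abs, abs_of_pos hκ0]
      gcongr
      refine (abs_sub _ _).trans ?_
      have h3 := (hρm t).2
      have h4 := (hρm t).1
      rw [abs_of_pos (hc.trans_le (hpm t).1), abs_mul, abs_of_pos (hc.trans_le h4),
        abs_of_nonneg (sq_nonneg (cl x))]
      have := hcl0 x; have := hclL x
      have := (hpm t).2
      gcongr
    · simp [hD, hαβ.le]
  obtain ⟨X, hX0, hX⟩ := hPL.exists_eq_forall_mem_Icc_hasDerivWithinAt₀
  have hXc : ContinuousOn X (Icc α β) := fun v hv => (hX v hv).continuousWithinAt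
  have hXr : ∀ v ∈ Ico α β, HasDerivWithinAt X (f v (X v)) (Ici v) v := fun v hv =>
    (hX v (Ico_subset_Icc_self hv)).mono_of_mem_nhdsWithin
      (mem_nhdsWithin.mpr ⟨Iio β, isOpen_Iio, hv.2, fun y hy => ⟨hv.1.trans hy.2, hy.1.le⟩⟩)
  have hXL : ∀ v ∈ Icc α β, X v ≤ L := fun v hv =>
    image_le_of_deriv_right_lt_deriv_boundary' (B := fun _ => L) (B' := fun _ => 0) hXc hXr
      (by simp only [hX0]; linarith) continuousOn_const (fun x _ => hasDerivWithinAt_const _ _ _)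
      (fun x _ hxL => by
        simp only [f]
        rw [hxL, hcleq L (by linarith) le_rfl]
        have h1 := (hρm x).1; have h2 := (hpm x).2
        have : p x - ρ x * L ^ 2 < 0 := by nlinarith
        exact mul_neg_of_pos_of_neg hκ0 this) hv
  have hXe : ∀ v ∈ Icc α β, e * (v - α) ≤ X v := fun v hv => by
    have := image_le_of_deriv_right_lt_deriv_boundary' (f := fun v => - X v)
      (B := fun v => - (e * (v - α))) (B' := fun _ => - e) hXc.neg (fun x hx => (hXr x hx).neg)
      (by simp [hX0]) (by fun_prop) (fun x _ => by
        have : HasDerivAt (fun v : ℝ => -(e * (v - α))) (-(e * 1)) x :=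
          (((hasDerivAt_id x).sub_const α).const_mul e).neg
        simpa using this.hasDerivWithinAt)
      (fun x hx hxe => by
        have hXx : X x = e * (x - α) := neg_inj.mp hxe
        have h0 : 0 ≤ X x := by rw [hXx]; exact mul_nonneg he.le (by linarith [hx.1])
        rw [neg_lt_neg_iff]
        simp only [f]
        rw [hcleq _ h0 (hXL x (Ico_subset_Icc_self hx)), hXx]
        have h1 := (hρm x).2; have h2 := (hpm x).1; have h5 := (hρm x).1
        have h3 : (e * (x - α)) ^ 2 ≤ (e * (β - α)) ^ 2 := by
          have := hx.1; have := hx.2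
          have : 0 ≤ x - α := by linarith
          gcongr
        have h4 : ρ x * (e * (x - α)) ^ 2 ≤ A * (e * (β - α)) ^ 2 := by gcongr
        nlinarith) hv
    exact neg_le_neg_iff.mp this
  refine ⟨IccExtend hαβ.le ((Icc α β).domRestrict X), (continuousOn_iff_continuous_domRestrict.mp
    hXc).Icc_extend', ?_, fun v hv => ?_, fun v hv => ?_⟩
  · rw [IccExtend_of_mem _ _ (left_mem_Icc.mpr hαβ.le)]
    exact hX0
  · have hv' := Ioo_subset_Icc_self hv
    have h1 := (hX v hv').hasDerivAt (Icc_mem_nhds hv.1 hv.2)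
    have h2 : IccExtend hαβ.le ((Icc α β).domRestrict X) =ᶠ[nhds v] X :=
      Filter.eventuallyEq_of_mem (Icc_mem_nhds hv.1 hv.2) fun x hx => IccExtend_of_mem _ _ hx
    have h3 := h1.congr_of_eventuallyEq h2
    rw [h2.self_of_nhds]
    simp only [f] at h3
    rwa [hcleq _ ((mul_nonneg he.le (by linarith [hv.1])).trans (hXe v hv')) (hXL v hv')] at h3
  · rw [IccExtend_of_mem _ _ hv]
    exact ⟨hXe v hv, hXL v hv⟩

/-- The coefficients of the rescaled pressure equation `q' = ρY`, `Y' = k²pq + bf`. -/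
structure RiccatiCoeff (s α β δ c A M : ℝ) (p ρ : ℝ → ℝ) : Prop where
  lt : α < β
  δ_pos : 0 < δ
  c_pos : 0 < c
  M_nonneg : 0 ≤ M
  cont_p : Continuous p
  cont_ρ : Continuous ρ
  p_mem : ∀ v, p v ∈ Icc c A
  ρ_mem : ∀ v, ρ v ∈ Icc c A
  gevrey_p : GevreyOn s (Ioo α β) A M p
  gevrey_ρ : GevreyOn s (Ioo α β) A M ρ
  const_p : ∀ v ∈ Ioo α (α + δ), p v = p α
  const_ρ : ∀ v ∈ Ioo α (α + δ), ρ v = ρ α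

namespace RiccatiCoeff

variable {s α β δ c A M : ℝ} {p ρ : ℝ → ℝ}

lemma A_pos (h : RiccatiCoeff s α β δ c A M p ρ) : 0 < A :=
  h.c_pos.trans_le ((h.p_mem 0).1.trans (h.p_mem 0).2)

lemma contDiffAt_riccati (h : RiccatiCoeff s α β δ c A M p ρ) {κ : ℝ} {X : ℝ → ℝ}
    (hX : ∀ v ∈ Ioo α β, HasDerivAt X (κ * (p v - ρ v * X v ^ 2)) v) :
    ∀ v ∈ Ioo α β, ContDiffAt ℝ ∞ X v := by
  have : ContDiffOn ℝ ∞ X (Ioo α β) := by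
    refine contDiffOn_infty_of_deriv isOpen_Ioo
      (fun v hv => (hX v hv).differentiableAt.differentiableWithinAt) fun k hk => ?_
    have h1 : ContDiffOn ℝ k (fun v => κ * (p v - ρ v * X v ^ 2)) (Ioo α β) := fun v hv =>
      contDiffWithinAt_const.mul
        (((h.gevrey_p.smooth v hv).of_le (by exact_mod_cast le_top)).contDiffWithinAt.sub
        (((h.gevrey_ρ.smooth v hv).of_le (by exact_mod_cast le_top)).contDiffWithinAt.mul
          ((hk v hv).pow 2)))
    exact h1.congr fun v hv => (hX v hv).deriv
  exact fun v hv => this.contDiffAt (isOpen_Ioo.mem_nhds hv)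

/-- In the region of constant coefficients the Riccati solution approaches its equilibrium. -/
lemma riccati_relaxation (h : RiccatiCoeff s α β δ c A M p ρ) {e L v₀ : ℝ} (he : 0 < e)
    (hv₀ : α < v₀) (hv₀β : v₀ < β) (hv₀δ : v₀ < α + δ) {κ : ℝ} (hκ : 1 ≤ κ) {X : ℝ → ℝ}
    (hX : ∀ v ∈ Ioo α β, HasDerivAt X (κ * (p v - ρ v * X v ^ 2)) v)
    (hXb : ∀ v ∈ Icc α β, e * (v - α) ≤ X v ∧ X v ≤ L) :
    |p v₀ - ρ v₀ * X v₀ ^ 2| ≤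
      (A + A * L ^ 2) * Real.exp (-(κ * (c * (e * ((v₀ - α) / 2)) * ((v₀ - α) / 2)))) := by
  -- From the midpoint on, X ≥ e(v₁ - α), so the deviation D = p - ρX², which satisfies D' = -2κρXD,
  -- decays at rate at least 2r. Half of this pays for the weight e^{r(v-v₁)} in E, half for the
  -- maximum principle.
  set v₁ : ℝ := (α + v₀) / 2 with hv₁
  have h1 : α < v₁ := by rw [hv₁]; linarith
  have h2 : v₁ < v₀ := by rw [hv₁]; linarith
  have h3 : (v₀ - α) / 2 = v₁ - α := by rw [hv₁]; ring
  have h4 : (v₀ - α) / 2 = v₀ - v₁ := by rw [hv₁]; ring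
  have hc := h.c_pos
  have hA := h.A_pos
  set r : ℝ := κ * (c * (e * (v₁ - α))) with hr
  have hr0 : 0 < r := by
    have : 0 < v₁ - α := by linarith
    positivity
  let D : ℝ → ℝ := fun v => p α - ρ α * X v ^ 2
  let E : ℝ → ℝ := fun v => Real.exp (r * (v - v₁)) * D v
  have hmem : ∀ v ∈ Icc v₁ v₀, v ∈ Ioo α β := fun v hv =>
    ⟨h1.trans_le hv.1, hv.2.trans_lt hv₀β⟩
  have hpρ : ∀ v ∈ Icc v₁ v₀, p v = p α ∧ ρ v = ρ α := fun v hv =>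
    ⟨h.const_p v ⟨h1.trans_le hv.1, hv.2.trans_lt hv₀δ⟩,
      h.const_ρ v ⟨h1.trans_le hv.1, hv.2.trans_lt hv₀δ⟩⟩
  have hE : ∀ v ∈ Icc v₁ v₀, HasDerivAt E ((r - 2 * κ * ρ α * X v) * E v) v := by
    intro v hv
    have d1 := hX v (hmem v hv)
    rw [(hpρ v hv).1, (hpρ v hv).2] at d1
    have d2 : HasDerivAt D (-(ρ α * (2 * X v ^ 1 * (κ * (p α - ρ α * X v ^ 2))))) v := by
      simpa using ((d1.pow 2).const_mul (ρ α)).const_sub (p α)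
    have d3 : HasDerivAt (fun v => Real.exp (r * (v - v₁)))
        (Real.exp (r * (v - v₁)) * (r * 1)) v :=
      (((hasDerivAt_id v).sub_const v₁).const_mul r).exp
    refine (d3.mul d2).congr_deriv ?_
    simp only [E, D]
    ring
  have hbd : ∀ v ∈ Icc α β, |D v| ≤ A + A * L ^ 2 := by
    intro v hv
    have b1 := hXb v hv
    have b2 : 0 ≤ X v := (mul_nonneg he.le (by linarith [hv.1])).trans b1.1
    refine (abs_sub _ _).trans ?_
    rw [abs_of_pos (hc.trans_le (h.p_mem α).1), abs_mul, abs_of_pos (hc.trans_le (h.ρ_mem α).1),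
      abs_of_nonneg (sq_nonneg (X v))]
    have b3 := (h.p_mem α).2; have b4 := (h.ρ_mem α).2; have := b1.2
    gcongr
  have key := norm_le_of_damped (E := E) (E' := fun v => (r - 2 * κ * ρ α * X v) * E v)
    (a := v₁) (b := v₀) (Λ := r) (B := A + A * L ^ 2) hr0 (by positivity)
    (fun v hv => (hE v hv).continuousAt.continuousWithinAt)
    (fun v hv => hE v (Ico_subset_Icc_self hv)) (fun v hv => ?_) ?_ v₀ ⟨h2.le, le_rfl⟩
  · have hv₀' : v₀ ∈ Icc v₁ v₀ := ⟨h2.le, le_rfl⟩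
    rw [(hpρ v₀ hv₀').1, (hpρ v₀ hv₀').2]
    simp only [E, norm_mul, Real.norm_eq_abs, abs_of_pos (Real.exp_pos _)] at key
    have : κ * (c * (e * ((v₀ - α) / 2)) * ((v₀ - α) / 2)) = r * (v₀ - v₁) := by
      rw [hr, ← h4, h3]; ring
    rw [this, Real.exp_neg, ← div_eq_mul_inv, le_div_iff₀ (Real.exp_pos _), mul_comm]
    exact key
  · have hv' := Ico_subset_Icc_self hv
    have b1 := (hXb v (Ioo_subset_Icc_self (hmem v hv'))).1
    have b2 : r ≤ κ * ρ α * X v := by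
      rw [hr, mul_assoc]
      have : e * (v₁ - α) ≤ X v := le_trans (by gcongr; exact hv.1) b1
      have b3 := (h.ρ_mem α).1
      have : 0 < v₁ - α := by linarith
      have b5 := hc.trans_le b3
      gcongr
    have : inner ℝ (E v) ((r - 2 * κ * ρ α * X v) * E v) =
        (r - 2 * κ * ρ α * X v) * ‖E v‖ ^ 2 := by
      rw [Real.norm_eq_abs, sq_abs]
      simp [inner]
      ring
    rw [this]
    have b4 : 0 ≤ r * (A + A * L ^ 2) * ‖E v‖ := by positivity
    nlinarith [sq_nonneg ‖E v‖]
  · simp only [E, sub_self, mul_zero, Real.exp_zero, one_mul]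
    exact hbd v₁ ⟨h1.le, (h2.trans hv₀β).le⟩

end RiccatiCoeff

/-- Partial sums of the exponential series. -/
noncomputable def expPartialSum (m : ℕ) (x : ℝ) : ℝ :=
  ∑ i ∈ Finset.range (m + 1), x ^ i / (Nat.factorial i : ℝ)

lemma expPartialSum_mono {x : ℝ} (hx : 0 ≤ x) {m n : ℕ} (h : m ≤ n) :
    expPartialSum m x ≤ expPartialSum n x := by
  refine Finset.sum_le_sum_of_subset_of_nonneg ?_ fun i _ _ => by positivity
  intro i hi
  simp only [Finset.mem_range] at hi ⊢
  omega

lemma expPartialSum_nonneg {x : ℝ} (hx : 0 ≤ x) (m : ℕ) : 0 ≤ expPartialSum m x :=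
  Finset.sum_nonneg fun i _ => by positivity

lemma expPartialSum_mul_exp_neg_le {x : ℝ} (hx : 0 ≤ x) (m : ℕ) :
    expPartialSum m x * Real.exp (-x) ≤ 1 := by
  rw [Real.exp_neg, ← div_eq_mul_inv, div_le_one (Real.exp_pos _)]
  exact Real.sum_le_exp_of_nonneg hx (m + 1)

/-- Termwise, x·x^i/i! = (i+1)x^{i+1}/(i+1)!. For x = κγ this converts the factor κ produced by each
differentiation of the Riccati equation into the factor m + 1 that the weights can absorb. -/
lemma mul_expPartialSum_le {x : ℝ} (hx : 0 ≤ x) (m : ℕ) :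
    x * expPartialSum m x ≤ ((m : ℝ) + 1) * expPartialSum (m + 1) x := by
  unfold expPartialSum
  rw [Finset.sum_range_succ' _ (m + 1), Finset.mul_sum]
  have h1 : ∑ i ∈ Finset.range (m + 1), x * (x ^ i / (Nat.factorial i : ℝ)) ≤
      ∑ i ∈ Finset.range (m + 1), ((m : ℝ) + 1) * (x ^ (i + 1) / (Nat.factorial (i + 1) : ℝ)) := by
    refine Finset.sum_le_sum fun i hi => ?_
    have hi' : (i : ℝ) + 1 ≤ (m : ℝ) + 1 := by
      have := Finset.mem_range.mp hi
      exact_mod_cast this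
    have h2 : (0 : ℝ) < (Nat.factorial i : ℝ) := by exact_mod_cast Nat.factorial_pos i
    calc x * (x ^ i / (Nat.factorial i : ℝ))
        = ((i : ℝ) + 1) * (x ^ (i + 1) / (Nat.factorial (i + 1) : ℝ)) := by
          rw [Nat.factorial_succ]; push_cast; field_simp; ring
      _ ≤ _ := by gcongr
  refine h1.trans ?_
  rw [← Finset.mul_sum]
  gcongr
  simp

namespace RiccatiCoeff

variable {s α β δ c A M : ℝ} {p ρ : ℝ → ℝ}

/-- With constant coefficients only the quadratic term survives differentiation; m ≥ 1 is needed to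
remove κp. -/
lemma iteratedDeriv_riccati_const (h : RiccatiCoeff s α β δ c A M p ρ) {v₀ κ : ℝ}
    (hv₀ : v₀ ∈ Ioo α β) (hv₀δ : v₀ < α + δ) {X : ℝ → ℝ}
    (hX : ∀ v ∈ Ioo α β, HasDerivAt X (κ * (p v - ρ v * X v ^ 2)) v) {m : ℕ} (hm : 1 ≤ m) :
    iteratedDeriv (m + 1) X v₀ = -(κ * ρ α) * ∑ i ∈ Finset.range (m + 1),
      (m.choose i : ℝ) * iteratedDeriv i X v₀ * iteratedDeriv (m - i) X v₀ := by
  have hsm := (h.contDiffAt_riccati hX v₀ hv₀).of_le (show ((m : ℕ∞) : WithTop ℕ∞) ≤ ∞ by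
    exact_mod_cast le_top)
  have e1 : deriv X =ᶠ[nhds v₀] fun v => κ * p α + (-(κ * ρ α)) * (X v * X v) :=
    Filter.eventuallyEq_of_mem ((isOpen_Ioo.inter isOpen_Ioo).mem_nhds
      (⟨hv₀, ⟨hv₀.1, hv₀δ⟩⟩ : v₀ ∈ Ioo α β ∩ Ioo α (α + δ))) fun v hv => by
      rw [(hX v hv.1).deriv, h.const_p v hv.2, h.const_ρ v hv.2]; ring
  rw [iteratedDeriv_succ', e1.iteratedDeriv_eq m,
    iteratedDeriv_fun_add contDiffAt_const (contDiffAt_const.mul (hsm.mul hsm)),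
    iteratedDeriv_const, if_neg (by omega), zero_add, iteratedDeriv_const_mul_field,
    iteratedDeriv_fun_mul hsm hsm]

/-- Gevrey bounds at a point of the region of constant coefficients, uniformly in `κ`. -/
lemma riccati_initial (h : RiccatiCoeff s α β δ c A M p ρ) (hs : 0 < s) (hs1 : s ≤ 1)
    {e L v₀ : ℝ} (he : 0 < e) (hL : 0 < L) (hv₀ : v₀ ∈ Ioo α β) (hv₀δ : v₀ < α + δ) :
    ∃ B : ℝ, 0 < B ∧ ∀ κ : ℝ, 1 ≤ κ → ∀ X : ℝ → ℝ,
      (∀ v ∈ Ioo α β, HasDerivAt X (κ * (p v - ρ v * X v ^ 2)) v) →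
      (∀ v ∈ Icc α β, e * (v - α) ≤ X v ∧ X v ≤ L) →
      ∀ m : ℕ, 1 ≤ m → |iteratedDeriv m X v₀| ≤ B ^ m * gevreyWeight s m := by
  have hA := h.A_pos
  have hc := h.c_pos
  have hd : 0 < (v₀ - α) / 2 := by linarith [hv₀.1]
  set γ : ℝ := c * (e * ((v₀ - α) / 2)) * ((v₀ - α) / 2) with hγ
  have hγ0 : 0 < γ := by positivity
  -- The first summand serves m = 1, where the weight equals 1/4; the second dominates the constant
  -- of the recursion from m to m + 1.
  set B : ℝ := 4 * (A + A * L ^ 2) / γ * 4 + 32 * A * (1 + L) / γ with hB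
  have hB0 : 0 < B := by positivity
  refine ⟨B, hB0, fun κ hκ X hX hXb => ?_⟩
  have hκ0 : 0 < κ := by linarith
  set ε : ℝ := Real.exp (-(κ * γ)) with hε
  have hε0 : 0 < ε := Real.exp_pos _
  have hκγ : 0 ≤ κ * γ := by positivity
  have hSε : ∀ m, expPartialSum m (κ * γ) * ε ≤ 1 := expPartialSum_mul_exp_neg_le hκγ
  have hS0 : ∀ m, 0 ≤ expPartialSum m (κ * γ) := expPartialSum_nonneg hκγ
  have hX0 : |X v₀| ≤ L := by
    have := hXb v₀ (Ioo_subset_Icc_self hv₀)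
    rw [abs_of_nonneg ((mul_nonneg he.le (by linarith [hv₀.1])).trans this.1)]
    exact this.2
  -- The induction carries the truncated exponential of κγ times e^{-κγ}, a quantity at most 1 that
  -- still remembers the relaxation to equilibrium. In a product of two derivatives one such factor
  -- is kept and the other is bounded by 1.
  have key : ∀ m : ℕ, 1 ≤ m → |iteratedDeriv m X v₀| ≤
      B ^ m * gevreyWeight s m * (expPartialSum m (κ * γ) * ε) := by
    intro m
    induction m using Nat.strong_induction_on with
    | _ m ih =>
    intro hm
    obtain ⟨m, rfl⟩ : ∃ n, m = n + 1 := ⟨m - 1, by omega⟩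
    rcases Nat.eq_zero_or_pos m with rfl | hm'
    · have h1 := h.riccati_relaxation he hv₀.1 hv₀.2 hv₀δ hκ hX hXb
      rw [← hγ, ← hε] at h1
      rw [zero_add, iteratedDeriv_one, (hX v₀ hv₀).deriv, abs_mul, abs_of_pos hκ0]
      have h2 : κ * γ ≤ expPartialSum 1 (κ * γ) := by
        simp [expPartialSum, Finset.sum_range_succ]
      have h3 : gevreyWeight s 1 = 1 / 4 := by norm_num [gevreyWeight]
      have h4 : 4 * (A + A * L ^ 2) / γ * 4 ≤ B := by
        rw [hB]; have : 0 ≤ 32 * A * (1 + L) / γ := by positivity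
        linarith
      rw [h3, pow_one]
      calc κ * |p v₀ - ρ v₀ * X v₀ ^ 2| ≤ κ * ((A + A * L ^ 2) * ε) := by gcongr
        _ ≤ 4 * (κ * ((A + A * L ^ 2) * ε)) := by
          have : 0 ≤ κ * ((A + A * L ^ 2) * ε) := by positivity
          linarith
        _ = (4 * (A + A * L ^ 2) / γ * 4) * (1 / 4) * ((κ * γ) * ε) := by field_simp
        _ ≤ _ := by gcongr
    · rw [h.iteratedDeriv_riccati_const hv₀ hv₀δ hX hm', abs_mul, abs_neg,
        abs_of_pos (mul_pos hκ0 (hc.trans_le (h.ρ_mem α).1))]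
      set T : ℝ := expPartialSum m (κ * γ) * ε with hT
      have hT0 : 0 ≤ T := mul_nonneg (hS0 m) hε0.le
      have hterm : ∀ i ∈ Finset.range (m + 1),
          ‖(m.choose i : ℝ) * iteratedDeriv i X v₀ * iteratedDeriv (m - i) X v₀‖ ≤
            (1 + L) * B ^ m * T * ((m.choose i : ℝ) * gevreyWeight s i * gevreyWeight s (m - i)) := by
        intro i hi
        have hi' : i ≤ m := Nat.lt_succ_iff.mp (Finset.mem_range.mp hi)
        rw [norm_mul, norm_mul, Real.norm_of_nonneg (Nat.cast_nonneg _), Real.norm_eq_abs,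
          Real.norm_eq_abs]
        have w1 := gevreyWeight_pos s i
        have w2 := gevreyWeight_pos s (m - i)
        have w3 := gevreyWeight_pos s m
        have ihm := ih m (by omega) hm'
        rcases Nat.eq_zero_or_pos i with rfl | hi0
        · simp only [Nat.choose_zero_right, Nat.cast_one, one_mul, iteratedDeriv_zero, Nat.sub_zero,
            gevreyWeight_zero]
          calc _ ≤ (1 + L) * (B ^ m * gevreyWeight s m * T) := by
                gcongr; linarith
            _ = _ := by ring
        rcases hi'.eq_or_lt with rfl | him
        · simp only [Nat.choose_self, Nat.cast_one, one_mul, iteratedDeriv_zero, Nat.sub_self,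
            gevreyWeight_zero]
          calc _ ≤ (B ^ i * gevreyWeight s i * T) * (1 + L) := by
                gcongr; linarith
            _ = _ := by ring
        · have b1 := ih i (by omega) hi0
          have b2 := ih (m - i) (by omega) (by omega)
          have b3 : expPartialSum i (κ * γ) * ε ≤ T := by
            rw [hT]; gcongr; exact expPartialSum_mono hκγ hi'
          have b4 : 0 ≤ expPartialSum (m - i) (κ * γ) * ε := mul_nonneg (hS0 _) hε0.le
          calc _ ≤ (m.choose i : ℝ) * (B ^ i * gevreyWeight s i * T) *
                (B ^ (m - i) * gevreyWeight s (m - i) * 1) := by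
                gcongr
                · exact b1.trans (by gcongr)
                · exact b2.trans (by gcongr; exact hSε _)
            _ = 1 * (B ^ i * B ^ (m - i)) * T *
                ((m.choose i : ℝ) * gevreyWeight s i * gevreyWeight s (m - i)) := by ring
            _ ≤ _ := by
              rw [← pow_add, Nat.add_sub_cancel' hi']
              gcongr
              linarith
      have hsum := (norm_sum_le _ _).trans (Finset.sum_le_sum hterm)
      rw [← Finset.mul_sum, Real.norm_eq_abs] at hsum
      have hw := gevreyWeight_pos s m
      have hw1 := gevreyWeight_pos s (m + 1)
      have hS := mul_expPartialSum_le hκγ m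
      have hww := succ_mul_gevreyWeight_le hs hs1 m
      have hBB : 32 * A * (1 + L) / γ ≤ B := by
        rw [hB]; have : 0 ≤ 4 * (A + A * L ^ 2) / γ * 4 := by positivity
        linarith
      have hρA := (h.ρ_mem α).2
      calc _ ≤ (κ * A) * ((1 + L) * B ^ m * T * (8 * gevreyWeight s m)) := by
            gcongr
            refine hsum.trans ?_
            gcongr
            exact sum_choose_gevreyWeight_le hs hs1 m
        _ = 8 * A * (1 + L) / γ * B ^ m * ε * ((κ * γ * expPartialSum m (κ * γ)) *
              gevreyWeight s m) := by rw [hT]; field_simp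
        _ ≤ 8 * A * (1 + L) / γ * B ^ m * ε * ((((m : ℝ) + 1) * expPartialSum (m + 1) (κ * γ)) *
              gevreyWeight s m) := by gcongr
        _ = 8 * A * (1 + L) / γ * B ^ m * ε * expPartialSum (m + 1) (κ * γ) *
              (((m : ℝ) + 1) * gevreyWeight s m) := by ring
        _ ≤ 8 * A * (1 + L) / γ * B ^ m * ε * expPartialSum (m + 1) (κ * γ) *
              (4 * gevreyWeight s (m + 1)) := by
            have := hS0 (m + 1)
            gcongr
        _ = (32 * A * (1 + L) / γ) * B ^ m * gevreyWeight s (m + 1) *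
              (expPartialSum (m + 1) (κ * γ) * ε) := by ring
        _ ≤ B * B ^ m * gevreyWeight s (m + 1) * (expPartialSum (m + 1) (κ * γ) * ε) := by
            have := hS0 (m + 1)
            gcongr
        _ = _ := by rw [pow_succ']
  intro m hm
  have hw := gevreyWeight_pos s m
  calc _ ≤ _ := key m hm
    _ ≤ B ^ m * gevreyWeight s m * 1 := by gcongr; exact hSε m
    _ = _ := mul_one _

/-- Gevrey bounds for the Riccati solution away from the initial layer, uniformly in `κ`. -/
lemma riccati_gevrey (h : RiccatiCoeff s α β δ c A M p ρ) (hs : 0 < s) (hs1 : s ≤ 1)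
    {e L v₀ : ℝ} (he : 0 < e) (hL : 0 < L) (hv₀ : v₀ ∈ Ioo α β) (hv₀δ : v₀ < α + δ) :
    ∃ M' : ℝ, 0 < M' ∧ ∀ κ : ℝ, 1 ≤ κ → ∀ X : ℝ → ℝ,
      (∀ v ∈ Ioo α β, HasDerivAt X (κ * (p v - ρ v * X v ^ 2)) v) →
      (∀ v ∈ Icc α β, e * (v - α) ≤ X v ∧ X v ≤ L) →
      GevreyOn s (Ioo v₀ β) (L + 1) M' X := by
  obtain ⟨B, hB0, hB⟩ := h.riccati_initial hs hs1 he hL hv₀ hv₀δ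
  have hA := h.A_pos
  have hc := h.c_pos
  have hM := h.M_nonneg
  have hx0 : 0 < v₀ - α := by linarith [hv₀.1]
  set x₀ : ℝ := e * (v₀ - α) with hx₀
  have hx₀0 : 0 < x₀ := by positivity
  -- The available damping is 2cx₀ν. The choice of ν leaves half of it for the quadratic terms, of
  -- size 8Aν²; the choice of τ leaves the other half for the terms with derivatives on p or ρ.
  obtain ⟨ν, hν0, hν1, hν⟩ : ∃ ν : ℝ, 0 < ν ∧ ν ≤ 1 ∧ 8 * A * ν ≤ c * x₀ := by
    refine ⟨min 1 (c * x₀ / (8 * A)), by positivity, min_le_left _ _, ?_⟩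
    have := min_le_right 1 (c * x₀ / (8 * A))
    rw [le_div_iff₀ (by positivity)] at this
    linarith
  obtain ⟨τ, hτ0, hτ1, hτ⟩ : ∃ τ : ℝ, 0 < τ ∧ τ ≤ 1 ∧
      (A + 64 * A * (L + 1) ^ 2) * τ ≤ c * x₀ * ν := by
    refine ⟨min 1 (c * x₀ * ν / (A + 64 * A * (L + 1) ^ 2)), by positivity, min_le_left _ _, ?_⟩
    have := min_le_right 1 (c * x₀ * ν / (A + 64 * A * (L + 1) ^ 2))
    rw [le_div_iff₀ (by positivity)] at this
    linarith
  -- This gives M ≤ τM' and B ≤ νM', so the data at v₀ obey B^m ≤ νM'^m for m ≥ 1 and lie below the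
  -- barrier.
  set M' : ℝ := M / τ + B / ν with hM'
  have hM'0 : 0 < M' := by positivity
  have hMτ : M ≤ τ * M' := by
    rw [hM', mul_add, mul_div_cancel₀ _ hτ0.ne']
    have : 0 ≤ τ * (B / ν) := by positivity
    linarith
  have hMM' : M ≤ M' := hMτ.trans (mul_le_of_le_one_left hM'0.le hτ1)
  have hBν : B ≤ ν * M' := by
    rw [hM', mul_add, mul_div_cancel₀ _ hν0.ne']
    have : 0 ≤ ν * (M / τ) := by positivity
    linarith
  refine ⟨M', hM'0, fun κ hκ X hX hXb => ?_⟩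
  have hκ0 : 0 < κ := by linarith
  have hsm := h.contDiffAt_riccati hX
  have hmem : ∀ v ∈ Ico v₀ β, v ∈ Ioo α β := fun v hv => ⟨hv₀.1.trans_le hv.1, hv.2⟩
  have hXx : ∀ v ∈ Ico v₀ β, x₀ ≤ X v := fun v hv => by
    refine le_trans ?_ (hXb v (Ioo_subset_Icc_self (hmem v hv))).1
    rw [hx₀]; gcongr; exact hv.1
  have hXL : ∀ v ∈ Ico v₀ β, |X v| ≤ L := fun v hv => by
    rw [abs_of_pos (hx₀0.trans_le (hXx v hv))]
    exact (hXb v (Ioo_subset_Icc_self (hmem v hv))).2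
  have key : ∀ m : ℕ, 1 ≤ m → ∀ v ∈ Ico v₀ β,
      |iteratedDeriv m X v| ≤ ν * M' ^ m * gevreyWeight s m := by
    intro m
    induction m using Nat.strong_induction_on with
    | _ m ih =>
    intro hm v hv
    have hw := gevreyWeight_pos s m
    have hall : ∀ j < m, ∀ x ∈ Ico v₀ β,
        ‖iteratedDeriv j X x‖ ≤ (L + 1) * M' ^ j * gevreyWeight s j := by
      intro j hj x hx
      rcases Nat.eq_zero_or_pos j with rfl | hj0
      · simp only [iteratedDeriv_zero, pow_zero, gevreyWeight_zero, mul_one, Real.norm_eq_abs]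
        linarith [hXL x hx]
      · refine (ih j hj hj0 x hx).trans ?_
        have := gevreyWeight_pos s j
        gcongr
        linarith
    have hder : ∀ x ∈ Ioo α β, HasDerivAt (iteratedDeriv m X) (iteratedDeriv (m + 1) X x) x := by
      intro x hx
      rw [iteratedDeriv_succ]
      exact ((contDiffAt_iteratedDeriv (hsm x hx) m).differentiableAt (by simp)).hasDerivAt
    have hderiv : ∀ x ∈ Ico v₀ β, ∃ R : ℝ, |R| ≤ 2 * c * x₀ * (ν * M' ^ m * gevreyWeight s m) ∧
        iteratedDeriv (m + 1) X x = κ * (-(2 * ρ x * X x) * iteratedDeriv m X x + R) := by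
      intro x hx
      have hx' := hmem x hx
      have hm1 : ((m : ℕ∞) : WithTop ℕ∞) ≤ ∞ := by exact_mod_cast le_top
      have c1 := (h.gevrey_p.smooth x hx').of_le hm1
      have c2 := (h.gevrey_ρ.smooth x hx').of_le hm1
      have c3 := (hsm x hx').of_le hm1
      have e1 : deriv X =ᶠ[nhds x] fun v => κ * (p v - ρ v * (X v * X v)) :=
        Filter.eventuallyEq_of_mem (isOpen_Ioo.mem_nhds hx') fun v hv => by
          rw [(hX v hv).deriv]; ring
      have e2 : iteratedDeriv (m + 1) X x = κ * (iteratedDeriv m p x -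
          iteratedDeriv m (fun v => ρ v * (X v * X v)) x) := by
        rw [iteratedDeriv_succ', e1.iteratedDeriv_eq m, iteratedDeriv_const_mul_field,
          iteratedDeriv_fun_sub c1 (c2.mul (c3.mul c3))]
      have hZ : ∀ j < m, ‖iteratedDeriv j (fun v => X v * X v) x‖ ≤
          8 * (L + 1) ^ 2 * M' ^ j * gevreyWeight s j := by
        intro j hj
        have hm2 : ((j : ℕ∞) : WithTop ℕ∞) ≤ ∞ := by exact_mod_cast le_top
        rw [iteratedDeriv_fun_mul ((hsm x hx').of_le hm2) ((hsm x hx').of_le hm2)]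
        calc _ ≤ ∑ i ∈ Finset.range (j + 1), (L + 1) ^ 2 * M' ^ j *
              ((j.choose i : ℝ) * gevreyWeight s i * gevreyWeight s (j - i)) := by
              refine (norm_sum_le _ _).trans (Finset.sum_le_sum fun i hi => ?_)
              have hi' : i ≤ j := Nat.lt_succ_iff.mp (Finset.mem_range.mp hi)
              rw [norm_mul, norm_mul, Real.norm_of_nonneg (Nat.cast_nonneg _)]
              have w1 := gevreyWeight_pos s i
              have w2 := gevreyWeight_pos s (j - i)
              calc _ ≤ (j.choose i : ℝ) * ((L + 1) * M' ^ i * gevreyWeight s i) *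
                    ((L + 1) * M' ^ (j - i) * gevreyWeight s (j - i)) := by
                    gcongr
                    · exact hall i (by omega) x hx
                    · exact hall (j - i) (by omega) x hx
                _ = (L + 1) ^ 2 * (M' ^ i * M' ^ (j - i)) *
                    ((j.choose i : ℝ) * gevreyWeight s i * gevreyWeight s (j - i)) := by ring
                _ = _ := by rw [← pow_add, Nat.add_sub_cancel' hi']
          _ ≤ (L + 1) ^ 2 * M' ^ j * (8 * gevreyWeight s j) := by
              rw [← Finset.mul_sum]
              gcongr
              exact sum_choose_gevreyWeight_le hs hs1 j
          _ = _ := by ring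
      have e3 := GevreyOn.norm_iteratedDeriv_mul_sub_le hs hs1 hA.le
        (B := 8 * (L + 1) ^ 2) (by positivity) hM h.gevrey_ρ hx' ((hsm x hx').mul (hsm x hx'))
        (m := m) hτ0.le hMM' hMτ hZ
      obtain ⟨n, rfl⟩ : ∃ n, m = n + 1 := ⟨m - 1, by omega⟩
      -- The Leibniz terms of X² in which both factors are differentiated. The two extreme terms are
      -- set apart: they form 2X times the top derivative, which is the damping.
      set Q : ℝ := ∑ i ∈ Finset.range n, ((n + 1).choose (i + 1) : ℝ) * iteratedDeriv (i + 1) X x *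
        iteratedDeriv (n + 1 - (i + 1)) X x with hQ
      have e4 : iteratedDeriv (n + 1) (fun v => X v * X v) x =
          2 * X x * iteratedDeriv (n + 1) X x + Q := by
        rw [iteratedDeriv_fun_mul c3 c3, Finset.sum_range_succ, Finset.sum_range_succ']
        simp only [Nat.choose_zero_right, Nat.cast_one, one_mul, iteratedDeriv_zero, Nat.sub_zero,
          Nat.choose_self, Nat.sub_self, hQ]
        ring
      have e5 : |Q| ≤ 8 * ν ^ 2 * M' ^ (n + 1) * gevreyWeight s (n + 1) := by
        rw [← Real.norm_eq_abs]
        calc ‖Q‖ ≤ ∑ i ∈ Finset.range n, ν ^ 2 * M' ^ (n + 1) *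
              (((n + 1).choose (i + 1) : ℝ) * gevreyWeight s (i + 1) *
                gevreyWeight s (n + 1 - (i + 1))) := by
              refine (norm_sum_le _ _).trans (Finset.sum_le_sum fun i hi => ?_)
              have hi' : i < n := Finset.mem_range.mp hi
              rw [norm_mul, norm_mul, Real.norm_of_nonneg (Nat.cast_nonneg _)]
              have w1 := gevreyWeight_pos s (i + 1)
              have w2 := gevreyWeight_pos s (n + 1 - (i + 1))
              calc _ ≤ ((n + 1).choose (i + 1) : ℝ) *
                    (ν * M' ^ (i + 1) * gevreyWeight s (i + 1)) *
                    (ν * M' ^ (n + 1 - (i + 1)) * gevreyWeight s (n + 1 - (i + 1))) := by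
                    gcongr
                    · exact ih (i + 1) (by omega) (by omega) x hx
                    · exact ih (n + 1 - (i + 1)) (by omega) (by omega) x hx
                _ = ν ^ 2 * (M' ^ (i + 1) * M' ^ (n + 1 - (i + 1))) *
                    (((n + 1).choose (i + 1) : ℝ) * gevreyWeight s (i + 1) *
                      gevreyWeight s (n + 1 - (i + 1))) := by ring
                _ = _ := by rw [← pow_add, Nat.add_sub_cancel' (show i + 1 ≤ n + 1 by omega)]
          _ ≤ ν ^ 2 * M' ^ (n + 1) * (8 * gevreyWeight s (n + 1)) := by
              rw [← Finset.mul_sum]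
              gcongr
              refine le_trans ?_ (sum_choose_gevreyWeight_le hs hs1 (n + 1))
              rw [Finset.sum_range_succ _ (n + 1), Finset.sum_range_succ' _ n]
              have w1 := gevreyWeight_pos s 0
              simp only [Nat.choose_zero_right, Nat.cast_one, one_mul, Nat.sub_zero,
                Nat.choose_self, Nat.sub_self, add_assoc, le_add_iff_nonneg_right]
              positivity
          _ = _ := by ring
      refine ⟨iteratedDeriv (n + 1) p x - (iteratedDeriv (n + 1) (fun v => ρ v * (X v * X v)) x -
        ρ x * iteratedDeriv (n + 1) (fun v => X v * X v) x) - ρ x * Q, ?_, by rw [e2, e4]; ring⟩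
      have e6 : |iteratedDeriv (n + 1) p x| ≤ A * τ * M' ^ (n + 1) * gevreyWeight s (n + 1) := by
        refine (h.gevrey_p.bound (n + 1) x hx').trans ?_
        have : M ^ (n + 1) ≤ τ * M' ^ (n + 1) := by
          calc M ^ (n + 1) = M ^ n * M := pow_succ _ _
            _ ≤ M' ^ n * (τ * M') := by gcongr
            _ = _ := by ring
        calc _ ≤ A * (τ * M' ^ (n + 1)) * gevreyWeight s (n + 1) := by gcongr
          _ = _ := by ring
      have e7 : |ρ x * Q| ≤ A * (8 * ν ^ 2 * M' ^ (n + 1) * gevreyWeight s (n + 1)) := by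
        rw [abs_mul, abs_of_pos (hc.trans_le (h.ρ_mem x).1)]
        have := (h.ρ_mem x).2
        gcongr
      refine (abs_sub _ _).trans ((add_le_add (abs_sub _ _) e7).trans ?_)
      rw [Real.norm_eq_abs] at e3
      have hP : 0 ≤ M' ^ (n + 1) * gevreyWeight s (n + 1) := by positivity
      have e8 : A * τ + 8 * A * (8 * (L + 1) ^ 2) * τ + A * (8 * ν ^ 2) ≤ 2 * c * x₀ * ν := by
        have : 8 * A * ν * ν ≤ c * x₀ * ν := by gcongr
        nlinarith
      calc _ ≤ A * τ * M' ^ (n + 1) * gevreyWeight s (n + 1) +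
            8 * A * (8 * (L + 1) ^ 2) * τ * M' ^ (n + 1) * gevreyWeight s (n + 1) +
            A * (8 * ν ^ 2 * M' ^ (n + 1) * gevreyWeight s (n + 1)) := by gcongr
        _ = (A * τ + 8 * A * (8 * (L + 1) ^ 2) * τ + A * (8 * ν ^ 2)) *
            (M' ^ (n + 1) * gevreyWeight s (n + 1)) := by ring
        _ ≤ (2 * c * x₀ * ν) * (M' ^ (n + 1) * gevreyWeight s (n + 1)) := by gcongr
        _ = _ := by ring
    have hsub : ∀ x ∈ Icc v₀ v, x ∈ Ico v₀ β := fun x hx => ⟨hx.1, hx.2.trans_lt hv.2⟩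
    refine norm_le_of_damped (E := iteratedDeriv m X) (E' := iteratedDeriv (m + 1) X) (a := v₀)
      (b := v) (Λ := κ * (2 * c * x₀)) (B := ν * M' ^ m * gevreyWeight s m) (by positivity)
      (by positivity) (fun x hx => (hder x (hmem x (hsub x hx))).continuousAt.continuousWithinAt)
      (fun x hx => hder x (hmem x (hsub x (Ico_subset_Icc_self hx)))) (fun x hx => ?_) ?_ v
      ⟨hv.1, le_rfl⟩
    · have hx' := hsub x (Ico_subset_Icc_self hx)
      obtain ⟨R, hR, hRe⟩ := hderiv x hx'
      rw [hRe]
      set E := iteratedDeriv m X x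
      have i1 : inner ℝ E (κ * (-(2 * ρ x * X x) * E + R)) =
          -(κ * (2 * (ρ x * X x))) * ‖E‖ ^ 2 + κ * (R * E) := by
        rw [Real.norm_eq_abs, sq_abs]
        simp [inner]
        ring
      rw [i1]
      have i2 : R * E ≤ 2 * c * x₀ * (ν * M' ^ m * gevreyWeight s m) * ‖E‖ := by
        refine (le_abs_self _).trans ?_
        rw [abs_mul, Real.norm_eq_abs]
        gcongr
      have i3 : c * x₀ ≤ ρ x * X x :=
        mul_le_mul (h.ρ_mem x).1 (hXx x hx') hx₀0.le (hc.trans_le (h.ρ_mem x).1).le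
      have i4 : κ * (2 * c * x₀) * ‖E‖ ^ 2 ≤ κ * (2 * (ρ x * X x)) * ‖E‖ ^ 2 := by
        rw [mul_assoc 2 c x₀]
        gcongr
      have i5 : κ * (R * E) ≤ κ * (2 * c * x₀ * (ν * M' ^ m * gevreyWeight s m) * ‖E‖) := by
        gcongr
      linarith
    · refine (hB κ hκ X hX hXb m hm).trans ?_
      gcongr
      calc B ^ m ≤ (ν * M') ^ m := by gcongr
        _ = ν ^ m * M' ^ m := mul_pow _ _ _
        _ ≤ ν * M' ^ m := by
          gcongr
          exact pow_le_of_le_one hν0.le hν1 (by omega)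
  refine ⟨fun v hv => hsm v (hmem v (Ioo_subset_Ico_self hv)), fun m v hv => ?_⟩
  have hv' := Ioo_subset_Ico_self hv
  rcases Nat.eq_zero_or_pos m with rfl | hm
  · simp only [iteratedDeriv_zero, pow_zero, gevreyWeight_zero, mul_one, Real.norm_eq_abs]
    linarith [hXL v hv']
  · refine (key m hm v hv').trans ?_
    have := gevreyWeight_pos s m
    gcongr
    linarith

end RiccatiCoeff

/-! ### Decay of Fourier transforms -/

lemma one_le_bracket (x : ℝ) : 1 ≤ bracket x := by
  unfold bracket
  rw [Real.one_le_sqrt]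
  nlinarith [sq_nonneg x]

lemma bracket_sq (x : ℝ) : bracket x ^ 2 = 1 + x ^ 2 := Real.sq_sqrt (by positivity)

lemma bracket_rpow_le {s : ℝ} (hs : 0 < s) (hs1 : s ≤ 1) (x : ℝ) :
    bracket x ^ s ≤ 1 + |x| ^ s := by
  have h1 : bracket x ≤ 1 + |x| := by
    unfold bracket
    rw [Real.sqrt_le_left (by positivity)]
    nlinarith [abs_nonneg x, sq_abs x]
  have h0 : 0 ≤ bracket x := zero_le_one.trans (one_le_bracket x)
  calc bracket x ^ s ≤ (1 + |x|) ^ s := by gcongr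
    _ ≤ 1 ^ s + |x| ^ s := Real.rpow_add_le_add_rpow zero_le_one (abs_nonneg x) hs.le hs1
    _ = _ := by rw [Real.one_rpow]

lemma gevreyWeight_le_factorial (s : ℝ) (m : ℕ) :
    gevreyWeight s m ≤ (Nat.factorial m : ℝ) ^ (1 / s) := by
  unfold gevreyWeight
  refine div_le_self (by positivity) ?_
  nlinarith [Nat.cast_nonneg (α := ℝ) m]

/-- Gevrey moment bounds give stretched exponential decay. -/
lemma exists_stretched_exp_bound {s M : ℝ} (hs : 0 < s) (hs1 : s ≤ 1) (hM : 0 < M) :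
    ∃ C lam : ℝ, 0 < C ∧ 0 < lam ∧ ∀ x y B : ℝ, 0 ≤ y → 0 ≤ B →
      (∀ m : ℕ, |x| ^ m * y ≤ B * M ^ m * gevreyWeight s m) →
      y ≤ C * B * Real.exp (-lam * bracket x ^ s) := by
  -- l₀M^s = 1/2: raise the moment bounds to the power s, multiply by l₀^m/m! and sum over m. The
  -- left side becomes an exponential, the right side a geometric series.
  set l₀ : ℝ := 1 / (2 * M ^ s) with hl₀
  have hMs : 0 < M ^ s := Real.rpow_pos_of_pos hM s
  have hl₀0 : 0 < l₀ := by positivity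
  refine ⟨2 ^ (1 / s) * Real.exp (l₀ / s), l₀ / s, by positivity, by positivity,
    fun x y B hy hB h => ?_⟩
  have hx : 0 ≤ |x| := abs_nonneg x
  set z : ℝ := |x| ^ s with hz
  have hz0 : 0 ≤ z := Real.rpow_nonneg hx s
  have h1 : ∀ m : ℕ, (l₀ * z) ^ m / (Nat.factorial m : ℝ) * y ^ s ≤ B ^ s * (1 / 2) ^ m := by
    intro m
    have hf : (0 : ℝ) < (Nat.factorial m : ℝ) := by exact_mod_cast Nat.factorial_pos m
    have h2 : (|x| ^ m * y) ^ s ≤ (B * M ^ m * (Nat.factorial m : ℝ) ^ (1 / s)) ^ s := by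
      refine Real.rpow_le_rpow (by positivity) ((h m).trans ?_) hs.le
      gcongr
      exact gevreyWeight_le_factorial s m
    have e1 : (|x| ^ m * y) ^ s = z ^ m * y ^ s := by
      rw [Real.mul_rpow (by positivity) hy, hz, ← Real.rpow_natCast, ← Real.rpow_natCast,
        ← Real.rpow_mul hx, ← Real.rpow_mul hx, mul_comm s]
    have e2 : (B * M ^ m * (Nat.factorial m : ℝ) ^ (1 / s)) ^ s =
        B ^ s * (M ^ s) ^ m * (Nat.factorial m : ℝ) := by
      rw [Real.mul_rpow (by positivity) (by positivity), Real.mul_rpow hB (by positivity),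
        ← Real.rpow_mul hf.le, one_div, inv_mul_cancel₀ hs.ne', Real.rpow_one,
        ← Real.rpow_natCast, ← Real.rpow_natCast, ← Real.rpow_mul hM.le, ← Real.rpow_mul hM.le,
        mul_comm s]
    rw [e1, e2] at h2
    have e3 : l₀ ^ m * (M ^ s) ^ m = (1 / 2) ^ m := by
      rw [← mul_pow, hl₀]
      congr 1
      field_simp
    calc (l₀ * z) ^ m / (Nat.factorial m : ℝ) * y ^ s
        = l₀ ^ m * (z ^ m * y ^ s) / (Nat.factorial m : ℝ) := by rw [mul_pow]; ring
      _ ≤ l₀ ^ m * (B ^ s * (M ^ s) ^ m * (Nat.factorial m : ℝ)) / (Nat.factorial m : ℝ) := by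
          gcongr
      _ = B ^ s * (l₀ ^ m * (M ^ s) ^ m) := by field_simp
      _ = _ := by rw [e3]
  have h2 : Real.exp (l₀ * z) * y ^ s ≤ B ^ s * 2 := by
    have s1 : HasSum (fun m : ℕ => (l₀ * z) ^ m / (Nat.factorial m : ℝ)) (Real.exp (l₀ * z)) := by
      rw [Real.exp_eq_exp_ℝ]
      exact NormedSpace.expSeries_div_hasSum_exp (l₀ * z)
    exact hasSum_le h1 (s1.mul_right _) (hasSum_geometric_two.mul_left _)
  have h3 : y ^ s ≤ 2 * B ^ s * Real.exp (-(l₀ * z)) := by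
    rw [Real.exp_neg, ← div_eq_mul_inv, le_div_iff₀ (Real.exp_pos _)]
    linarith
  have h4 : y ≤ 2 ^ (1 / s) * B * Real.exp (-(l₀ / s * z)) := by
    have := Real.rpow_le_rpow (Real.rpow_nonneg hy s) h3 (by positivity : 0 ≤ 1 / s)
    rw [Real.mul_rpow (by positivity) (by positivity), Real.mul_rpow (by norm_num) (by positivity),
      ← Real.rpow_mul hy, ← Real.rpow_mul hB, mul_one_div_cancel hs.ne', Real.rpow_one,
      Real.rpow_one, ← Real.exp_mul] at this
    refine this.trans (le_of_eq ?_)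
    congr 2
    ring
  have h5 := bracket_rpow_le hs hs1 x
  calc y ≤ 2 ^ (1 / s) * B * Real.exp (-(l₀ / s * z)) := h4
    _ ≤ 2 ^ (1 / s) * B * Real.exp (l₀ / s + -(l₀ / s) * bracket x ^ s) := by
        gcongr
        have : 0 < l₀ / s := by positivity
        nlinarith
    _ = _ := by rw [Real.exp_add]; ring

/-- Stretched exponential decay of the Fourier transform of a compactly supported Gevrey
function. -/
lemma exists_fourier_decay {s M a b : ℝ} (hs : 0 < s) (hs1 : s ≤ 1) (hM : 0 < M) (hab : a < b) :
    ∃ C lam : ℝ, 0 < C ∧ 0 < lam ∧ ∀ (B : ℝ) (f : ℝ → ℂ), 0 ≤ B → ContDiff ℝ ∞ f →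
      tsupport f ⊆ Icc a b →
      (∀ (m : ℕ) (v : ℝ), ‖iteratedDeriv m f v‖ ≤ B * M ^ m * gevreyWeight s m) →
      ∀ x : ℝ, ‖∫ v : ℝ, f v * Complex.exp (-(Complex.I * (v : ℂ) * (x : ℂ)))‖ ≤
        C * B * Real.exp (-lam * bracket x ^ s) := by
  obtain ⟨C, lam, hC, hlam, h⟩ := exists_stretched_exp_bound hs hs1 hM
  refine ⟨C * (b - a), lam, mul_pos hC (by linarith), hlam, fun B f hB hf hsupp hbd x => ?_⟩
  have hcs : HasCompactSupport f := isCompact_Icc.of_isClosed_subset (isClosed_tsupport f) hsupp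
  have hsm : ∀ m : ℕ, tsupport (iteratedDeriv m f) ⊆ tsupport f := by
    intro m
    induction m with
    | zero => simp
    | succ m ih => rw [iteratedDeriv_succ]; exact tsupport_deriv_subset.trans ih
  have hci : ∀ m : ℕ, Continuous (iteratedDeriv m f) := fun m =>
    hf.continuous_iteratedDeriv m (by exact_mod_cast le_top)
  have hint : ∀ m : ℕ, Integrable (iteratedDeriv m f) := fun m =>
    (hci m).integrable_of_hasCompactSupport (hcs.mono' ((subset_tsupport _).trans (hsm m)))
  have hL1 : ∀ m : ℕ, ∫ v, ‖iteratedDeriv m f v‖ ≤ (b - a) * B * M ^ m * gevreyWeight s m := by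
    intro m
    have e1 : ∫ v, ‖iteratedDeriv m f v‖ = ∫ v in Icc a b, ‖iteratedDeriv m f v‖ := by
      rw [setIntegral_eq_integral_of_forall_compl_eq_zero]
      intro v hv
      rw [image_eq_zero_of_notMem_tsupport (fun h => hv (hsupp (hsm m h))), norm_zero]
    rw [e1]
    have := norm_setIntegral_le_of_norm_le_const (μ := volume) (s := Icc a b)
      (f := fun v => ‖iteratedDeriv m f v‖) (C := B * M ^ m * gevreyWeight s m)
      (by simp) (fun v _ => by simpa using hbd m v)
    refine (le_abs_self _).trans (this.trans (le_of_eq ?_))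
    simp [measureReal_def, hab.le]
    ring
  have hfour : ∀ g : ℝ → ℂ, ∫ v : ℝ, g v * Complex.exp (-(Complex.I * (v : ℂ) * (x : ℂ))) =
      FourierTransform.fourier g (x / (2 * Real.pi)) := by
    intro g
    rw [Real.fourier_eq']
    congr 1
    ext v
    rw [smul_eq_mul, mul_comm]
    congr 2
    simp
    field_simp
  rw [hfour]
  have := h x ‖FourierTransform.fourier f (x / (2 * Real.pi))‖ ((b - a) * B) (norm_nonneg _)
    (mul_nonneg (by linarith) hB) (fun m => ?_)
  · refine this.trans (le_of_eq ?_); ring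
  -- The m-th moment of the transform is the transform of the m-th derivative, hence at most its L¹
  -- norm.
  · have e1 := Real.fourier_iteratedDeriv (N := ⊤) (n := m) hf (fun n _ => hint n) le_top
    have e2 := congrFun e1 (x / (2 * Real.pi))
    have e3 : ‖FourierTransform.fourier (iteratedDeriv m f) (x / (2 * Real.pi))‖ =
        |x| ^ m * ‖FourierTransform.fourier f (x / (2 * Real.pi))‖ := by
      rw [e2, norm_smul, norm_pow]
      congr 2
      simp [abs_of_pos Real.pi_pos]
      field_simp
    rw [← e3]
    exact (VectorFourier.norm_fourierIntegral_le_integral_norm _ _ _ _ _).trans (hL1 m)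

/-- The inequality 1 + κ² + ξ² ≤ 4(κ + |η|)²(1 + (ξ-η)²) moves the weight from η to ξ, and half of
the exponential pays for the polynomial loss. Because s > 1/2, the loss is at most the fourth power
of ⟨ξ-η⟩^s, which one Taylor term of the exponential controls. -/
lemma exists_kernel_weight_bound {s lam : ℝ} (hs : 1 / 2 < s) (hlam : 0 < lam) :
    ∃ C : ℝ, 0 < C ∧ ∀ κ ξ η : ℝ, 1 ≤ κ →
      Real.exp (-lam * bracket (ξ - η) ^ s) / (κ + |η|) ^ 2 ≤ C * min
        (Real.exp (-(lam / 2) * bracket (ξ - η) ^ s) / (1 + κ ^ 2 + ξ ^ 2))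
        (Real.exp (-(lam / 2) * bracket (ξ - η) ^ s) / (1 + κ ^ 2 + η ^ 2)) := by
  have hs0 : 0 < s := by linarith
  set D : ℝ := 1 + 24 / (lam / 2) ^ 4 with hD
  have hD1 : 1 ≤ D := by rw [hD]; have : 0 ≤ 24 / (lam / 2) ^ 4 := by positivity
                         linarith
  refine ⟨4 * D, by positivity, fun κ ξ η hκ => ?_⟩
  set x : ℝ := ξ - η with hx
  set t : ℝ := bracket x ^ s with ht
  have hb1 := one_le_bracket x
  have ht1 : 1 ≤ t := Real.one_le_rpow hb1 hs0.le
  have h1 : 1 + x ^ 2 ≤ t ^ 4 := by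
    rw [← bracket_sq, ht, ← Real.rpow_natCast, ← Real.rpow_natCast, ← Real.rpow_mul (by linarith)]
    refine Real.rpow_le_rpow_of_exponent_le hb1 ?_
    push_cast
    linarith
  have h2 : t ^ 4 ≤ D * Real.exp (lam / 2 * t) := by
    have := Real.pow_div_factorial_le_exp (lam / 2 * t) (by positivity) 4
    have e : (Nat.factorial 4 : ℝ) = 24 := by norm_num [Nat.factorial]
    rw [e, div_le_iff₀ (by norm_num), mul_pow] at this
    have h3 : t ^ 4 ≤ 24 / (lam / 2) ^ 4 * Real.exp (lam / 2 * t) := by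
      rw [div_mul_eq_mul_div, le_div_iff₀ (by positivity)]
      linarith
    have := Real.exp_pos (lam / 2 * t)
    rw [hD]
    nlinarith
  have h3 : Real.exp (-lam * t) * (1 + x ^ 2) ≤ D * Real.exp (-(lam / 2) * t) := by
    calc Real.exp (-lam * t) * (1 + x ^ 2)
        ≤ Real.exp (-lam * t) * (D * Real.exp (lam / 2 * t)) := by
          gcongr; exact h1.trans h2
      _ = D * (Real.exp (-lam * t) * Real.exp (lam / 2 * t)) := by ring
      _ = _ := by rw [← Real.exp_add]; congr 2; ring
  have h4 : 1 + κ ^ 2 + η ^ 2 ≤ 2 * (κ + |η|) ^ 2 := by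
    nlinarith [abs_nonneg η, sq_abs η]
  have h5 : 1 + κ ^ 2 + ξ ^ 2 ≤ 4 * (κ + |η|) ^ 2 * (1 + x ^ 2) := by
    have : 1 + κ ^ 2 + ξ ^ 2 ≤ 2 * (1 + κ ^ 2 + η ^ 2) * (1 + x ^ 2) := by
      have : ξ = x + η := by rw [hx]; ring
      rw [this]
      nlinarith [sq_nonneg (x - η), sq_nonneg (κ * x), sq_nonneg (η * x), sq_nonneg x]
    nlinarith [sq_nonneg x]
  have hE := Real.exp_pos (-lam * t)
  have hE2 := Real.exp_pos (-(lam / 2) * t)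
  have hκη : 0 < κ + |η| := by linarith [abs_nonneg η]
  rw [mul_min_of_nonneg _ _ (by positivity)]
  refine le_min ?_ ?_
  · rw [← mul_div_assoc, div_le_div_iff₀ (by positivity) (by positivity)]
    calc _ ≤ Real.exp (-lam * t) * (4 * (κ + |η|) ^ 2 * (1 + x ^ 2)) := by gcongr
      _ = 4 * (κ + |η|) ^ 2 * (Real.exp (-lam * t) * (1 + x ^ 2)) := by ring
      _ ≤ 4 * (κ + |η|) ^ 2 * (D * Real.exp (-(lam / 2) * t)) := by gcongr
      _ = _ := by ring
  · rw [← mul_div_assoc, div_le_div_iff₀ (by positivity) (by positivity)]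
    have h6 : Real.exp (-lam * t) ≤ D * Real.exp (-(lam / 2) * t) := by
      refine le_trans ?_ h3
      nlinarith [sq_nonneg x]
    calc _ ≤ (D * Real.exp (-(lam / 2) * t)) * (2 * (κ + |η|) ^ 2) := by gcongr
      _ ≤ _ := by
        have : 0 ≤ (D * Real.exp (-(lam / 2) * t)) * (κ + |η|) ^ 2 := by positivity
        nlinarith

/-! ### First order equations with strong damping and fast phase. -/

/-- Scalar linear equations with continuous coefficients are solvable on the whole line, and the
solution with zero data vanishes as long as the source does. -/
lemma exists_linear_ode {l g : ℝ → ℂ} (hl : Continuous l) (hg : Continuous g) (v₀ : ℝ) :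
    ∃ N : ℝ → ℂ, N v₀ = 0 ∧ (∀ v, HasDerivAt N (l v * N v + g v) v) ∧
      ∀ v, (∀ w ∈ uIcc v₀ v, g w = 0) → N v = 0 := by
  let Λ : ℝ → ℂ := fun v => ∫ w in v₀..v, l w
  have hΛ : ∀ v, HasDerivAt Λ (l v) v := fun v =>
    intervalIntegral.integral_hasDerivAt_right (hl.intervalIntegrable _ _)
      hl.stronglyMeasurable.stronglyMeasurableAtFilter hl.continuousAt
  have hΛc : Continuous Λ := continuous_iff_continuousAt.mpr fun v => (hΛ v).continuousAt
  have hk : Continuous fun w => Complex.exp (-Λ w) * g w := by fun_prop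
  refine ⟨fun v => Complex.exp (Λ v) * ∫ w in v₀..v, Complex.exp (-Λ w) * g w, by simp,
    fun v => ?_, fun v hv => ?_⟩
  · have h2 := intervalIntegral.integral_hasDerivAt_right (hk.intervalIntegrable v₀ v)
      hk.stronglyMeasurable.stronglyMeasurableAtFilter hk.continuousAt
    refine ((hΛ v).cexp.mul h2).congr_deriv ?_
    have : Complex.exp (Λ v) * Complex.exp (-Λ v) = 1 := by rw [← Complex.exp_add]; simp
    linear_combination g v * this
  · have : ∫ w in v₀..v, Complex.exp (-Λ w) * g w = 0 :=
      intervalIntegral.integral_zero_ae (Filter.Eventually.of_forall fun w hw => by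
        rw [hv w (uIoc_subset_uIcc hw), mul_zero])
    simp [this]

namespace GevreyOn

/-- The bound for a damped equation gains one power of `κ + |η|`. -/
lemma exists_of_damped_ode {s A M H c : ℝ} (hs : 1 / 2 < s) (hs1 : s ≤ 1) (hA : 0 ≤ A)
    (hM : 0 < M) (hH : 0 ≤ H) (hc : 0 < c) :
    ∃ H' M' : ℝ, 0 ≤ H' ∧ M ≤ M' ∧ ∀ (a b a' : ℝ), a < a' → ∀ (μ h n : ℝ → ℂ),
      GevreyOn s (Ioo a b) A M μ → (∀ v ∈ Ioo a b, c ≤ (μ v).re) →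
      GevreyOn s (Ioo a b) H M h → ∀ κ η : ℝ, 1 ≤ κ →
      (∀ v ∈ Ioo a b, HasDerivAt n (-((κ : ℂ) * μ v + Complex.I * η) * n v + h v) v) →
      (∀ v ∈ Ioo a a', n v = 0) → GevreyOn s (Ioo a b) (H' / (κ + |η|)) M' n := by
  have hs0 : 0 < s := by linarith
  set M₁ := M * ((16 * A + c) / c) with hM₁
  have hMM₁ : M ≤ M₁ := le_mul_of_one_le_right hM.le (by rw [le_div_iff₀ hc]; linarith)
  have hM₁0 : 0 < M₁ := hM.trans_le hMM₁
  refine ⟨2 * H / c + (H + 2 * H / c * M₁ + 16 * A * H / c), 4 * M₁, by positivity, by linarith,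
    fun a b a' ha' μ h n hμ hμc hh κ η hκ hn hn0 => ?_⟩
  have hκ0 : 0 < κ := by linarith
  have h1 := of_damped_ode hs0 hs1 hA hM.le hH hc ha' hμ hμc hh hκ0 hn hn0
  rw [← hM₁] at h1
  have hK0 : 0 ≤ 2 * H / (c * κ) := by positivity
  have h2 := h1.deriv hs hK0 hM₁0.le
  have h3 := ((hμ.mono hA hM.le le_rfl hMM₁).mul hs0 hs1 hA hK0 hM₁0.le h1).const_mul (κ : ℂ)
  have h4 : M₁ ≤ 4 * M₁ := by linarith
  have h5 := ((hh.mono hH hM.le le_rfl (hMM₁.trans h4)).sub h2).sub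
    (h3.mono (by positivity) hM₁0.le le_rfl h4)
  have h6 : EqOn (fun v => h v - _root_.deriv n v - (κ : ℂ) * (μ v * n v))
      (fun v => (Complex.I * η) * n v) (Ioo a b) := fun v hv => by
    simp only [(hn v hv).deriv]; ring
  have h7 := h5.congr isOpen_Ioo h6
  have hκη : 0 < κ + |η| := by linarith [abs_nonneg η]
  refine ⟨h1.smooth, fun m v hv => ?_⟩
  have h8 := h7.bound m v hv
  have h9 := h1.bound m v hv
  rw [iteratedDeriv_const_mul_field, norm_mul, norm_mul, Complex.norm_I, one_mul,
    Complex.norm_real, Real.norm_eq_abs, Complex.norm_real, Real.norm_of_nonneg hκ0.le] at h8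
  have hw := gevreyWeight_pos s m
  have h10 : κ * ‖iteratedDeriv m n v‖ ≤ 2 * H / c * (4 * M₁) ^ m * gevreyWeight s m := by
    calc _ ≤ κ * (2 * H / (c * κ) * M₁ ^ m * gevreyWeight s m) := by gcongr
      _ = 2 * H / c * M₁ ^ m * gevreyWeight s m := by field_simp
      _ ≤ _ := by gcongr
  have h11 : H + 2 * H / (c * κ) * M₁ + κ * (8 * A * (2 * H / (c * κ))) ≤
      H + 2 * H / c * M₁ + 16 * A * H / c := by
    have e1 : κ * (8 * A * (2 * H / (c * κ))) = 16 * A * H / c := by field_simp; ring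
    have e2 : 2 * H / (c * κ) ≤ 2 * H / c := by
      gcongr; exact le_mul_of_one_le_right hc.le hκ
    rw [e1]
    gcongr
  rw [div_mul_eq_mul_div, div_mul_eq_mul_div, le_div_iff₀ hκη]
  calc _ = κ * ‖iteratedDeriv m n v‖ + |η| * ‖iteratedDeriv m n v‖ := by ring
    _ ≤ 2 * H / c * (4 * M₁) ^ m * gevreyWeight s m +
        (H + 2 * H / c * M₁ + 16 * A * H / c) * (4 * M₁) ^ m * gevreyWeight s m := by
        refine add_le_add h10 (h8.trans ?_)
        gcongr
    _ = _ := by ring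

/-- The difference of the two factors gains a second power of `κ + |η|`. -/
lemma sub_of_damped_ode {s A M G : ℝ} (hs : 1 / 2 < s) (hs1 : s ≤ 1) (hA : 0 ≤ A) (hM : 0 < M)
    (hG : 0 ≤ G) {a b : ℝ} {μ₁ μ₂ h n₁ n₂ : ℝ → ℂ} (hμ₁ : GevreyOn s (Ioo a b) A M μ₁)
    (hμ₂ : GevreyOn s (Ioo a b) A M μ₂) (hn₁ : GevreyOn s (Ioo a b) G M n₁)
    (hn₂ : GevreyOn s (Ioo a b) G M n₂) {κ η : ℝ} (hκ : 1 ≤ κ)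
    (hd₁ : ∀ v ∈ Ioo a b, HasDerivAt n₁ (-((κ : ℂ) * μ₁ v + Complex.I * η) * n₁ v + h v) v)
    (hd₂ : ∀ v ∈ Ioo a b, HasDerivAt n₂ (((κ : ℂ) * μ₂ v - Complex.I * η) * n₂ v + h v) v) :
    GevreyOn s (Ioo a b) (κ * (16 * A + 2 * M + 2) * G / (κ + |η|)) (4 * M)
      (fun v => n₂ v - n₁ v) := by
  have hs0 : 0 < s := by linarith
  have hκ0 : 0 < κ := by linarith
  have hκη : 0 < κ + |η| := by linarith [abs_nonneg η]
  have h1 := hn₂.sub hn₁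
  have h2 := h1.deriv hs (by positivity) hM.le
  have h4 : M ≤ 4 * M := by linarith
  have h3 := (((hμ₂.mul hs0 hs1 hA hG hM.le hn₂).add
    (hμ₁.mul hs0 hs1 hA hG hM.le hn₁)).const_mul (κ : ℂ)).mono (by positivity) hM.le le_rfl h4
  have h5 := h3.sub h2
  -- The source h is common to both equations and cancels. The factor κ left in the bound is removed
  -- later by the denominator κ(X₁ + X₂).
  have h6 : EqOn (fun v => (κ : ℂ) * (μ₂ v * n₂ v + μ₁ v * n₁ v) -
      _root_.deriv (fun v => n₂ v - n₁ v) v)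
      (fun v => (Complex.I * η) * (n₂ v - n₁ v)) (Ioo a b) := fun v hv => by
    simp only [((hd₂ v hv).fun_sub (hd₁ v hv)).deriv]; ring
  have h7 := h5.congr isOpen_Ioo h6
  refine ⟨h1.smooth, fun m v hv => ?_⟩
  have h8 := h7.bound m v hv
  have h9 := h1.bound m v hv
  rw [iteratedDeriv_const_mul_field, norm_mul, norm_mul, Complex.norm_I, one_mul,
    Complex.norm_real, Real.norm_eq_abs, Complex.norm_real, Real.norm_of_nonneg hκ0.le] at h8
  have hw := gevreyWeight_pos s m
  set D := ‖iteratedDeriv m (fun v => n₂ v - n₁ v) v‖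
  have h10 : κ * D ≤ 2 * κ * G * (4 * M) ^ m * gevreyWeight s m := by
    calc _ ≤ κ * ((G + G) * M ^ m * gevreyWeight s m) := by gcongr
      _ ≤ κ * ((G + G) * (4 * M) ^ m * gevreyWeight s m) := by gcongr
      _ = _ := by ring
  have h11 : κ * (8 * A * G + 8 * A * G) + (G + G) * M ≤ κ * (16 * A + 2 * M) * G := by
    have : 0 ≤ (κ - 1) * (2 * M * G) := mul_nonneg (by linarith) (by positivity)
    nlinarith
  rw [div_mul_eq_mul_div, div_mul_eq_mul_div, le_div_iff₀ hκη]
  calc _ = κ * D + |η| * D := by ring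
    _ ≤ 2 * κ * G * (4 * M) ^ m * gevreyWeight s m +
        (κ * (16 * A + 2 * M) * G) * (4 * M) ^ m * gevreyWeight s m := by
        refine add_le_add h10 (h8.trans ?_)
        gcongr
    _ = _ := by ring

lemma univ_of_tsupport {s A M a b : ℝ} {f : ℝ → ℂ} (hA : 0 ≤ A) (hM : 0 ≤ M)
    (hf : GevreyOn s (Ioo a b) A M f) (hsupp : tsupport f ⊆ Ioo a b) : GevreyOn s univ A M f := by
  have h0 : ∀ v, v ∉ Ioo a b → f =ᶠ[nhds v] fun _ => 0 := fun v hv =>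
    notMem_tsupport_iff_eventuallyEq.mp fun h => hv (hsupp h)
  refine ⟨fun v _ => ?_, fun m v _ => ?_⟩
  · by_cases hv : v ∈ Ioo a b
    · exact hf.smooth v hv
    · exact contDiffAt_const.congr_of_eventuallyEq (h0 v hv)
  · by_cases hv : v ∈ Ioo a b
    · exact hf.bound m v hv
    · rw [(h0 v hv).iteratedDeriv_eq m, iteratedDeriv_const]
      have := gevreyWeight_pos s m
      simp only [ite_self, norm_zero]
      positivity

end GevreyOn

/-! ### The Riccati pair and the two first order factors. -/

/-- The two Riccati solutions adapted to the Neumann conditions at the two endpoints. -/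
structure RiccatiPair (α β κ : ℝ) (p ρ X₁ X₂ : ℝ → ℝ) : Prop where
  cont₁ : Continuous X₁
  cont₂ : Continuous X₂
  left : X₁ α = 0
  right : X₂ β = 0
  deriv₁ : ∀ v ∈ Ioo α β, HasDerivAt X₁ (κ * (p v - ρ v * X₁ v ^ 2)) v
  deriv₂ : ∀ v ∈ Ioo α β, HasDerivAt X₂ (-(κ * (p v - ρ v * X₂ v ^ 2))) v
  pos : ∀ v ∈ Icc α β, 0 < X₁ v + X₂ v

/-- The solutions of the two first order equations into which the Neumann problem factorizes. -/
structure IsFactorPair (α β κ : ℝ) (ρ X₁ X₂ : ℝ → ℝ) (F N₁ N₂ : ℝ → ℂ) : Prop where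
  cont₁ : ContinuousOn N₁ (Icc α β)
  cont₂ : ContinuousOn N₂ (Icc α β)
  left : N₁ α = 0
  right : N₂ β = 0
  deriv₁ : ∀ v ∈ Ioo α β, HasDerivAt N₁ (-((κ * (ρ v * X₁ v) : ℝ) : ℂ) * N₁ v + F v) v
  deriv₂ : ∀ v ∈ Ioo α β, HasDerivAt N₂ (((κ * (ρ v * X₂ v) : ℝ) : ℂ) * N₂ v + F v) v

/-- a and b must lie within ε of the endpoints, inside the zones of constant coefficients where the
Riccati bounds start. The gaps between a and a₁ and between b₁ and b are where the source vanishes,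
so that the damped equations start from zero data. -/
lemma exists_Icc_of_isCompact {α β ε : ℝ} {K : Set ℝ} (hαβ : α < β) (hε : 0 < ε)
    (hK : IsCompact K) (hKs : K ⊆ Ioo α β) : ∃ a a₁ b₁ b : ℝ, α < a ∧ a < a₁ ∧ a₁ < b₁ ∧ b₁ < b ∧
      b < β ∧ a < α + ε ∧ β - ε < b ∧ K ⊆ Icc a₁ b₁ := by
  obtain ⟨x, y, hx, hy, hxy⟩ : ∃ x y : ℝ, α < x ∧ y < β ∧ K ⊆ Icc x y := by
    rcases K.eq_empty_or_nonempty with rfl | hne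
    · exact ⟨α + 1, β - 1, by linarith, by linarith, by simp⟩
    · obtain ⟨x, hx, hxl⟩ := hK.exists_isLeast hne
      obtain ⟨y, hy, hyl⟩ := hK.exists_isGreatest hne
      exact ⟨x, y, (hKs hx).1, (hKs hy).2, fun z hz => ⟨hxl hz, hyl hz⟩⟩
  obtain ⟨a₁, h1, h2⟩ := exists_between (lt_min (lt_min hx (by linarith : α < α + ε))
    (by linarith : α < (α + β) / 2))
  obtain ⟨b₁, h3, h4⟩ := exists_between (max_lt (max_lt hy (by linarith : β - ε < β))
    (by linarith : (α + β) / 2 < β))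
  obtain ⟨a, h5, h6⟩ := exists_between h1
  obtain ⟨b, h7, h8⟩ := exists_between h4
  simp only [lt_min_iff, max_lt_iff] at h2 h3
  exact ⟨a, a₁, b₁, b, h5, h6, by linarith, h7, h8, by linarith, by linarith, fun z hz =>
    ⟨by linarith [(hxy hz).1], by linarith [(hxy hz).2]⟩⟩

/-- Riccati solutions for both endpoints with Gevrey bounds on a compact subinterval. -/
lemma exists_riccatiPair {s α β δ c A M : ℝ} {p ρ : ℝ → ℝ} (hs : 0 < s) (hs1 : s ≤ 1)
    (h : RiccatiCoeff s α β δ c A M p ρ)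
    (h' : RiccatiCoeff s (-β) (-α) δ c A M (fun v => p (-v)) (fun v => ρ (-v)))
    {a b : ℝ} (ha : α < a) (hab : a < b) (hb : b < β) (haδ : a < α + δ) (hbδ : β - δ < b) :
    ∃ x₀ B M' : ℝ, 0 < x₀ ∧ 0 < B ∧ 0 < M' ∧ ∀ κ : ℝ, 1 ≤ κ → ∃ X₁ X₂ : ℝ → ℝ,
      RiccatiPair α β κ p ρ X₁ X₂ ∧ GevreyOn s (Ioo a b) B M' X₁ ∧ GevreyOn s (Ioo a b) B M' X₂ ∧
      ∀ v ∈ Ioo a b, x₀ ≤ X₁ v ∧ x₀ ≤ X₂ v := by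
  have hαβ := h.lt
  have hc := h.c_pos
  obtain ⟨e₁, L₁, he₁, hL₁, hr₁⟩ := exists_riccati (A := A) hαβ hc
  obtain ⟨e₂, L₂, he₂, hL₂, hr₂⟩ := exists_riccati (A := A) (neg_lt_neg hαβ) hc
  obtain ⟨M₁, hM₁, hg₁⟩ := h.riccati_gevrey hs hs1 he₁ hL₁ (v₀ := a) ⟨ha, by linarith⟩ haδ
  -- The reflection v ↦ -v makes the right endpoint a left one.
  obtain ⟨M₂, hM₂, hg₂⟩ := h'.riccati_gevrey hs hs1 he₂ hL₂ (v₀ := -b)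
    ⟨by linarith, by linarith⟩ (by linarith)
  have hx : 0 < min (e₁ * (a - α)) (e₂ * (β - b)) :=
    lt_min (mul_pos he₁ (by linarith)) (mul_pos he₂ (by linarith))
  refine ⟨_, L₁ + L₂ + 1, M₁ + M₂, hx, by positivity, by positivity, fun κ hκ => ?_⟩
  obtain ⟨X₁, hc₁, h0₁, hd₁, hb₁⟩ := hr₁ p ρ h.cont_p h.cont_ρ h.p_mem h.ρ_mem κ hκ
  obtain ⟨Y, hcY, h0Y, hdY, hbY⟩ := hr₂ _ _ h'.cont_p h'.cont_ρ h'.p_mem h'.ρ_mem κ hκ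
  have hbX₂ : ∀ v ∈ Icc α β, e₂ * (β - v) ≤ Y (-v) := fun v hv => by
    have := (hbY (-v) ⟨by linarith [hv.2], by linarith [hv.1]⟩).1
    rwa [show -v - -β = β - v by ring] at this
  refine ⟨X₁, fun v => Y (-v), ⟨hc₁, hcY.comp continuous_neg, h0₁, h0Y, hd₁, fun v hv => ?_,
    fun v hv => ?_⟩, ?_, ?_, fun v hv => ⟨?_, ?_⟩⟩
  · have := (hdY (-v) ⟨by linarith [hv.2], by linarith [hv.1]⟩).comp v (hasDerivAt_neg v)
    refine this.congr_deriv ?_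
    simp
  · have h1 := (hb₁ v hv).1
    have h2 := hbX₂ v hv
    rcases hv.1.eq_or_lt with h3 | h3
    · have : 0 < e₂ * (β - v) := mul_pos he₂ (by linarith)
      have : 0 ≤ e₁ * (v - α) := mul_nonneg he₁.le (by linarith)
      linarith
    · have : 0 ≤ e₂ * (β - v) := mul_nonneg he₂.le (by linarith [hv.2])
      have : 0 < e₁ * (v - α) := mul_pos he₁ (by linarith)
      linarith
  · exact ((hg₁ κ hκ X₁ hd₁ hb₁).mono_set (Ioo_subset_Ioo_right hb.le)).mono (by positivity)
      hM₁.le (by linarith) (by linarith)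
  · refine ((hg₂ κ hκ Y hdY hbY).comp_neg.mono_set fun v hv => ?_).mono (by positivity)
      hM₂.le (by linarith) (by linarith)
    exact ⟨by linarith [hv.2], by linarith [hv.1]⟩
  · refine (min_le_left _ _).trans (le_trans ?_ (hb₁ v ⟨by linarith [hv.1], by linarith [hv.2]⟩).1)
    gcongr
    exact hv.1.le
  · refine (min_le_right _ _).trans (le_trans ?_
      (hbX₂ v ⟨by linarith [hv.1], by linarith [hv.2]⟩))
    gcongr
    exact hv.2.le

lemma hasDerivAt_cexp_mul (c : ℂ) (v : ℝ) :
    HasDerivAt (fun v : ℝ => Complex.exp (c * v)) (c * Complex.exp (c * v)) v := by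
  have := ((hasDerivAt_id v).ofReal_comp.const_mul c).cexp
  simp only [id] at this
  refine this.congr_deriv ?_
  simp [mul_comm]

/-- The conjugated factors `e^{-iηv} N` are Gevrey regular, uniformly in `κ` and `η`. -/
lemma exists_factorPair_gevrey {s α β a a₁ b₁ b c x₀ A B M H Mh : ℝ} (hs : 1 / 2 < s) (hs1 : s ≤ 1)
    (hαa : α < a) (haa₁ : a < a₁) (hb₁b : b₁ < b) (hbβ : b < β) (hc : 0 < c)
    (hx₀ : 0 < x₀) (hA : 0 ≤ A) (hB : 0 ≤ B) (hM : 0 < M) (hH : 0 ≤ H) (hMh : 0 ≤ Mh)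
    {ρ : ℝ → ℝ} {h : ℝ → ℂ} (hρc : Continuous ρ) (hhc : Continuous h)
    (hρ : GevreyOn s (Ioo a b) A M ρ) (hρ0 : ∀ v, c ≤ ρ v)
    (hh : GevreyOn s (Ioo a b) H Mh h) (hsupp : ∀ v, v ∉ Icc a₁ b₁ → h v = 0) :
    ∃ D M' : ℝ, 0 ≤ D ∧ 0 < M' ∧ ∀ κ : ℝ, 1 ≤ κ → ∀ X₁ X₂ : ℝ → ℝ, Continuous X₁ → Continuous X₂ →
      GevreyOn s (Ioo a b) B M X₁ → GevreyOn s (Ioo a b) B M X₂ →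
      (∀ v ∈ Ioo a b, x₀ ≤ X₁ v ∧ x₀ ≤ X₂ v) → ∀ η : ℝ, ∃ N₁ N₂ : ℝ → ℂ,
        IsFactorPair α β κ ρ X₁ X₂ (fun v => h v * Complex.exp (Complex.I * η * v)) N₁ N₂ ∧
        GevreyOn s (Ioo a b) (κ * D / (κ + |η|) ^ 2) M'
          (fun v => Complex.exp (-(Complex.I * η) * v) * (N₂ v - N₁ v)) := by
  have hs0 : 0 < s := by linarith
  obtain ⟨H', M', hH', hMM', hn⟩ := GevreyOn.exists_of_damped_ode (A := 8 * A * B) (M := M + Mh)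
    (H := H) (c := c * x₀) hs hs1 (by positivity) (by positivity) hH (by positivity)
  have hM'0 : 0 < M' := by linarith
  refine ⟨(16 * (8 * A * B) + 2 * M' + 2) * H', 4 * M', by positivity, by positivity,
    fun κ hκ X₁ X₂ hX₁c hX₂c hX₁ hX₂ hX η => ?_⟩
  have hκ0 : 0 < κ := by linarith
  have hκη : 0 < κ + |η| := by linarith [abs_nonneg η]
  have hFc : Continuous fun v : ℝ => h v * Complex.exp (Complex.I * η * v) := by fun_prop
  obtain ⟨N₁, hN₁0, hN₁d, hN₁z⟩ := exists_linear_ode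
    (l := fun v => -((κ * (ρ v * X₁ v) : ℝ) : ℂ)) (by fun_prop) hFc α
  obtain ⟨N₂, hN₂0, hN₂d, hN₂z⟩ := exists_linear_ode
    (l := fun v => ((κ * (ρ v * X₂ v) : ℝ) : ℂ)) (by fun_prop) hFc β
  have hN₁c : Continuous N₁ := continuous_iff_continuousAt.mpr fun v => (hN₁d v).continuousAt
  have hN₂c : Continuous N₂ := continuous_iff_continuousAt.mpr fun v => (hN₂d v).continuousAt
  refine ⟨N₁, N₂, ⟨hN₁c.continuousOn, hN₂c.continuousOn, hN₁0, hN₂0, fun v _ => hN₁d v,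
    fun v _ => hN₂d v⟩, ?_⟩
  have hMle : M ≤ M + Mh := by linarith
  have hMle' : Mh ≤ M + Mh := by linarith
  have hμ₁ := ((hρ.mul hs0 hs1 hA hB hM.le hX₁).ofReal).mono (by positivity) hM.le le_rfl hMle
  have hμ₂ := ((hρ.mul hs0 hs1 hA hB hM.le hX₂).ofReal).mono (by positivity) hM.le le_rfl hMle
  have hh' := hh.mono hH hMh le_rfl hMle'
  have hexp : ∀ v : ℝ, Complex.exp (-(Complex.I * η) * v) * Complex.exp (Complex.I * η * v) = 1 := by
    intro v
    rw [← Complex.exp_add]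
    simp
  set n₁ : ℝ → ℂ := fun v => Complex.exp (-(Complex.I * η) * v) * N₁ v with hn₁
  set n₂ : ℝ → ℂ := fun v => Complex.exp (-(Complex.I * η) * v) * N₂ v with hn₂
  have hd₁ : ∀ v, HasDerivAt n₁
      (-((κ : ℂ) * ((ρ v * X₁ v : ℝ) : ℂ) + Complex.I * η) * n₁ v + h v) v := fun v => by
    refine ((hasDerivAt_cexp_mul _ v).mul (hN₁d v)).congr_deriv ?_
    simp only [hn₁]
    push_cast
    linear_combination h v * hexp v
  have hd₂ : ∀ v, HasDerivAt n₂
      (((κ : ℂ) * ((ρ v * X₂ v : ℝ) : ℂ) - Complex.I * η) * n₂ v + h v) v := fun v => by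
    refine ((hasDerivAt_cexp_mul _ v).mul (hN₂d v)).congr_deriv ?_
    simp only [hn₂]
    push_cast
    linear_combination h v * hexp v
  have hg₁ := hn a b a₁ haa₁ _ h n₁ hμ₁ (fun v hv => by
      rw [Complex.ofReal_re]
      exact mul_le_mul (hρ0 v) (hX v hv).1 hx₀.le (hc.le.trans (hρ0 v))) hh' κ η hκ
    (fun v _ => hd₁ v) (fun v hv => by
      simp only [hn₁]
      rw [hN₁z v, mul_zero]
      intro w hw
      rw [uIcc_of_le (by linarith [hv.1])] at hw
      rw [hsupp w (fun hw' => by linarith [hw.2, hw'.1, hv.2]), zero_mul])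
  have hrefl : Neg.neg ⁻¹' (Ioo a b) = Ioo (-b) (-a) := by
    ext v; simp only [mem_preimage, mem_Ioo]; constructor <;> rintro ⟨_, _⟩ <;> constructor <;>
      linarith
  have hrefl' : Neg.neg ⁻¹' (Ioo (-b) (-a)) = Ioo a b := by
    ext v; simp only [mem_preimage, mem_Ioo]; constructor <;> rintro ⟨_, _⟩ <;> constructor <;>
      linarith
  have hμ₂' := hμ₂.comp_neg
  have hh'' := hh'.comp_neg.neg
  rw [hrefl] at hμ₂' hh''
  -- n₂(-v) solves a damped equation with source -h(-v) and frequency -η and vanishes near -b, so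
  -- the bound for n₁ applies to it.
  have hg₂ := hn (-b) (-a) (-b₁) (by linarith) _ _ (fun v => n₂ (-v)) hμ₂' (fun v hv => by
      have hv' : -v ∈ Ioo a b := ⟨by linarith [hv.2], by linarith [hv.1]⟩
      rw [Complex.ofReal_re]
      exact mul_le_mul (hρ0 _) (hX _ hv').2 hx₀.le (hc.le.trans (hρ0 _))) hh'' κ (-η) hκ
    (fun v _ => by
      have := (hd₂ (-v)).scomp v (hasDerivAt_neg v)
      refine this.congr_deriv ?_
      simp
      ring)
    (fun v hv => by
      simp only [hn₂]
      rw [hN₂z (-v), mul_zero]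
      intro w hw
      rw [uIcc_of_ge (by linarith [hv.1])] at hw
      rw [hsupp w (fun hw' => by linarith [hw.1, hw'.2, hv.2]), zero_mul])
  have hg₂' := hg₂.comp_neg
  rw [hrefl', abs_neg] at hg₂'
  simp only [neg_neg] at hg₂'
  have hfin := GevreyOn.sub_of_damped_ode hs hs1 (A := 8 * A * B) (by positivity) hM'0
    (G := H' / (κ + |η|)) (by positivity) (hμ₁.mono (by positivity) (by positivity) le_rfl hMM')
    (hμ₂.mono (by positivity) (by positivity) le_rfl hMM') hg₁ hg₂' hκ (fun v _ => hd₁ v)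
    (fun v _ => hd₂ v)
  have e1 : κ * (16 * (8 * A * B) + 2 * M' + 2) * (H' / (κ + |η|)) / (κ + |η|) =
      κ * ((16 * (8 * A * B) + 2 * M' + 2) * H') / (κ + |η|) ^ 2 := by field_simp
  have e2 : (fun v => n₂ v - n₁ v) =
      fun v : ℝ => Complex.exp (-(Complex.I * η) * v) * (N₂ v - N₁ v) := by
    ext v; simp only [hn₁, hn₂]; ring
  rw [e1, e2] at hfin
  exact hfin

/-! ### The localized response to an oscillating source. -/

/-- The Fourier bound for the localized resolvent, uniformly in `κ ≥ 1` and `η`. -/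
theorem exists_resolvent_bound {s α β δ c A M : ℝ} {p ρ : ℝ → ℝ} (hs : 1 / 2 < s) (hs1 : s ≤ 1)
    (hR : RiccatiCoeff s α β δ c A M p ρ)
    (hR' : RiccatiCoeff s (-β) (-α) δ c A M (fun v => p (-v)) (fun v => ρ (-v)))
    {h Υ : ℝ → ℂ} {H Mh : ℝ} (hH : 0 ≤ H) (hMh : 0 ≤ Mh) (hh : GevreyOn s (Ioo α β) H Mh h)
    (hhs : tsupport h ⊆ Ioo α β) (hΥ : GevreyOn s (Ioo α β) H Mh Υ) (hΥs : tsupport Υ ⊆ Ioo α β) :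
    ∃ C lam : ℝ, 0 < C ∧ 0 < lam ∧ ∀ κ : ℝ, 1 ≤ κ → ∃ X₁ X₂ : ℝ → ℝ,
      RiccatiPair α β κ p ρ X₁ X₂ ∧ ∀ η : ℝ, ∃ N₁ N₂ : ℝ → ℂ,
        IsFactorPair α β κ ρ X₁ X₂ (fun v => h v * Complex.exp (Complex.I * η * v)) N₁ N₂ ∧
        ∀ ξ : ℝ, ‖∫ v : ℝ, Υ v * ((N₂ v - N₁ v) / ((κ * (X₁ v + X₂ v) : ℝ) : ℂ)) *
            Complex.exp (-(Complex.I * v * ξ))‖ ≤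
          C * (Real.exp (-lam * bracket (ξ - η) ^ s) / (κ + |η|) ^ 2) := by
  have hs0 : 0 < s := by linarith
  have hc := hR.c_pos
  have hA := hR.A_pos
  have hM := hR.M_nonneg
  have hcomp : ∀ f : ℝ → ℂ, tsupport f ⊆ Ioo α β → IsCompact (tsupport f) := fun f hf =>
    isCompact_Icc.of_isClosed_subset (isClosed_tsupport f) (hf.trans Ioo_subset_Icc_self)
  obtain ⟨a, a₁, b₁, b, hαa, haa₁, hab₁, hb₁b, hbβ, haδ, hbδ, hK⟩ :=
    exists_Icc_of_isCompact hR.lt hR.δ_pos ((hcomp h hhs).union (hcomp Υ hΥs))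
      (union_subset hhs hΥs)
  have hab : a < b := by linarith
  have hsub : Ioo a b ⊆ Ioo α β := Ioo_subset_Ioo hαa.le hbβ.le
  obtain ⟨x₀, B, M₁, hx₀, hB, hM₁, hX⟩ := exists_riccatiPair hs0 hs1 hR hR' hαa hab hbβ haδ hbδ
  have hhu := hh.univ_of_tsupport hH hMh hhs
  have hhc : Continuous h :=
    continuous_iff_continuousAt.mpr fun v => (hhu.smooth v (mem_univ v)).continuousAt
  obtain ⟨D, M', hD, hM', hN⟩ := exists_factorPair_gevrey (M := M + M₁) (B := B) hs hs1 hαa haa₁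
    hb₁b hbβ hc hx₀ hA.le hB.le (by positivity) hH hMh hR.cont_ρ hhc
    ((hR.gevrey_ρ.mono_set hsub).mono hA.le hM le_rfl (by linarith)) (fun v => (hR.ρ_mem v).1)
    (hh.mono_set hsub) (fun v hv => by
      by_contra h0
      exact hv (hK (Or.inl (subset_tsupport h h0))))
  set Ma : ℝ := M₁ * ((8 * (B + B) + x₀) / x₀) with hMa
  have hMa0 : 0 < Ma := by positivity
  set Mf : ℝ := M' + Ma + Mh with hMf
  obtain ⟨C, lam, hC, hlam, hF⟩ := exists_fourier_decay (M := Mf) hs0 hs1 (by positivity) hab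
  set B₀ : ℝ := 8 * H * (8 * D * (1 / x₀)) with hB₀
  have hB₀0 : 0 ≤ B₀ := by positivity
  refine ⟨C * B₀ + 1, lam, by positivity, hlam, fun κ hκ => ?_⟩
  have hκ0 : 0 < κ := by linarith
  obtain ⟨X₁, X₂, hP, hX₁, hX₂, hXx⟩ := hX κ hκ
  have hM₁le : M₁ ≤ M + M₁ := by linarith
  refine ⟨X₁, X₂, hP, fun η => ?_⟩
  have hκη : 0 < κ + |η| := by linarith [abs_nonneg η]
  obtain ⟨N₁, N₂, hNp, hNg⟩ := hN κ hκ X₁ X₂ hP.cont₁ hP.cont₂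
    (hX₁.mono hB.le hM₁.le le_rfl hM₁le) (hX₂.mono hB.le hM₁.le le_rfl hM₁le) hXx η
  refine ⟨N₁, N₂, hNp, fun ξ => ?_⟩
  have ga := ((hX₁.add hX₂).ofReal).inv hs0 hs1 isOpen_Ioo (by positivity) hM₁.le hx₀
    (fun v hv => by
      have := hXx v hv
      rw [Complex.norm_real, Real.norm_of_nonneg (by linarith)]
      linarith)
  rw [← hMa] at ga
  have hMa_le : Ma ≤ Mf := by rw [hMf]; linarith
  have hM'_le : M' ≤ Mf := by rw [hMf]; linarith
  have hMh_le : Mh ≤ Mf := by rw [hMf]; linarith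
  have hMf0 : 0 < Mf := by linarith
  -- The 1/κ of the denominator κ(X₁ + X₂) cancels the growth of the bound for the difference.
  have gd := (hNg.const_mul (1 / κ : ℂ)).mono (by positivity) hM'.le
    (show ‖(1 / κ : ℂ)‖ * (κ * D / (κ + |η|) ^ 2) ≤ D / (κ + |η|) ^ 2 by
      rw [norm_div, norm_one, Complex.norm_real, Real.norm_of_nonneg hκ0.le]
      apply le_of_eq; field_simp) hM'_le
  have gf := ((hΥ.mono_set hsub).mono hH hMh le_rfl hMh_le).mul hs0 hs1 hH (by positivity) hMf0.le
    (gd.mul hs0 hs1 (by positivity) (by positivity) hMf0.le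
      (ga.mono (by positivity) hMa0.le le_rfl hMa_le))
  set f : ℝ → ℂ := fun v => Υ v * ((1 / κ : ℂ) * (Complex.exp (-(Complex.I * η) * v) *
    (N₂ v - N₁ v)) * (((X₁ v + X₂ v : ℝ) : ℂ))⁻¹) with hf
  have hfs : tsupport f ⊆ Icc a₁ b₁ :=
    (tsupport_mul_subset_left).trans fun v hv => hK (Or.inr hv)
  have hfu := gf.univ_of_tsupport (by positivity) hMf0.le (hfs.trans (Icc_subset_Ioo haa₁ hb₁b))
  have hconst : 8 * H * (8 * (D / (κ + |η|) ^ 2) * (1 / x₀)) = B₀ / (κ + |η|) ^ 2 := by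
    rw [hB₀]; field_simp
  rw [hconst] at hfu
  have hfin := hF (B₀ / (κ + |η|) ^ 2) f (by positivity)
    (contDiff_iff_contDiffAt.mpr fun v => hfu.smooth v (mem_univ v))
    (hfs.trans (Icc_subset_Icc haa₁.le hb₁b.le)) (fun m v => hfu.bound m v (mem_univ v)) (ξ - η)
  -- f already contains e^{-iηv}, so its transform is evaluated at ξ - η: regularity gives the
  -- decay, the amplitude gives (κ + |η|)^{-2}.
  have hint : ∀ v : ℝ, Υ v * ((N₂ v - N₁ v) / ((κ * (X₁ v + X₂ v) : ℝ) : ℂ)) *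
      Complex.exp (-(Complex.I * v * ξ)) =
      f v * Complex.exp (-(Complex.I * (v : ℂ) * ((ξ - η : ℝ) : ℂ))) := by
    intro v
    have : Complex.exp (-(Complex.I * v * ξ)) = Complex.exp (-(Complex.I * η) * v) *
        Complex.exp (-(Complex.I * (v : ℂ) * ((ξ - η : ℝ) : ℂ))) := by
      rw [← Complex.exp_add]
      congr 1
      push_cast
      ring
    rw [this, hf]
    push_cast
    rw [div_eq_mul_inv, mul_inv, one_div]
    ring
  simp only [hint]
  refine hfin.trans ?_
  calc _ = C * B₀ * (Real.exp (-lam * bracket (ξ - η) ^ s) / (κ + |η|) ^ 2) := by ring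
    _ ≤ _ := by gcongr; linarith

/-! ### Duality, Parseval and the kernel. -/

/-- Duality between the factorized problem and the adjoint first order equations. -/
lemma exists_adjoint {α β κ : ℝ} (hαβ : α ≤ β) {ρ X₁ X₂ : ℝ → ℝ} {h : ℝ → ℂ} (hρ : Continuous ρ)
    (hX₁ : Continuous X₁) (hX₂ : Continuous X₂) (hh : Continuous h) :
    ∃ W : ℝ → ℂ, Continuous W ∧ ∀ F N₁ N₂ : ℝ → ℂ, Continuous F →
      IsFactorPair α β κ ρ X₁ X₂ F N₁ N₂ →
      ∫ v in α..β, h v * (N₂ v - N₁ v) = ∫ v in α..β, W v * F v := by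
  -- Each adjoint solution vanishes at the endpoint opposite to that of its partner, so (WN)' = WF -
  -- hN integrates without boundary terms.
  obtain ⟨W₁, h₁, hd₁, -⟩ := exists_linear_ode (l := fun v => ((κ * (ρ v * X₁ v) : ℝ) : ℂ))
    (g := fun v => - h v) (by fun_prop) (by fun_prop) β
  obtain ⟨W₂, h₂, hd₂, -⟩ := exists_linear_ode (l := fun v => -((κ * (ρ v * X₂ v) : ℝ) : ℂ))
    (g := fun v => - h v) (by fun_prop) (by fun_prop) α
  have hc₁ : Continuous W₁ := continuous_iff_continuousAt.mpr fun v => (hd₁ v).continuousAt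
  have hc₂ : Continuous W₂ := continuous_iff_continuousAt.mpr fun v => (hd₂ v).continuousAt
  refine ⟨fun v => W₂ v - W₁ v, hc₂.sub hc₁, fun F N₁ N₂ hF hN => ?_⟩
  have hN₁ := hN.cont₁
  have hN₂ := hN.cont₂
  rw [← uIcc_of_le hαβ] at hN₁ hN₂
  have ii : ∀ W N : ℝ → ℂ, Continuous W → ContinuousOn N (uIcc α β) →
      IntervalIntegrable (fun v => W v * N v) volume α β := fun W N hW hN =>
    (hW.continuousOn.mul hN).intervalIntegrable
  have key : ∀ W N : ℝ → ℂ, Continuous W → ContinuousOn N (uIcc α β) →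
      (∀ v ∈ Ioo α β, HasDerivAt (fun v => W v * N v) (W v * F v - h v * N v) v) →
      W β * N β = 0 → W α * N α = 0 →
      ∫ v in α..β, W v * F v = ∫ v in α..β, h v * N v := by
    intro W N hW hN hd h0 h1
    have := intervalIntegral.integral_eq_sub_of_hasDerivAt_of_le hαβ
      (by rw [← uIcc_of_le hαβ]; exact hW.continuousOn.mul hN) hd
      ((ii W F hW hF.continuousOn).sub (ii h N hh hN))
    rw [intervalIntegral.integral_sub (ii W F hW hF.continuousOn) (ii h N hh hN), h0, h1,
      sub_self, sub_eq_zero] at this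
    exact this
  have k₁ := key W₁ N₁ hc₁ hN₁ (fun v hv => ((hd₁ v).mul (hN.deriv₁ v hv)).congr_deriv (by ring))
    (by rw [h₁, zero_mul]) (by rw [hN.left, mul_zero])
  have k₂ := key W₂ N₂ hc₂ hN₂ (fun v hv => ((hd₂ v).mul (hN.deriv₂ v hv)).congr_deriv (by ring))
    (by rw [hN.right, mul_zero]) (by rw [h₂, zero_mul])
  simp only [mul_sub, sub_mul]
  rw [intervalIntegral.integral_sub (ii h N₂ hh hN₂) (ii h N₁ hh hN₁),
    intervalIntegral.integral_sub (ii W₂ F hc₂ hF.continuousOn) (ii W₁ F hc₁ hF.continuousOn),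
    k₁, k₂]

lemma fourier_transform_eq (g : ℝ → ℂ) (x : ℝ) :
    ∫ v : ℝ, g v * Complex.exp (-(Complex.I * (v : ℂ) * (x : ℂ))) =
      FourierTransform.fourier g (x / (2 * Real.pi)) := by
  rw [Real.fourier_eq']
  congr 1
  ext v
  rw [smul_eq_mul, mul_comm]
  congr 2
  simp
  field_simp

lemma fourierInv_transform_eq (g : ℝ → ℂ) (x : ℝ) :
    ∫ v : ℝ, g v * Complex.exp (Complex.I * (v : ℂ) * (x : ℂ)) =
      FourierTransformInv.fourierInv g (x / (2 * Real.pi)) := by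
  rw [Real.fourierInv_eq']
  congr 1
  ext v
  rw [smul_eq_mul, mul_comm]
  congr 2
  simp
  field_simp

/-- Parseval's identity for an integrable inverse Fourier transform. -/
lemma integral_fourierInv_mul_fourier {G g : ℝ → ℂ} (hGc : Continuous G) (hGi : Integrable G)
    (hgi : Integrable g) {Φ : ℝ → ℂ}
    (hΦ : ∀ η, Φ η = (1 / (2 * Real.pi) : ℂ) *
      ∫ w : ℝ, G w * Complex.exp (Complex.I * (w : ℂ) * (η : ℂ)))
    (hΦi : Integrable Φ) :
    Integrable (fun η : ℝ => Φ η * ∫ v : ℝ, g v * Complex.exp (-(Complex.I * (v : ℂ) * (η : ℂ)))) ∧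
      ∫ η : ℝ, (Φ η * ∫ v : ℝ, g v * Complex.exp (-(Complex.I * (v : ℂ) * (η : ℂ)))) =
        ∫ w, G w * g w := by
  have hπ : (0 : ℝ) < 2 * Real.pi := by positivity
  have hπc : (2 * Real.pi : ℂ) ≠ 0 := by exact_mod_cast hπ.ne'
  have hΦ' : ∀ η, Φ η = (1 / (2 * Real.pi) : ℂ) *
      FourierTransformInv.fourierInv G (η / (2 * Real.pi)) := fun η => by
    rw [hΦ, fourierInv_transform_eq]
  have hinv : Integrable (FourierTransformInv.fourierInv G : ℝ → ℂ) := by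
    have h1 := (hΦi.comp_mul_left' hπ.ne').const_mul (2 * Real.pi : ℂ)
    refine h1.congr (Filter.Eventually.of_forall fun x => ?_)
    simp only [hΦ']
    rw [← mul_assoc, mul_one_div_cancel hπc, one_mul, mul_div_cancel_left₀ _ hπ.ne']
  have hfour : Integrable (FourierTransform.fourier G : ℝ → ℂ) := by
    refine hinv.comp_neg.congr (Filter.Eventually.of_forall fun x => ?_)
    simp only [Real.fourierInv_eq_fourier_neg, neg_neg]
  have hgc : Continuous (FourierTransform.fourier g : ℝ → ℂ) :=
    VectorFourier.fourierIntegral_continuous Real.continuous_fourierChar continuous_inner hgi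
  constructor
  · refine hΦi.mul_bdd (c := ∫ v, ‖g v‖) ?_ (Filter.Eventually.of_forall fun η => ?_)
    · simp only [fourier_transform_eq]
      exact (hgc.comp (continuous_id.div_const _)).aestronglyMeasurable
    · rw [fourier_transform_eq]
      exact VectorFourier.norm_fourierIntegral_le_integral_norm _ _ _ _ _
  · let K : ℝ → ℂ := fun x => (1 / (2 * Real.pi) : ℂ) * (FourierTransformInv.fourierInv G x *
      FourierTransform.fourier g x)
    have h1 : ∀ η : ℝ, Φ η * ∫ v : ℝ, g v * Complex.exp (-(Complex.I * (v : ℂ) * (η : ℂ))) =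
        K (η / (2 * Real.pi)) := fun η => by
      simp only [K, hΦ', fourier_transform_eq]
      ring
    simp only [h1]
    rw [Measure.integral_comp_div, integral_const_mul, abs_of_pos hπ, Complex.real_smul,
      ← mul_assoc]
    push_cast
    rw [mul_one_div_cancel hπc, one_mul]
    have h2 : ∫ x : ℝ, FourierTransform.fourier (FourierTransformInv.fourierInv G) x • g x =
        ∫ x : ℝ, FourierTransformInv.fourierInv G x • FourierTransform.fourier g x := by
      simpa using! VectorFourier.integral_fourierIntegral_smul_eq_flip (L := innerₗ ℝ)
        Real.continuous_fourierChar continuous_inner hinv hgi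
    simp only [smul_eq_mul] at h2
    rw [← h2, hGc.fourier_fourierInv_eq hGi hfour]

/-- The localized resolvent of the rescaled pressure equation as an integral operator in Fourier
variables. -/
theorem exists_kernel {s α β δ c A M : ℝ} {p ρ : ℝ → ℝ} (hs : 1 / 2 < s) (hs1 : s ≤ 1)
    (hR : RiccatiCoeff s α β δ c A M p ρ)
    (hR' : RiccatiCoeff s (-β) (-α) δ c A M (fun v => p (-v)) (fun v => ρ (-v)))
    {h Υ : ℝ → ℂ} {H Mh : ℝ} (hH : 0 ≤ H) (hMh : 0 ≤ Mh) (hh : GevreyOn s (Ioo α β) H Mh h)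
    (hhs : tsupport h ⊆ Ioo α β) (hΥ : GevreyOn s (Ioo α β) H Mh Υ) (hΥs : tsupport Υ ⊆ Ioo α β) :
    ∃ (C lam : ℝ) (𝒦 : ℝ → ℝ → ℝ → ℂ) (X₁ X₂ : ℝ → ℝ → ℝ), 0 < C ∧ 0 < lam ∧
      (∀ κ : ℝ, 1 ≤ κ → RiccatiPair α β κ p ρ (X₁ κ) (X₂ κ)) ∧
      (∀ κ ξ η : ℝ, 1 ≤ κ → ‖𝒦 κ ξ η‖ ≤ C * min
        (Real.exp (-lam * bracket (ξ - η) ^ s) / (1 + κ ^ 2 + ξ ^ 2))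
        (Real.exp (-lam * bracket (ξ - η) ^ s) / (1 + κ ^ 2 + η ^ 2))) ∧
      ∀ κ : ℝ, 1 ≤ κ → ∀ (τ : ℝ) (g N₁ N₂ : ℝ → ℂ), Continuous g → HasCompactSupport g →
        IsFactorPair α β κ ρ (X₁ κ) (X₂ κ)
          (fun v => h v * Complex.exp (-(Complex.I * τ * v)) * g v) N₁ N₂ →
        ∀ ξ : ℝ,
          Integrable (fun η : ℝ => 𝒦 κ (ξ - τ) (η - τ) *
            ∫ v : ℝ, g v * Complex.exp (-(Complex.I * (v : ℂ) * (η : ℂ)))) ∧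
          ∫ v : ℝ, Υ v * ((N₂ v - N₁ v) / ((κ * (X₁ κ v + X₂ κ v) : ℝ) : ℂ)) *
              Complex.exp (-(Complex.I * v * ((ξ - τ : ℝ) : ℂ))) =
            ∫ η : ℝ, 𝒦 κ (ξ - τ) (η - τ) *
              ∫ v : ℝ, g v * Complex.exp (-(Complex.I * (v : ℂ) * (η : ℂ))) := by
  obtain ⟨C, lam, hC, hlam, hX⟩ := exists_resolvent_bound hs hs1 hR hR' hH hMh hh hhs hΥ hΥs
  obtain ⟨C', hC', hw⟩ := exists_kernel_weight_bound hs hlam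
  choose! X₁ X₂ hP hN using hX
  choose! N₁ N₂ hF hbd using hN
  have hπ : (0 : ℝ) < 2 * Real.pi := by positivity
  have hbd' : ∀ κ ξ η : ℝ, 1 ≤ κ → ‖(1 / (2 * Real.pi) : ℂ) *
      ∫ v : ℝ, Υ v * ((N₂ κ η v - N₁ κ η v) / ((κ * (X₁ κ v + X₂ κ v) : ℝ) : ℂ)) *
        Complex.exp (-(Complex.I * v * ξ))‖ ≤ C / (2 * Real.pi) * C' * min
        (Real.exp (-(lam / 2) * bracket (ξ - η) ^ s) / (1 + κ ^ 2 + ξ ^ 2))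
        (Real.exp (-(lam / 2) * bracket (ξ - η) ^ s) / (1 + κ ^ 2 + η ^ 2)) := by
    intro κ ξ η hκ
    have e : ‖(1 / (2 * Real.pi) : ℂ)‖ = 1 / (2 * Real.pi) := by
      rw [norm_div, norm_one, norm_mul, Complex.norm_real, Real.norm_of_nonneg Real.pi_pos.le]
      simp
    rw [norm_mul, e]
    calc _ ≤ 1 / (2 * Real.pi) *
          (C * (Real.exp (-lam * bracket (ξ - η) ^ s) / (κ + |η|) ^ 2)) := by
          gcongr; exact hbd κ hκ η ξ
      _ ≤ 1 / (2 * Real.pi) * (C * (C' * min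
        (Real.exp (-(lam / 2) * bracket (ξ - η) ^ s) / (1 + κ ^ 2 + ξ ^ 2))
        (Real.exp (-(lam / 2) * bracket (ξ - η) ^ s) / (1 + κ ^ 2 + η ^ 2)))) := by
          gcongr; exact hw κ ξ η hκ
      _ = _ := by ring
  -- The kernel, read off from `hbd'`, is 1/(2π) times the transform at ξ of the localized response
  -- to he^{iηv}.
  refine ⟨C / (2 * Real.pi) * C', lam / 2, _, X₁, X₂, by positivity, by positivity, hP, hbd',
    fun κ hκ τ g n₁ n₂ hg hgs hn ξ => ?_⟩
  have hκ0 : 0 < κ := by linarith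
  have hPκ := hP κ hκ
  have hαβ := hR.lt.le
  have hhc : Continuous h := continuous_iff_continuousAt.mpr fun v =>
    ((hh.univ_of_tsupport hH hMh hhs).smooth v (mem_univ v)).continuousAt
  set ψ : ℝ → ℂ := fun v => Υ v * (((κ * (X₁ κ v + X₂ κ v) : ℝ) : ℂ))⁻¹ *
    Complex.exp (-(Complex.I * v * ((ξ - τ : ℝ) : ℂ))) with hψ
  have hψs : tsupport ψ ⊆ tsupport Υ := tsupport_mul_subset_left.trans tsupport_mul_subset_left
  have hψc : Continuous ψ := by
    refine continuous_iff_continuousAt.mpr fun v => ?_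
    by_cases hv : v ∈ Ioo α β
    · have h1 := (hΥ.smooth v hv).continuousAt
      have h2 : ContinuousAt (fun v => ((κ * (X₁ κ v + X₂ κ v) : ℝ) : ℂ)) v := by
        have := hPκ.cont₁; have := hPκ.cont₂
        exact (by fun_prop : Continuous fun v => ((κ * (X₁ κ v + X₂ κ v) : ℝ) : ℂ)).continuousAt
      have h3 : ((κ * (X₁ κ v + X₂ κ v) : ℝ) : ℂ) ≠ 0 := by
        exact_mod_cast (mul_pos hκ0 (hPκ.pos v (Ioo_subset_Icc_self hv))).ne'
      exact (h1.mul (h2.inv₀ h3)).mul (by fun_prop)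
    · exact (continuousAt_const (y := (0 : ℂ))).congr
        (notMem_tsupport_iff_eventuallyEq.mp fun h => hv (hΥs (hψs h))).symm
  obtain ⟨W, hW, hWF⟩ := exists_adjoint (κ := κ) hαβ hR.cont_ρ hPκ.cont₁ hPκ.cont₂ hψc
  have hLHS : ∀ n₁ n₂ : ℝ → ℂ,
      ∫ v : ℝ, Υ v * ((n₂ v - n₁ v) / ((κ * (X₁ κ v + X₂ κ v) : ℝ) : ℂ)) *
        Complex.exp (-(Complex.I * v * ((ξ - τ : ℝ) : ℂ))) =
      ∫ v in α..β, ψ v * (n₂ v - n₁ v) := by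
    intro n₁ n₂
    rw [intervalIntegral.integral_eq_integral_of_support_subset]
    · congr 1; ext v; simp only [hψ]; rw [div_eq_mul_inv]; ring
    · intro v hv
      have : ψ v ≠ 0 := left_ne_zero_of_mul hv
      exact Ioo_subset_Ioc_self (hΥs (hψs (subset_tsupport _ this)))
  set G : ℝ → ℂ := fun w => W w * h w * Complex.exp (-(Complex.I * τ * w)) with hG
  have hGc : Continuous G := by fun_prop
  have hRHS : ∀ f : ℝ → ℂ, ∫ v in α..β, W v * (h v * f v) = ∫ v, W v * (h v * f v) := by
    intro f
    refine intervalIntegral.integral_eq_integral_of_support_subset fun v hv => ?_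
    have : h v ≠ 0 := left_ne_zero_of_mul (right_ne_zero_of_mul hv)
    exact Ioo_subset_Ioc_self (hhs (subset_tsupport _ this))
  have hhcs : HasCompactSupport h :=
    isCompact_Icc.of_isClosed_subset (isClosed_tsupport h) (hhs.trans Ioo_subset_Icc_self)
  have hGi : Integrable G :=
    hGc.integrable_of_hasCompactSupport ((hhcs.mul_left).mul_right)
  -- The exponential responses and the given pair (n₁, n₂) are tested through the same W, so the
  -- chosen factors need not be related to the given ones.
  have hΦ : ∀ η : ℝ, (1 / (2 * Real.pi) : ℂ) *
      ∫ v : ℝ, Υ v * ((N₂ κ (η - τ) v - N₁ κ (η - τ) v) / ((κ * (X₁ κ v + X₂ κ v) : ℝ) : ℂ)) *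
        Complex.exp (-(Complex.I * v * ((ξ - τ : ℝ) : ℂ))) = (1 / (2 * Real.pi) : ℂ) *
      ∫ w : ℝ, G w * Complex.exp (Complex.I * (w : ℂ) * (η : ℂ)) := by
    intro η
    rw [hLHS, hWF _ _ _ (by fun_prop) (hF κ hκ (η - τ)), hRHS]
    congr 2
    ext w
    simp only [hG]
    have : Complex.exp (Complex.I * ((η - τ : ℝ) : ℂ) * w) =
        Complex.exp (-(Complex.I * τ * w)) * Complex.exp (Complex.I * (w : ℂ) * (η : ℂ)) := by
      rw [← Complex.exp_add]
      congr 1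
      push_cast
      ring
    rw [this]
    ring
  have hΦc : Continuous fun η : ℝ =>
      (1 / (2 * Real.pi) : ℂ) * ∫ w : ℝ, G w * Complex.exp (Complex.I * (w : ℂ) * (η : ℂ)) := by
    have h1 : Continuous (FourierTransform.fourier G : ℝ → ℂ) :=
      VectorFourier.fourierIntegral_continuous Real.continuous_fourierChar continuous_inner hGi
    simp only [fourierInv_transform_eq, Real.fourierInv_eq_fourier_neg]
    fun_prop
  have hΦi : Integrable fun η : ℝ =>
      (1 / (2 * Real.pi) : ℂ) * ∫ w : ℝ, G w * Complex.exp (Complex.I * (w : ℂ) * (η : ℂ)) := by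
    -- The second bound in the minimum dominates the kernel by a multiple of 1/(1 + (η - τ)²).
    refine (((integrable_inv_one_add_sq.comp_sub_right τ).const_mul (C / (2 * Real.pi) * C'))).mono'
      hΦc.aestronglyMeasurable (Filter.Eventually.of_forall fun η => ?_)
    rw [← hΦ]
    refine (hbd' κ (ξ - τ) (η - τ) hκ).trans ?_
    gcongr
    refine (min_le_right _ _).trans ?_
    rw [← one_div]
    gcongr
    · rw [Real.exp_le_one_iff]
      have := Real.rpow_nonneg (zero_le_one.trans (one_le_bracket (ξ - τ - (η - τ)))) s
      nlinarith
    · nlinarith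
  have hfin := integral_fourierInv_mul_fourier hGc hGi (hg.integrable_of_hasCompactSupport hgs)
    (fun η => rfl) hΦi
  simp only [hΦ]
  refine ⟨hfin.1, ?_⟩
  rw [hfin.2, hLHS, hWF _ _ _ (by fun_prop) hn]
  simp only [mul_assoc]
  rw [hRHS]
  congr 1
  ext w
  simp only [hG]
  ring_nf

/-! ### Gevrey bounds under the change of variables `v = u(y)` -/

/-- Composition with a function whose derivative is a Gevrey function of its value. -/
lemma norm_iteratedDeriv_comp_le {s A₀ M : ℝ} (hs : 0 < s) (hs1 : s ≤ 1) (hA₀ : 0 ≤ A₀)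
    (hM : 0 ≤ M) {S S' : Set ℝ} (hS' : IsOpen S') {y g : ℝ → ℝ}
    (hy : ∀ v ∈ S', y v ∈ S) (hyd : ∀ v ∈ S', HasDerivAt y (g (y v)) v)
    (hg : GevreyOn s S A₀ M g) (m : ℕ) : ∀ (f : ℝ → ℝ) (n : ℕ) (A : ℝ), 0 ≤ A →
      (∀ x ∈ S, ContDiffAt ℝ ∞ f x) →
      (∀ j, ∀ x ∈ S, ‖iteratedDeriv j f x‖ ≤ A * M ^ j * gevreyWeight s (n + j)) →
      ∀ v ∈ S', ‖iteratedDeriv m (fun v => f (y v)) v‖ ≤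
        A * (8 * A₀ * M) ^ m * gevreyWeight s (n + m) := by
  induction m with
  | zero => intro f n A _ _ h v hv; simpa using h 0 (y v) (hy v hv)
  | succ m ih =>
    intro f n A hA hf h v hv
    -- (f∘y)' = (g f')∘y, so the induction passes from f to g f', whose bounds use weights shifted
    -- by one index. Recording the shift n keeps the loss per derivative to the fixed factor 8A₀M.
    have e1 : deriv (fun v => f (y v)) =ᶠ[nhds v] fun v => (fun x => g x * deriv f x) (y v) :=
      Filter.eventuallyEq_of_mem (hS'.mem_nhds hv) fun w hw => by
        have := ((hf _ (hy w hw)).differentiableAt (by simp)).hasDerivAt.comp w (hyd w hw)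
        rw [show (fun v => f (y v)) = f ∘ y from rfl, this.deriv, mul_comm]
    rw [iteratedDeriv_succ', e1.iteratedDeriv_eq m]
    have := ih (fun x => g x * deriv f x) (n + 1) (8 * A₀ * (A * M)) (by positivity)
      (fun x hx => (hg.smooth x hx).mul ((hf x hx).derivWithin (by simp)))
      (fun j x hx => by
        refine GevreyOn.norm_iteratedDeriv_mul_le hs hs1 hA₀ (by positivity) hM hg hx
          ((hf x hx).derivWithin (by simp)) fun i _ => ?_
        rw [← iteratedDeriv_succ']
        refine (h (i + 1) x hx).trans (le_of_eq ?_)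
        rw [pow_succ, show n + 1 + i = n + (i + 1) by ring]
        ring) v hv
    refine this.trans (le_of_eq ?_)
    rw [show n + 1 + m = n + (m + 1) by ring, pow_succ]
    ring

lemma contDiffAt_comp_of_deriv {S S' : Set ℝ} (hS' : IsOpen S') {y g : ℝ → ℝ}
    (hy : ∀ v ∈ S', y v ∈ S) (hyd : ∀ v ∈ S', HasDerivAt y (g (y v)) v)
    (hg : ∀ x ∈ S, ContDiffAt ℝ ∞ g x) : ∀ v ∈ S', ContDiffAt ℝ ∞ y v := by
  have : ContDiffOn ℝ ∞ y S' := by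
    refine contDiffOn_infty_of_deriv hS'
      (fun v hv => (hyd v hv).differentiableAt.differentiableWithinAt) fun k hk => ?_
    have h1 : ContDiffOn ℝ k (fun v => g (y v)) S' := fun v hv =>
      ((hg _ (hy v hv)).of_le (by exact_mod_cast le_top)).comp_contDiffWithinAt v (hk v hv)
    exact h1.congr fun v hv => (hyd v hv).deriv
  exact fun v hv => this.contDiffAt (hS'.mem_nhds hv)

lemma GevreyOn.comp_of_deriv {s A₀ A M : ℝ} (hs : 0 < s) (hs1 : s ≤ 1) (hA₀ : 0 ≤ A₀)
    (hA : 0 ≤ A) (hM : 0 ≤ M) {S S' : Set ℝ} (hS' : IsOpen S') {y g f : ℝ → ℝ}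
    (hy : ∀ v ∈ S', y v ∈ S) (hyd : ∀ v ∈ S', HasDerivAt y (g (y v)) v)
    (hg : GevreyOn s S A₀ M g) (hf : GevreyOn s S A M f) :
    GevreyOn s S' A (8 * A₀ * M) (fun v => f (y v)) :=
  ⟨fun v hv => (hf.smooth _ (hy v hv)).comp v (contDiffAt_comp_of_deriv hS' hy hyd hg.smooth v hv),
    fun m v hv => by
      simpa using norm_iteratedDeriv_comp_le hs hs1 hA₀ hM hS' hy hyd hg m f 0 A hA hf.smooth
        (fun j x hx => by simpa using hf.bound j x hx) v hv⟩

/-! ### The inverse of the shear profile and the coefficients in v. -/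

namespace Background

variable {u θ : ℝ → ℝ} {κ₀ K s₀ : ℝ}

lemma hasDerivWithinAt_u (h : Background u θ κ₀ K s₀) {y : ℝ} (hy : y ∈ Icc (0 : ℝ) 1) :
    HasDerivWithinAt u (derivWithin u (Icc 0 1) y) (Icc 0 1) y :=
  ((h.smooth_u.differentiableOn (by simp)) y hy).hasDerivWithinAt

lemma exists_le_sub (h : Background u θ κ₀ K s₀) : ∃ c : ℝ, 0 < c ∧
    ∀ x ∈ Icc (0 : ℝ) 1, ∀ y ∈ Icc (0 : ℝ) 1, x ≤ y → c * (y - x) ≤ u y - u x := by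
  obtain ⟨c, hc, hcu⟩ := h.monotone
  refine ⟨c, hc, fun x hx y hy hxy => ?_⟩
  refine (convex_Icc (0 : ℝ) 1).mul_sub_le_image_sub_of_le_deriv h.smooth_u.continuousOn
    ((h.smooth_u.differentiableOn (by simp)).mono interior_subset) (fun z hz => ?_) x hx y hy hxy
  rw [interior_Icc] at hz
  rw [← derivWithin_of_mem_nhds (Icc_mem_nhds hz.1 hz.2)]
  exact hcu z (Ioo_subset_Icc_self hz)

lemma strictMonoOn (h : Background u θ κ₀ K s₀) : StrictMonoOn u (Icc 0 1) := by
  obtain ⟨c, hc, hcu⟩ := h.exists_le_sub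
  intro x hx y hy hxy
  have := hcu x hx y hy hxy.le
  have : 0 < c * (y - x) := mul_pos hc (by linarith)
  linarith

lemma u_zero_lt_u_one (h : Background u θ κ₀ K s₀) : u 0 < u 1 :=
  h.strictMonoOn (by simp) (by simp) zero_lt_one

lemma exists_eq (h : Background u θ κ₀ K s₀) {v : ℝ} (hv : v ∈ Icc (u 0) (u 1)) :
    ∃ y ∈ Icc (0 : ℝ) 1, u y = v :=
  intermediate_value_Icc zero_le_one h.smooth_u.continuousOn hv

lemma inv_mem (h : Background u θ κ₀ K s₀) {v : ℝ} (hv : v ∈ Icc (u 0) (u 1)) :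
    Function.invFunOn u (Icc 0 1) v ∈ Icc (0 : ℝ) 1 :=
  Function.invFunOn_mem (h.exists_eq hv)

lemma apply_inv (h : Background u θ κ₀ K s₀) {v : ℝ} (hv : v ∈ Icc (u 0) (u 1)) :
    u (Function.invFunOn u (Icc 0 1) v) = v :=
  Function.invFunOn_eq (h.exists_eq hv)

lemma inv_mem_Ioo (h : Background u θ κ₀ K s₀) {v : ℝ} (hv : v ∈ Ioo (u 0) (u 1)) :
    Function.invFunOn u (Icc 0 1) v ∈ Ioo (0 : ℝ) 1 := by
  have hv' := Ioo_subset_Icc_self hv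
  have h1 := h.inv_mem hv'
  have h2 := h.apply_inv hv'
  refine ⟨h1.1.lt_of_ne ?_, h1.2.lt_of_ne ?_⟩
  · intro h0; rw [← h0] at h2; exact hv.1.ne h2
  · intro h0; rw [h0] at h2; exact hv.2.ne h2.symm

lemma inv_lt (h : Background u θ κ₀ K s₀) {v y : ℝ} (hv : v ∈ Icc (u 0) (u 1))
    (hy : y ∈ Icc (0 : ℝ) 1) (hvy : v < u y) : Function.invFunOn u (Icc 0 1) v < y := by
  rw [← h.strictMonoOn.lt_iff_lt (h.inv_mem hv) hy, h.apply_inv hv]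
  exact hvy

lemma lt_inv (h : Background u θ κ₀ K s₀) {v y : ℝ} (hv : v ∈ Icc (u 0) (u 1))
    (hy : y ∈ Icc (0 : ℝ) 1) (hvy : u y < v) : y < Function.invFunOn u (Icc 0 1) v := by
  rw [← h.strictMonoOn.lt_iff_lt hy (h.inv_mem hv), h.apply_inv hv]
  exact hvy

lemma continuousOn_inv (h : Background u θ κ₀ K s₀) :
    ContinuousOn (Function.invFunOn u (Icc 0 1)) (Icc (u 0) (u 1)) := by
  obtain ⟨c, hc, hcu⟩ := h.exists_le_sub
  have key : LipschitzOnWith (Real.toNNReal (1 / c)) (Function.invFunOn u (Icc 0 1))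
      (Icc (u 0) (u 1)) := by
    refine LipschitzOnWith.of_dist_le_mul fun v hv w hw => ?_
    rw [Real.coe_toNNReal _ (by positivity), Real.dist_eq, Real.dist_eq, one_div,
      inv_mul_eq_div, le_div_iff₀ hc]
    have h1 := h.apply_inv hv
    have h2 := h.apply_inv hw
    rcases le_total (Function.invFunOn u (Icc 0 1) v) (Function.invFunOn u (Icc 0 1) w) with h3 | h3
    · have := hcu _ (h.inv_mem hv) _ (h.inv_mem hw) h3
      rw [h1, h2] at this
      rw [abs_sub_comm, abs_of_nonneg (by linarith), abs_sub_comm]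
      refine le_trans ?_ (le_abs_self _)
      linarith
    · have := hcu _ (h.inv_mem hw) _ (h.inv_mem hv) h3
      rw [h1, h2] at this
      rw [abs_of_nonneg (by linarith)]
      refine le_trans ?_ (le_abs_self _)
      linarith
  exact key.continuousOn

lemma derivWithin_pos (h : Background u θ κ₀ K s₀) {y : ℝ} (hy : y ∈ Icc (0 : ℝ) 1) :
    0 < derivWithin u (Icc 0 1) y := by
  obtain ⟨c, hc, hcu⟩ := h.monotone
  exact hc.trans_le (hcu y hy)

lemma hasDerivAt_inv (h : Background u θ κ₀ K s₀) {v : ℝ} (hv : v ∈ Ioo (u 0) (u 1)) :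
    HasDerivAt (Function.invFunOn u (Icc 0 1))
      ((derivWithin u (Icc 0 1) (Function.invFunOn u (Icc 0 1) v))⁻¹) v := by
  have hv' := Ioo_subset_Icc_self hv
  have h1 := h.inv_mem_Ioo hv
  refine HasDerivAt.of_local_left_inverse
    ((h.continuousOn_inv v hv').continuousAt (Icc_mem_nhds hv.1 hv.2))
    ((h.hasDerivWithinAt_u (h.inv_mem hv')).hasDerivAt (Icc_mem_nhds h1.1 h1.2))
    (h.derivWithin_pos (h.inv_mem hv')).ne' ?_
  filter_upwards [Icc_mem_nhds hv.1 hv.2] with w hw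
  exact h.apply_inv hw

lemma contDiffOn_derivWithin (h : Background u θ κ₀ K s₀) :
    ContDiffOn ℝ ∞ (derivWithin u (Icc 0 1)) (Icc 0 1) :=
  h.smooth_u.derivWithin (uniqueDiffOn_Icc zero_lt_one) (by simp)

/-- Gevrey bounds for `f` from bounds on its derivative, on the unit interval. -/
lemma _root_.PressureKernel.exists_gevreyOn_of_iteratedDerivWithin {s s₀ K : ℝ} (hs : 0 < s)
    (hs1 : s ≤ 1) (hss₀ : s ≤ s₀) (hK : 1 < K) {f : ℝ → ℝ} (hf : ContDiffOn ℝ ∞ f (Icc 0 1))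
    (hb : ∀ m : ℕ, ∀ y ∈ Icc (0 : ℝ) 1,
      |iteratedDerivWithin (m + 1) f (Icc 0 1) y| ≤ K ^ m * gevreyWeight s₀ m) :
    ∃ A : ℝ, 0 ≤ A ∧ GevreyOn s (Ioo 0 1) A K f := by
  obtain ⟨C, hC⟩ := isCompact_Icc.exists_bound_of_continuousOn hf.continuousOn
  have hC0 : 0 ≤ C := (norm_nonneg _).trans (hC 0 (by simp))
  have hsm : ∀ v ∈ Ioo (0 : ℝ) 1, ContDiffAt ℝ ∞ f v := fun v hv =>
    hf.contDiffAt (Icc_mem_nhds hv.1 hv.2)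
  refine ⟨C + 4, by positivity, hsm, fun m v hv => ?_⟩
  have hv' := Ioo_subset_Icc_self hv
  rcases m with _ | m
  · simp only [iteratedDeriv_zero, pow_zero, gevreyWeight_zero, mul_one]
    linarith [hC v hv']
  · rw [← iteratedDerivWithin_eq_iteratedDeriv (uniqueDiffOn_Icc zero_lt_one)
      ((hsm v hv).of_le (by exact_mod_cast le_top)) hv']
    have h1 := gevreyWeight_pos s m
    have h2 := gevreyWeight_pos s (m + 1)
    calc _ ≤ K ^ m * gevreyWeight s₀ m := hb m v hv'
      _ ≤ K ^ (m + 1) * (4 * gevreyWeight s (m + 1)) := by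
        gcongr
        · exact (gevreyWeight_pos s₀ m).le
        · exact hK.le
        · omega
        · exact (gevreyWeight_anti hs hss₀ m).trans (gevreyWeight_le_succ hs hs1 m)
      _ ≤ _ := by
        have : 0 ≤ C * (K ^ (m + 1) * gevreyWeight s (m + 1)) := by positivity
        linarith

lemma const_of_derivWithin_eq_zero {f : ℝ → ℝ} (hf : DifferentiableOn ℝ f (Icc 0 1)) {a b : ℝ}
    (ha : 0 ≤ a) (hab : a ≤ b) (hb : b ≤ 1)
    (h0 : ∀ y ∈ Ico a b, derivWithin f (Icc 0 1) y = 0) : f b = f a := by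
  refine constant_of_has_deriv_right_zero (hf.continuousOn.mono (Icc_subset_Icc ha hb))
    (fun x hx => ?_) b ⟨hab, le_rfl⟩
  have hx' : x ∈ Icc (0 : ℝ) 1 := ⟨ha.trans hx.1, hx.2.le.trans hb⟩
  have h1 := (hf x hx').hasDerivWithinAt
  rw [h0 x hx] at h1
  exact h1.mono_of_mem_nhdsWithin (mem_nhdsWithin.mpr ⟨Iio 1, isOpen_Iio, hx.2.trans_le hb,
    fun y hy => ⟨hx'.1.trans hy.2, hy.1.le⟩⟩)

/-- This is where the supports of u'' and θ' enter: the boundary layers of the Riccati solutions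
form where the coefficients are constant. -/
lemma const_near_endpoints (h : Background u θ κ₀ K s₀) :
    (∀ y ∈ Icc (0 : ℝ) 1, y < 4 * κ₀ →
      θ y = θ 0 ∧ derivWithin u (Icc 0 1) y = derivWithin u (Icc 0 1) 0) ∧
    (∀ y ∈ Icc (0 : ℝ) 1, 1 - 4 * κ₀ < y →
      θ y = θ 1 ∧ derivWithin u (Icc 0 1) y = derivWithin u (Icc 0 1) 1) := by
  have hdu := h.contDiffOn_derivWithin.differentiableOn (by simp)
  have hdθ := h.smooth_θ.differentiableOn (by simp)
  have h2 : ∀ y ∈ Icc (0 : ℝ) 1, y ∉ Icc (4 * κ₀) (1 - 4 * κ₀) →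
      derivWithin (derivWithin u (Icc 0 1)) (Icc 0 1) y = 0 := fun y hy hy' => by
    have := h.supp_u y hy hy'
    rwa [iteratedDerivWithin_succ', iteratedDerivWithin_one] at this
  constructor
  · intro y hy hy4
    have hn : ∀ z ∈ Ico 0 y, z ∉ Icc (4 * κ₀) (1 - 4 * κ₀) := fun z hz hz' => by
      linarith [hz.2, hz'.1]
    have hm : ∀ z ∈ Ico 0 y, z ∈ Icc (0 : ℝ) 1 := fun z hz => ⟨hz.1, hz.2.le.trans hy.2⟩
    exact ⟨const_of_derivWithin_eq_zero hdθ le_rfl hy.1 hy.2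
      fun z hz => h.supp_θ z (hm z hz) (hn z hz), const_of_derivWithin_eq_zero hdu le_rfl hy.1 hy.2
      fun z hz => h2 z (hm z hz) (hn z hz)⟩
  · intro y hy hy4
    have hn : ∀ z ∈ Ico y 1, z ∉ Icc (4 * κ₀) (1 - 4 * κ₀) := fun z hz hz' => by
      linarith [hz.1, hz'.2]
    have hm : ∀ z ∈ Ico y 1, z ∈ Icc (0 : ℝ) 1 := fun z hz => ⟨hy.1.trans hz.1, hz.2.le⟩
    exact ⟨(const_of_derivWithin_eq_zero hdθ hy.1 hy.2 le_rfl
      fun z hz => h.supp_θ z (hm z hz) (hn z hz)).symm,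
      (const_of_derivWithin_eq_zero hdu hy.1 hy.2 le_rfl
      fun z hz => h2 z (hm z hz) (hn z hz)).symm⟩

lemma theta_pos (h : Background u θ κ₀ K s₀) {y : ℝ} (hy : y ∈ Icc (0 : ℝ) 1) : 0 < θ y := by
  obtain ⟨c, hc, hcu⟩ := h.positive
  exact hc.trans_le (hcu y hy)

lemma continuousOn_tilde (h : Background u θ κ₀ K s₀) {φ : ℝ → ℝ}
    (hφ : ContinuousOn φ (Icc 0 1)) : ContinuousOn (tilde u φ) (Icc (u 0) (u 1)) :=
  hφ.comp h.continuousOn_inv fun _ hv => h.inv_mem hv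

end Background

lemma exists_pos_bounds {f : ℝ → ℝ} (hf : ContinuousOn f (Icc 0 1))
    (hpos : ∀ y ∈ Icc (0 : ℝ) 1, 0 < f y) :
    ∃ c A : ℝ, 0 < c ∧ ∀ y ∈ Icc (0 : ℝ) 1, c ≤ f y ∧ f y ≤ A := by
  have hne : (Icc (0 : ℝ) 1).Nonempty := ⟨0, by simp⟩
  obtain ⟨x, hx, hxm⟩ := isCompact_Icc.exists_isMinOn hne hf
  obtain ⟨z, hz, hzm⟩ := isCompact_Icc.exists_isMaxOn hne hf
  exact ⟨f x, f z, hpos x hx, fun y hy => ⟨hxm hy, hzm hy⟩⟩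

/-- The hypotheses are symmetric under v ↦ -v, so all results for the left endpoint also serve the
right one. -/
lemma RiccatiCoeff.of_two_sided {s α β δ c A M : ℝ} (hαβ : α < β) (hδ : 0 < δ) (hc : 0 < c)
    (hM : 0 ≤ M) {p ρ : ℝ → ℝ} (hp : Continuous p) (hρ : Continuous ρ)
    (hpm : ∀ v, p v ∈ Icc c A) (hρm : ∀ v, ρ v ∈ Icc c A)
    (hpg : GevreyOn s (Ioo α β) A M p) (hρg : GevreyOn s (Ioo α β) A M ρ)
    (hl : ∀ v ∈ Ioo α (α + δ), p v = p α ∧ ρ v = ρ α)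
    (hr : ∀ v ∈ Ioo (β - δ) β, p v = p β ∧ ρ v = ρ β) :
    RiccatiCoeff s α β δ c A M p ρ ∧
      RiccatiCoeff s (-β) (-α) δ c A M (fun v => p (-v)) (fun v => ρ (-v)) := by
  have hrefl : Neg.neg ⁻¹' (Ioo α β) = Ioo (-β) (-α) := by
    ext v; simp only [mem_preimage, mem_Ioo]; constructor <;> rintro ⟨_, _⟩ <;> constructor <;>
      linarith
  have hpg' := hpg.comp_neg
  have hρg' := hρg.comp_neg
  rw [hrefl] at hpg' hρg'
  have hm : ∀ v ∈ Ioo (-β) (-β + δ), -v ∈ Ioo (β - δ) β := fun v hv =>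
    ⟨by linarith [hv.2], by linarith [hv.1]⟩
  exact ⟨⟨hαβ, hδ, hc, hM, hp, hρ, hpm, hρm, hpg, hρg, fun v hv => (hl v hv).1,
    fun v hv => (hl v hv).2⟩, ⟨neg_lt_neg hαβ, hδ, hc, hM, hp.comp continuous_neg,
    hρ.comp continuous_neg, fun v => hpm (-v), fun v => hρm (-v), hpg', hρg',
    fun v hv => by simpa using (hr (-v) (hm v hv)).1,
    fun v hv => by simpa using (hr (-v) (hm v hv)).2⟩⟩

namespace Background

variable {u θ : ℝ → ℝ} {κ₀ K s₀ : ℝ}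

/-- The coefficients `θ/u'`, `1/(θu')` and `1/u'` are Gevrey functions on the unit interval. -/
lemma exists_gevrey_coeff (h : Background u θ κ₀ K s₀) {s : ℝ} (hs : 0 < s) (hs1 : s ≤ 1)
    (hss₀ : s ≤ s₀) (hK : 1 < K) : ∃ A M : ℝ, 0 ≤ A ∧ 0 ≤ M ∧
      GevreyOn s (Ioo 0 1) A M (fun y => (derivWithin u (Icc 0 1) y)⁻¹) ∧
      GevreyOn s (Ioo 0 1) A M (fun y => θ y * (derivWithin u (Icc 0 1) y)⁻¹) ∧
      GevreyOn s (Ioo 0 1) A M (fun y => (θ y)⁻¹ * (derivWithin u (Icc 0 1) y)⁻¹) := by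
  obtain ⟨Aθ, hAθ, gθ⟩ := exists_gevreyOn_of_iteratedDerivWithin hs hs1 hss₀ hK h.smooth_θ
    fun m y hy => by
      have := h.gevrey m y hy y hy
      have := abs_nonneg (iteratedDerivWithin (m + 2) u (Icc 0 1) y)
      linarith
  obtain ⟨Au, hAu, gu⟩ := exists_gevreyOn_of_iteratedDerivWithin hs hs1 hss₀ hK
    h.contDiffOn_derivWithin fun m y hy => by
      have h1 := h.gevrey m y hy y hy
      have := abs_nonneg (iteratedDerivWithin (m + 1) θ (Icc 0 1) y)
      rw [iteratedDerivWithin_succ' (n := m + 1)] at h1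
      linarith
  obtain ⟨c, hc, hcu⟩ := h.monotone
  obtain ⟨c', hc', hcθ⟩ := h.positive
  have hK0 : 0 ≤ K := by linarith
  have gi := gu.inv hs hs1 isOpen_Ioo hAu hK0 hc fun v hv =>
    (hcu v (Ioo_subset_Icc_self hv)).trans (le_abs_self _)
  have gθi := gθ.inv hs hs1 isOpen_Ioo hAθ hK0 hc' fun v hv =>
    (hcθ v (Ioo_subset_Icc_self hv)).trans (le_abs_self _)
  set M₁ := K * ((8 * Au + c) / c) with hM₁
  set M₂ := K * ((8 * Aθ + c') / c') with hM₂
  have hM₁0 : 0 ≤ M₁ := by positivity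
  have hM₂0 : 0 ≤ M₂ := by positivity
  have gi' := gi.mono (by positivity) hM₁0 le_rfl (by linarith : M₁ ≤ K + M₁ + M₂)
  have gp := (gθ.mono hAθ hK0 le_rfl (by linarith : K ≤ K + M₁ + M₂)).mul hs hs1 hAθ
    (by positivity) (by positivity) gi'
  have gr := (gθi.mono (by positivity) hM₂0 le_rfl (by linarith : M₂ ≤ K + M₁ + M₂)).mul hs hs1
    (by positivity) (by positivity) (by positivity) gi'
  have e1 : 0 ≤ 1 / c := by positivity
  have e2 : 0 ≤ 8 * Aθ * (1 / c) := by positivity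
  have e3 : 0 ≤ 8 * (1 / c') * (1 / c) := by positivity
  refine ⟨1 / c + 8 * Aθ * (1 / c) + 8 * (1 / c') * (1 / c), K + M₁ + M₂, by positivity,
    by positivity, gi'.mono e1 (by positivity) (by linarith) le_rfl,
    gp.mono e2 (by positivity) (by linarith) le_rfl,
    gr.mono e3 (by positivity) (by linarith) le_rfl⟩

/-- The coefficients of the rescaled pressure equation in the variable `v`. -/
theorem exists_coeff (h : Background u θ κ₀ K s₀) {s : ℝ} (hs : 0 < s) (hs1 : s ≤ 1)
    (hss₀ : s ≤ s₀) (hK : 1 < K) (hκ₀ : 0 < κ₀) (hκ₀' : κ₀ ≤ 1 / 10) :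
    ∃ (δ c A M : ℝ) (p ρ b : ℝ → ℝ), RiccatiCoeff s (u 0) (u 1) δ c A M p ρ ∧
      RiccatiCoeff s (-(u 1)) (-(u 0)) δ c A M (fun v => p (-v)) (fun v => ρ (-v)) ∧
      GevreyOn s (Ioo (u 0) (u 1)) A M b ∧ ∀ v ∈ Icc (u 0) (u 1),
        p v = tilde u θ v * (tildeDeriv u v)⁻¹ ∧ ρ v = (tilde u θ v)⁻¹ * (tildeDeriv u v)⁻¹ ∧
        b v = (tildeDeriv u v)⁻¹ := by
  have hαβ := h.u_zero_lt_u_one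
  obtain ⟨A₀, M₀, hA₀, hM₀, gb, gp, gr⟩ := h.exists_gevrey_coeff hs hs1 hss₀ hK
  set ub : ℝ → ℝ := fun y => (derivWithin u (Icc 0 1) y)⁻¹ with hub
  set P : ℝ → ℝ := fun y => θ y * (derivWithin u (Icc 0 1) y)⁻¹ with hP
  set R : ℝ → ℝ := fun y => (θ y)⁻¹ * (derivWithin u (Icc 0 1) y)⁻¹ with hR
  have hubc : ContinuousOn ub (Icc 0 1) :=
    h.contDiffOn_derivWithin.continuousOn.inv₀ fun y hy => (h.derivWithin_pos hy).ne'
  have hPc : ContinuousOn P (Icc 0 1) := h.smooth_θ.continuousOn.mul hubc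
  have hRc : ContinuousOn R (Icc 0 1) :=
    (h.smooth_θ.continuousOn.inv₀ fun y hy => (h.theta_pos hy).ne').mul hubc
  obtain ⟨c₁, A₁, hc₁, hb₁⟩ := exists_pos_bounds hPc fun y hy =>
    mul_pos (h.theta_pos hy) (inv_pos.mpr (h.derivWithin_pos hy))
  obtain ⟨c₂, A₂, hc₂, hb₂⟩ := exists_pos_bounds hRc fun y hy =>
    mul_pos (inv_pos.mpr (h.theta_pos hy)) (inv_pos.mpr (h.derivWithin_pos hy))
  -- Extension by the endpoint values gives continuous coefficients bounded on the whole line; only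
  -- their values between u(0) and u(1) matter.
  let E : (ℝ → ℝ) → ℝ → ℝ := fun φ =>
    IccExtend hαβ.le ((Icc (u 0) (u 1)).domRestrict (tilde u φ))
  have hEc : ∀ φ, ContinuousOn φ (Icc 0 1) → Continuous (E φ) := fun φ hφ =>
    (continuousOn_iff_continuous_domRestrict.mp (h.continuousOn_tilde hφ)).Icc_extend'
  have hEeq : ∀ φ, ∀ v ∈ Icc (u 0) (u 1), E φ v = φ (Function.invFunOn u (Icc 0 1) v) :=
    fun φ v hv => IccExtend_of_mem _ _ hv
  have hEm : ∀ φ v, ∃ y ∈ Icc (0 : ℝ) 1, E φ v = φ y := fun φ v =>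
    ⟨_, h.inv_mem (projIcc (u 0) (u 1) hαβ.le v).2, rfl⟩
  -- The inverse of u solves y' = (1/u')(y), and 1/u' is Gevrey by `gb`.
  have hEg : ∀ φ, GevreyOn s (Ioo 0 1) A₀ M₀ φ →
      GevreyOn s (Ioo (u 0) (u 1)) A₀ (8 * A₀ * M₀) (E φ) := fun φ hφ =>
    (GevreyOn.comp_of_deriv hs hs1 hA₀ hA₀ hM₀ isOpen_Ioo (fun v hv => h.inv_mem_Ioo hv)
      (fun v hv => h.hasDerivAt_inv hv) gb hφ).congr isOpen_Ioo
      fun v hv => (hEeq φ v (Ioo_subset_Icc_self hv)).symm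
  have h4 : (4 * κ₀) ∈ Icc (0 : ℝ) 1 := ⟨by linarith, by linarith⟩
  have h4' : (1 - 4 * κ₀) ∈ Icc (0 : ℝ) 1 := ⟨by linarith, by linarith⟩
  -- δ is at most the width, in the variable v, of each of the two layers in which the coefficients
  -- are constant.
  have hδ : 0 < min (u (4 * κ₀) - u 0) (u 1 - u (1 - 4 * κ₀)) := by
    have h5 := h.strictMonoOn (by simp) h4 (by linarith : 0 < 4 * κ₀)
    have h6 := h.strictMonoOn h4' (by simp) (by linarith : 1 - 4 * κ₀ < 1)
    exact lt_min (by linarith) (by linarith)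
  obtain ⟨hcl, hcr⟩ := h.const_near_endpoints
  have h0 : Function.invFunOn u (Icc 0 1) (u 0) = 0 := h.strictMonoOn.injOn.leftInvOn_invFunOn
    (by simp)
  have h1 : Function.invFunOn u (Icc 0 1) (u 1) = 1 := h.strictMonoOn.injOn.leftInvOn_invFunOn
    (by simp)
  have hA₁ : 0 ≤ |A₁| := abs_nonneg _
  have hA₂ : 0 ≤ |A₂| := abs_nonneg _
  have hMM : 0 ≤ 8 * A₀ * M₀ := by positivity
  set δ := min (u (4 * κ₀) - u 0) (u 1 - u (1 - 4 * κ₀)) with hδdef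
  have hδ1 : δ ≤ u (4 * κ₀) - u 0 := min_le_left _ _
  have hδ2 : δ ≤ u 1 - u (1 - 4 * κ₀) := min_le_right _ _
  have hu4 : u (4 * κ₀) ≤ u 1 := h.strictMonoOn.monotoneOn h4 (by simp) h4.2
  have hu4' : u 0 ≤ u (1 - 4 * κ₀) := h.strictMonoOn.monotoneOn (by simp) h4' h4'.1
  have hleft : ∀ v ∈ Ioo (u 0) (u 0 + δ), θ (Function.invFunOn u (Icc 0 1) v) = θ 0 ∧
      derivWithin u (Icc 0 1) (Function.invFunOn u (Icc 0 1) v) =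
        derivWithin u (Icc 0 1) 0 ∧ v ∈ Icc (u 0) (u 1) := fun v hv => by
    have hv' : v ∈ Icc (u 0) (u 1) := ⟨hv.1.le, by linarith [hv.2]⟩
    have := hcl _ (h.inv_mem hv') (h.inv_lt hv' h4 (by linarith [hv.2]))
    exact ⟨this.1, this.2, hv'⟩
  have hright : ∀ v ∈ Ioo (u 1 - δ) (u 1), θ (Function.invFunOn u (Icc 0 1) v) = θ 1 ∧
      derivWithin u (Icc 0 1) (Function.invFunOn u (Icc 0 1) v) =
        derivWithin u (Icc 0 1) 1 ∧ v ∈ Icc (u 0) (u 1) := fun v hv => by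
    have hv' : v ∈ Icc (u 0) (u 1) := ⟨by linarith [hv.1], hv.2.le⟩
    have := hcr _ (h.inv_mem hv') (h.lt_inv hv' h4' (by linarith [hv.1]))
    exact ⟨this.1, this.2, hv'⟩
  have hmem0 : u 0 ∈ Icc (u 0) (u 1) := left_mem_Icc.mpr hαβ.le
  have hmem1 : u 1 ∈ Icc (u 0) (u 1) := right_mem_Icc.mpr hαβ.le
  obtain ⟨r1, r2⟩ := RiccatiCoeff.of_two_sided (s := s) (c := min c₁ c₂) (A := A₀ + |A₁| + |A₂|)
    (M := 8 * A₀ * M₀) (p := E P) (ρ := E R) hαβ hδ (lt_min hc₁ hc₂) hMM (hEc P hPc) (hEc R hRc)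
    (fun v => by
      obtain ⟨y, hy, e⟩ := hEm P v
      rw [e]
      exact ⟨(min_le_left _ _).trans (hb₁ y hy).1, by linarith [(hb₁ y hy).2, le_abs_self A₁]⟩)
    (fun v => by
      obtain ⟨y, hy, e⟩ := hEm R v
      rw [e]
      exact ⟨(min_le_right _ _).trans (hb₂ y hy).1, by linarith [(hb₂ y hy).2, le_abs_self A₂]⟩)
    ((hEg P gp).mono hA₀ hMM (by linarith) le_rfl) ((hEg R gr).mono hA₀ hMM (by linarith) le_rfl)
    (fun v hv => by
      obtain ⟨e1, e2, hv'⟩ := hleft v hv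
      rw [hEeq P v hv', hEeq R v hv', hEeq P _ hmem0, hEeq R _ hmem0, h0]
      simp only [hP, hR, e1, e2, and_self])
    (fun v hv => by
      obtain ⟨e1, e2, hv'⟩ := hright v hv
      rw [hEeq P v hv', hEeq R v hv', hEeq P _ hmem1, hEeq R _ hmem1, h1]
      simp only [hP, hR, e1, e2, and_self])
  refine ⟨δ, _, _, _, E P, E R, E ub, r1, r2,
    (hEg ub gb).mono hA₀ hMM (by linarith) le_rfl, fun v hv => ⟨hEeq P v hv, hEeq R v hv,
    hEeq ub v hv⟩⟩

end Background

/-! ### Reduction to a single Fourier mode -/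

lemma continuousOn_fourierZ {α β : ℝ} (hαβ : α ≤ β) {G : ℝ → ℝ → ℂ}
    (hG : ContinuousOn (fun p : ℝ × ℝ => G p.1 p.2) (univ ×ˢ Icc α β)) (k : ℤ) :
    ContinuousOn (fourierZ G k) (Icc α β) := by
  have h1 : Continuous fun p : ℝ × ℝ => G p.2 (projIcc α β hαβ p.1) :=
    hG.comp_continuous (f := fun p : ℝ × ℝ => (p.2, (projIcc α β hαβ p.1 : ℝ)))
      (by fun_prop) fun p => ⟨mem_univ _, (projIcc α β hαβ p.1).2⟩
  have h2 : Continuous fun v : ℝ => ∫ z in (0 : ℝ)..(2 * Real.pi),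
      G z (projIcc α β hαβ v) * Complex.exp (-(Complex.I * (z : ℂ) * (k : ℂ))) :=
    intervalIntegral.continuous_parametric_intervalIntegral_of_continuous'
      (f := fun v z => G z (projIcc α β hαβ v) * Complex.exp (-(Complex.I * (z : ℂ) * (k : ℂ))))
      (h1.mul (by fun_prop)) 0 (2 * Real.pi)
  refine (h2.const_mul (1 / (2 * Real.pi) : ℂ)).continuousOn.congr fun v hv => ?_
  simp only [fourierZ, projIcc_of_mem hαβ hv]

lemma continuous_slice {J : Set ℝ} {G : ℝ → ℝ → ℂ}
    (hG : ContinuousOn (fun p : ℝ × ℝ => G p.1 p.2) (univ ×ˢ J)) {v : ℝ} (hv : v ∈ J) :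
    Continuous fun z => G z v :=
  hG.comp_continuous (f := fun z : ℝ => (z, v)) (by fun_prop) fun _ => ⟨mem_univ _, hv⟩

lemma hasDerivAt_fourierZ {α β : ℝ} {G G' : ℝ → ℝ → ℂ}
    (hG : ContinuousOn (fun p : ℝ × ℝ => G p.1 p.2) (univ ×ˢ Ioo α β))
    (hG' : ContinuousOn (fun p : ℝ × ℝ => G' p.1 p.2) (univ ×ˢ Ioo α β))
    (hd : ∀ z, ∀ v ∈ Ioo α β, HasDerivAt (G z) (G' z v) v) (k : ℤ) {v : ℝ} (hv : v ∈ Ioo α β) :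
    HasDerivAt (fourierZ G k) (fourierZ G' k v) v := by
  obtain ⟨a, ha, hav⟩ := exists_between hv.1
  obtain ⟨b, hvb, hb⟩ := exists_between hv.2
  have hsub : Icc a b ⊆ Ioo α β := fun x hx => ⟨ha.trans_le hx.1, hx.2.trans_lt hb⟩
  obtain ⟨C, hC⟩ := (isCompact_Icc.prod isCompact_Icc : IsCompact
    (Icc (0 : ℝ) (2 * Real.pi) ×ˢ Icc a b)).exists_bound_of_continuousOn
      (hG'.mono (prod_mono (subset_univ _) hsub))
  have hcont : ∀ {G : ℝ → ℝ → ℂ}, ContinuousOn (fun p : ℝ × ℝ => G p.1 p.2) (univ ×ˢ Ioo α β) →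
      ∀ w ∈ Ioo α β, Continuous fun z : ℝ =>
        G z w * Complex.exp (-(Complex.I * (z : ℂ) * (k : ℂ))) :=
    fun hG w hw => (continuous_slice hG hw).mul (by fun_prop)
  refine (intervalIntegral.hasDerivAt_integral_of_dominated_loc_of_deriv_le (μ := volume)
    (F := fun v z => G z v * Complex.exp (-(Complex.I * (z : ℂ) * (k : ℂ))))
    (F' := fun v z => G' z v * Complex.exp (-(Complex.I * (z : ℂ) * (k : ℂ))))
    (bound := fun _ => C) (s := Icc a b) (Icc_mem_nhds hav hvb) ?_
    ((hcont hG v hv).intervalIntegrable _ _) (hcont hG' v hv).aestronglyMeasurable ?_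
    intervalIntegrable_const ?_).2.const_mul _
  · filter_upwards [Icc_mem_nhds hav hvb] with w hw
    exact (hcont hG w (hsub hw)).aestronglyMeasurable
  · refine Filter.Eventually.of_forall fun z hz w hw => ?_
    rw [uIoc_of_le (by positivity)] at hz
    have e : ‖Complex.exp (-(Complex.I * (z : ℂ) * (k : ℂ)))‖ = 1 := by
      rw [Complex.norm_exp]; simp
    rw [norm_mul, e, mul_one]
    exact hC (z, w) ⟨⟨hz.1.le, hz.2⟩, hw⟩
  · exact Filter.Eventually.of_forall fun z _ w hw => (hd z w (hsub hw)).mul_const _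

/-- Integration by parts over a period; periodicity cancels the boundary terms. -/
lemma fourierZ_of_hasDerivAt {f f' : ℝ → ℝ → ℂ} {v : ℝ}
    (hper : Function.Periodic (fun z => f z v) (2 * Real.pi))
    (hd : ∀ z, HasDerivAt (fun z => f z v) (f' z v) z) (hc : Continuous fun z => f' z v) (k : ℤ) :
    fourierZ f' k v = Complex.I * k * fourierZ f k v := by
  have he : ∀ z : ℝ, HasDerivAt (fun z : ℝ => Complex.exp (-(Complex.I * (z : ℂ) * (k : ℂ))))
      (-(Complex.I * k) * Complex.exp (-(Complex.I * (z : ℂ) * (k : ℂ)))) z := fun z => by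
    have h := (((Complex.ofRealCLM.hasDerivAt (x := z)).const_mul Complex.I).mul_const
      (k : ℂ)).neg.cexp
    simp only [Complex.ofRealCLM_apply, Complex.ofReal_one, mul_one] at h
    rw [mul_comm]
    exact h
  have hint := intervalIntegral.integral_mul_deriv_eq_deriv_mul (a := 0) (b := 2 * Real.pi)
    (u := fun z : ℝ => Complex.exp (-(Complex.I * (z : ℂ) * (k : ℂ)))) (v := fun z => f z v)
    (fun z _ => he z) (fun z _ => hd z)
    ((by fun_prop : Continuous fun z : ℝ => -(Complex.I * k) *
      Complex.exp (-(Complex.I * (z : ℂ) * (k : ℂ)))).intervalIntegrable _ _)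
    (hc.intervalIntegrable _ _)
  have h0 : f (2 * Real.pi) v = f 0 v := by simpa using hper 0
  have h1 : Complex.exp (-(Complex.I * ((2 * Real.pi : ℝ) : ℂ) * (k : ℂ))) = 1 := by
    rw [Complex.exp_eq_one_iff]
    exact ⟨-k, by push_cast; ring⟩
  have h2 : Complex.exp (-(Complex.I * ((0 : ℝ) : ℂ) * (k : ℂ))) = 1 := by simp
  simp only [h0, h1, h2, sub_self, zero_sub] at hint
  unfold fourierZ
  simp only [mul_comm (f' _ v), mul_comm (f _ v)]
  rw [hint, ← intervalIntegral.integral_neg, ← intervalIntegral.integral_const_mul,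
    ← intervalIntegral.integral_const_mul, ← intervalIntegral.integral_const_mul]
  congr 1
  ext z
  ring

lemma fourierZ_add {f g : ℝ → ℝ → ℂ} {v : ℝ} (hf : Continuous fun z => f z v)
    (hg : Continuous fun z => g z v) (a b : ℂ) (k : ℤ) :
    fourierZ (fun z v => a * f z v + b * g z v) k v = a * fourierZ f k v + b * fourierZ g k v := by
  unfold fourierZ
  simp only [add_mul, mul_assoc]
  rw [intervalIntegral.integral_add, intervalIntegral.integral_const_mul,
    intervalIntegral.integral_const_mul]
  · ring
  · exact (by fun_prop : Continuous fun z : ℝ => a * (f z v *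
      Complex.exp (-(Complex.I * ((z : ℂ) * (k : ℂ)))))).intervalIntegrable _ _
  · exact (by fun_prop : Continuous fun z : ℝ => b * (g z v *
      Complex.exp (-(Complex.I * ((z : ℂ) * (k : ℂ)))))).intervalIntegrable _ _

/-! ### Partial derivatives on the open and on the closed strip. -/

section PartialDerivatives

variable {u : ℝ → ℝ} {J : Set ℝ} {f : ℝ → ℝ → ℂ}

lemma hasDerivAt_dz (hf : DifferentiableOn ℝ (fun p : ℝ × ℝ => f p.1 p.2) (univ ×ˢ J)) (z : ℝ)
    {v : ℝ} (hv : v ∈ J) : HasDerivAt (fun z => f z v)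
      (fderivWithin ℝ (fun p : ℝ × ℝ => f p.1 p.2) (univ ×ˢ J) (z, v) (1, 0)) z := by
  have h1 : HasDerivWithinAt (fun z : ℝ => (z, v)) ((1 : ℝ), (0 : ℝ)) univ z :=
    (hasDerivWithinAt_id z univ).prodMk (hasDerivWithinAt_const z univ v)
  have := (hf (z, v) ⟨mem_univ _, hv⟩).hasFDerivWithinAt.comp_hasDerivWithinAt_of_eq z h1
    (fun _ _ => ⟨mem_univ _, hv⟩) rfl
  exact hasDerivWithinAt_univ.mp this

lemma hasDerivWithinAt_dv (hf : DifferentiableOn ℝ (fun p : ℝ × ℝ => f p.1 p.2) (univ ×ˢ J))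
    (z : ℝ) {v : ℝ} (hv : v ∈ J) : HasDerivWithinAt (f z)
      (fderivWithin ℝ (fun p : ℝ × ℝ => f p.1 p.2) (univ ×ˢ J) (z, v) (0, 1)) J v := by
  have h1 : HasDerivWithinAt (fun v : ℝ => (z, v)) ((0 : ℝ), (1 : ℝ)) J v :=
    (hasDerivWithinAt_const v J z).prodMk (hasDerivWithinAt_id v J)
  exact (hf (z, v) ⟨mem_univ _, hv⟩).hasFDerivWithinAt.comp_hasDerivWithinAt_of_eq v h1
    (fun _ hw => ⟨mem_univ _, hw⟩) rfl

/-- J stands both for the closed interval, where solutions are C¹, and for the open one, where they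
are C². The condition on neighbourhood filters holds for both and lets derivatives within the closed
interval, as in `dv`, be computed within J. -/
lemma uniqueDiffOn_of_nhdsWithin_eq (hu : u 0 < u 1) (hJs : J ⊆ Icc (u 0) (u 1))
    (hJ : ∀ v ∈ J, nhdsWithin v J = nhdsWithin v (Icc (u 0) (u 1))) : UniqueDiffOn ℝ J :=
  fun v hv => (uniqueDiffWithinAt_congr (hJ v hv)).mpr (uniqueDiffOn_Icc hu v (hJs hv))

lemma dv_eq (hu : u 0 < u 1) (hJs : J ⊆ Icc (u 0) (u 1))
    (hJ : ∀ v ∈ J, nhdsWithin v J = nhdsWithin v (Icc (u 0) (u 1)))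
    (hf : DifferentiableOn ℝ (fun p : ℝ × ℝ => f p.1 p.2) (univ ×ˢ J)) (z : ℝ)
    {v : ℝ} (hv : v ∈ J) : dv u f z v =
      fderivWithin ℝ (fun p : ℝ × ℝ => f p.1 p.2) (univ ×ˢ J) (z, v) (0, 1) := by
  have h := (hasDerivWithinAt_dv hf z hv).mono_of_mem_nhdsWithin (s := Icc (u 0) (u 1))
    (by rw [← hJ v hv]; exact self_mem_nhdsWithin)
  exact h.derivWithin (uniqueDiffOn_Icc hu v (hJs hv))

lemma dz_eq (hf : DifferentiableOn ℝ (fun p : ℝ × ℝ => f p.1 p.2) (univ ×ˢ J)) (z : ℝ)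
    {v : ℝ} (hv : v ∈ J) : dz f z v =
      fderivWithin ℝ (fun p : ℝ × ℝ => f p.1 p.2) (univ ×ˢ J) (z, v) (1, 0) :=
  (hasDerivAt_dz hf z hv).deriv

lemma contDiffOn_dz (hJ : UniqueDiffOn ℝ J) {n : ℕ}
    (hf : ContDiffOn ℝ (n + 1) (fun p : ℝ × ℝ => f p.1 p.2) (univ ×ˢ J)) :
    ContDiffOn ℝ n (fun p : ℝ × ℝ => dz f p.1 p.2) (univ ×ˢ J) :=
  ((hf.fderivWithin (uniqueDiffOn_univ.prod hJ) le_rfl).clm_apply contDiffOn_const).congr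
    fun p hp => dz_eq (hf.differentiableOn (by simp)) p.1 hp.2

lemma contDiffOn_dv (hu : u 0 < u 1) (hJs : J ⊆ Icc (u 0) (u 1))
    (hJ : ∀ v ∈ J, nhdsWithin v J = nhdsWithin v (Icc (u 0) (u 1))) {n : ℕ}
    (hf : ContDiffOn ℝ (n + 1) (fun p : ℝ × ℝ => f p.1 p.2) (univ ×ˢ J)) :
    ContDiffOn ℝ n (fun p : ℝ × ℝ => dv u f p.1 p.2) (univ ×ˢ J) :=
  ((hf.fderivWithin (uniqueDiffOn_univ.prod (uniqueDiffOn_of_nhdsWithin_eq hu hJs hJ))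
    le_rfl).clm_apply contDiffOn_const).congr
    fun p hp => dv_eq hu hJs hJ (hf.differentiableOn (by simp)) p.1 hp.2

lemma contDiffOn_shearDeriv (hu : u 0 < u 1) (hJs : J ⊆ Icc (u 0) (u 1))
    (hJ : ∀ v ∈ J, nhdsWithin v J = nhdsWithin v (Icc (u 0) (u 1))) {n : ℕ}
    (hf : ContDiffOn ℝ (n + 1) (fun p : ℝ × ℝ => f p.1 p.2) (univ ×ˢ J)) (t : ℝ) :
    ContDiffOn ℝ n (fun p : ℝ × ℝ => shearDeriv u t f p.1 p.2) (univ ×ˢ J) :=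
  (contDiffOn_dv hu hJs hJ hf).sub (contDiffOn_const.mul
    (contDiffOn_dz (uniqueDiffOn_of_nhdsWithin_eq hu hJs hJ) hf))

lemma nhdsWithin_Ioo_eq {α β : ℝ} : ∀ v ∈ Ioo α β, nhdsWithin v (Ioo α β) =
    nhdsWithin v (Icc α β) := fun v hv => by
  rw [isOpen_Ioo.nhdsWithin_eq hv, nhdsWithin_eq_nhds.mpr (Icc_mem_nhds hv.1 hv.2)]

lemma periodic_dz {v c : ℝ} (hf : Function.Periodic (fun z => f z v) c) :
    Function.Periodic (fun z => dz f z v) c := fun z => by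
  have h : (fun z₁ => f (z₁ + c) v) = fun z₁ => f z₁ v := funext hf
  simp only [dz]
  rw [← deriv_comp_add_const (fun z₁ => f z₁ v), h]

lemma periodic_dv {c : ℝ} (hf : ∀ v ∈ Icc (u 0) (u 1), Function.Periodic (fun z => f z v) c)
    {v : ℝ} (hv : v ∈ Icc (u 0) (u 1)) : Function.Periodic (fun z => dv u f z v) c :=
  fun z => derivWithin_congr (fun w hw => hf w hw z) (hf v hv z)

lemma periodic_shearDeriv {c : ℝ} (t : ℝ)
    (hf : ∀ v ∈ Icc (u 0) (u 1), Function.Periodic (fun z => f z v) c)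
    {v : ℝ} (hv : v ∈ Icc (u 0) (u 1)) : Function.Periodic (fun z => shearDeriv u t f z v) c :=
  fun z => by
    have h1 := periodic_dv hf hv z
    have h2 := periodic_dz (hf v hv) z
    simp only [shearDeriv] at h1 h2 ⊢
    rw [h1, h2]

end PartialDerivatives

/-- The shear derivative becomes an ordinary derivative on the Fourier side. -/
lemma hasDerivAt_cexp_mul_fourierZ {u : ℝ → ℝ} (hu : u 0 < u 1) {G : ℝ → ℝ → ℂ}
    (hG : ContDiffOn ℝ 1 (fun p : ℝ × ℝ => G p.1 p.2) (univ ×ˢ Ioo (u 0) (u 1)))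
    (hper : ∀ v ∈ Ioo (u 0) (u 1), Function.Periodic (fun z => G z v) (2 * Real.pi)) (t : ℝ) (k : ℤ)
    {v : ℝ} (hv : v ∈ Ioo (u 0) (u 1)) :
    HasDerivAt (fun v : ℝ => Complex.exp (-(Complex.I * ((k * t : ℝ) : ℂ) * v)) * fourierZ G k v)
      (Complex.exp (-(Complex.I * ((k * t : ℝ) : ℂ) * v)) * fourierZ (shearDeriv u t G) k v) v := by
  have hG' : ContDiffOn ℝ ((0 : ℕ) + 1) (fun p : ℝ × ℝ => G p.1 p.2)
      (univ ×ˢ Ioo (u 0) (u 1)) := by simpa using hG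
  have hdiff := hG.differentiableOn (by simp)
  have hdv := (contDiffOn_dv hu Ioo_subset_Icc_self nhdsWithin_Ioo_eq hG').continuousOn
  have hdz := (contDiffOn_dz isOpen_Ioo.uniqueDiffOn hG').continuousOn
  have h1 := hasDerivAt_fourierZ hG.continuousOn hdv (fun z w hw => by
    have := (hasDerivWithinAt_dv hdiff z hw).hasDerivAt (isOpen_Ioo.mem_nhds hw)
    rwa [← dv_eq hu Ioo_subset_Icc_self nhdsWithin_Ioo_eq hdiff z hw] at this) k hv
  have h2 := fourierZ_of_hasDerivAt (f' := dz G) (hper v hv) (fun z => by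
    have := hasDerivAt_dz hdiff z hv
    rwa [← dz_eq hdiff z hv] at this) (continuous_slice hdz hv) k
  have h3 := fourierZ_add (continuous_slice hdv hv) (continuous_slice hdz hv) 1 (-(t : ℂ)) k
  have h4 : fourierZ (shearDeriv u t G) k v =
      fourierZ (fun z v => 1 * dv u G z v + -(t : ℂ) * dz G z v) k v := by
    simp only [fourierZ, shearDeriv, one_mul, neg_mul, sub_eq_add_neg]
  have he := ((Complex.ofRealCLM.hasDerivAt (x := v)).const_mul
    (Complex.I * ((k * t : ℝ) : ℂ))).neg.cexp
  simp only [Complex.ofRealCLM_apply, Complex.ofReal_one, mul_one] at he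
  refine (he.mul h1).congr_deriv ?_
  rw [h4, h3, h2]
  push_cast
  simp only [Pi.neg_apply]
  ring

lemma fourierZ_const_mul (c : ℝ → ℂ) (f : ℝ → ℝ → ℂ) (k : ℤ) (v : ℝ) :
    fourierZ (fun z v => c v * f z v) k v = c v * fourierZ f k v := by
  simp only [fourierZ, mul_assoc, intervalIntegral.integral_const_mul]
  ring

lemma Background.contDiffOn_tilde {u θ : ℝ → ℝ} {κ₀ K s₀ : ℝ} (h : Background u θ κ₀ K s₀)
    {φ : ℝ → ℝ} (hφ : ContDiffOn ℝ ∞ φ (Icc 0 1)) :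
    ContDiffOn ℝ ∞ (tilde u φ) (Ioo (u 0) (u 1)) := by
  have hin : ∀ {f : ℝ → ℝ}, ContDiffOn ℝ ∞ f (Icc 0 1) → ∀ y ∈ Ioo (0 : ℝ) 1, ContDiffAt ℝ ∞ f y :=
    fun hf y hy => hf.contDiffAt (Icc_mem_nhds hy.1 hy.2)
  refine fun v hv => ContDiffAt.contDiffWithinAt ?_
  exact (hin hφ _ (h.inv_mem_Ioo hv)).comp v
    (contDiffAt_comp_of_deriv (S := Ioo 0 1) isOpen_Ioo (fun v hv => h.inv_mem_Ioo hv)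
      (g := fun y => (derivWithin u (Icc 0 1) y)⁻¹) (fun v hv => h.hasDerivAt_inv hv)
      (fun y hy => (hin h.contDiffOn_derivWithin y hy).inv
        (h.derivWithin_pos (Ioo_subset_Icc_self hy)).ne') v hv)

/-- The `k`-th Fourier mode of a solution of the Neumann problem solves the factorized system. -/
theorem IsNeumannSolution.exists_isFactorPair {u θ : ℝ → ℝ} {κ₀ K s₀ : ℝ}
    (hbg : Background u θ κ₀ K s₀) {t : ℝ} {F P : ℝ → ℝ → ℂ} (hP : IsNeumannSolution u θ t F P)
    {p ρ b X₁ X₂ : ℝ → ℝ} (hc : ∀ v ∈ Icc (u 0) (u 1),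
      p v = tilde u θ v * (tildeDeriv u v)⁻¹ ∧ ρ v = (tilde u θ v)⁻¹ * (tildeDeriv u v)⁻¹ ∧
      b v = (tildeDeriv u v)⁻¹) {k : ℤ} (hk : k ≠ 0)
    (hX : RiccatiPair (u 0) (u 1) |(k : ℝ)| p ρ X₁ X₂) : ∃ N₁ N₂ : ℝ → ℂ,
    IsFactorPair (u 0) (u 1) |(k : ℝ)| ρ X₁ X₂ (fun v => b v *
      (Complex.exp (-(Complex.I * ((k * t : ℝ) : ℂ) * v)) * fourierZ F k v)) N₁ N₂ ∧
    ∀ v ∈ Icc (u 0) (u 1), Complex.exp (-(Complex.I * ((k * t : ℝ) : ℂ) * v)) * fourierZ P k v =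
      (N₂ v - N₁ v) / ((|(k : ℝ)| * (X₁ v + X₂ v) : ℝ) : ℂ) := by
  have hu := hbg.u_zero_lt_u_one
  set κ : ℝ := |(k : ℝ)| with hκ
  have hκ0 : 0 < κ := by rw [hκ, abs_pos]; exact_mod_cast hk
  have hκ2 : ((κ : ℂ)) ^ 2 = (k : ℂ) ^ 2 := by
    rw [hκ]; exact_mod_cast congrArg (fun x : ℝ => (x : ℂ)) (sq_abs (k : ℝ))
  have hT : ∀ v ∈ Icc (u 0) (u 1), tilde u θ v ≠ 0 := fun v hv =>
    (hbg.theta_pos (hbg.inv_mem hv)).ne'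
  have hU : ∀ v ∈ Icc (u 0) (u 1), tildeDeriv u v ≠ 0 := fun v hv =>
    (hbg.derivWithin_pos (hbg.inv_mem hv)).ne'
  set D : ℝ → ℝ → ℂ := shearDeriv u t P with hD
  set W : ℝ → ℝ → ℂ := fun z₁ v₁ => (tilde u θ v₁ : ℂ) * (tildeDeriv u v₁ : ℂ) * D z₁ v₁ with hW
  set e : ℝ → ℂ := fun v => Complex.exp (-(Complex.I * ((k * t : ℝ) : ℂ) * v)) with he
  have hec : Continuous e := by simp only [he]; fun_prop
  have hP1 : ContDiffOn ℝ ((0 : ℕ) + 1) (fun p : ℝ × ℝ => P p.1 p.2)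
      (univ ×ˢ Icc (u 0) (u 1)) := by simpa using hP.contDiff_closed
  have hP2 : ContDiffOn ℝ ((1 : ℕ) + 1) (fun p : ℝ × ℝ => P p.1 p.2)
      (univ ×ˢ Ioo (u 0) (u 1)) := by
    simpa [show ((1 : WithTop ℕ∞) + 1) = 2 by norm_num] using hP.contDiff_open
  have hDc : ContinuousOn (fun p : ℝ × ℝ => D p.1 p.2) (univ ×ˢ Icc (u 0) (u 1)) :=
    (contDiffOn_shearDeriv hu subset_rfl (fun _ _ => rfl) hP1 t).continuousOn
  have hDo : ContDiffOn ℝ (1 : ℕ) (fun p : ℝ × ℝ => D p.1 p.2) (univ ×ˢ Ioo (u 0) (u 1)) :=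
    contDiffOn_shearDeriv hu Ioo_subset_Icc_self nhdsWithin_Ioo_eq hP2 t
  have hcast : ∀ {f : ℝ → ℝ}, ContDiffOn ℝ ∞ f (Ioo (u 0) (u 1)) →
      ContDiffOn ℝ (1 : ℕ) (fun p : ℝ × ℝ => (f p.2 : ℂ)) (univ ×ˢ Ioo (u 0) (u 1)) :=
    fun hf => Complex.ofRealCLM.contDiff.comp_contDiffOn
      ((hf.of_le (by exact_mod_cast le_top)).comp contDiff_snd.contDiffOn fun p hp => hp.2)
  have hW1 : ContDiffOn ℝ (1 : ℕ) (fun p : ℝ × ℝ => W p.1 p.2) (univ ×ˢ Ioo (u 0) (u 1)) :=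
    ((hcast (hbg.contDiffOn_tilde hbg.smooth_θ)).mul
      (hcast (hbg.contDiffOn_tilde hbg.contDiffOn_derivWithin))).mul hDo
  have hWo : ContDiffOn ℝ ((0 : ℕ) + 1) (fun p : ℝ × ℝ => W p.1 p.2)
      (univ ×ˢ Ioo (u 0) (u 1)) := by simpa using hW1
  have hDper : ∀ v ∈ Icc (u 0) (u 1), Function.Periodic (fun z => D z v) (2 * Real.pi) :=
    fun v hv => periodic_shearDeriv t hP.periodic hv
  have hWper : ∀ v ∈ Ioo (u 0) (u 1), Function.Periodic (fun z => W z v) (2 * Real.pi) :=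
    fun v hv z => by
      have := hDper v (Ioo_subset_Icc_self hv) z
      simp only [hW] at this ⊢
      rw [this]
  -- q is the conjugated mode and Y its flux. C¹ regularity on the closed strip makes Y continuous
  -- up to the boundary, where the Neumann conditions make it vanish.
  set q : ℝ → ℂ := fun v => e v * fourierZ P k v with hq
  set Y : ℝ → ℂ := fun v => ((tilde u θ v : ℂ) * (tildeDeriv u v : ℂ)) * (e v * fourierZ D k v)
    with hY
  have hqc : ContinuousOn q (Icc (u 0) (u 1)) :=
    hec.continuousOn.mul (continuousOn_fourierZ hu.le hP1.continuousOn k)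
  have hYc : ContinuousOn Y (Icc (u 0) (u 1)) :=
    ((Complex.continuous_ofReal.comp_continuousOn
      (hbg.continuousOn_tilde hbg.smooth_θ.continuousOn)).mul
      (Complex.continuous_ofReal.comp_continuousOn
        (hbg.continuousOn_tilde hbg.contDiffOn_derivWithin.continuousOn))).mul
      (hec.continuousOn.mul (continuousOn_fourierZ hu.le hDc k))
  have hqd : ∀ v ∈ Ioo (u 0) (u 1), HasDerivAt q ((ρ v : ℂ) * Y v) v := fun v hv => by
    have h1 := hasDerivAt_cexp_mul_fourierZ hu (hP2.of_le (by norm_num))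
      (fun v hv => hP.periodic v (Ioo_subset_Icc_self hv)) t k hv
    refine h1.congr_deriv ?_
    have hv' := Ioo_subset_Icc_self hv
    have h2 : (tilde u θ v : ℂ) ≠ 0 := by exact_mod_cast hT v hv'
    have h3 : (tildeDeriv u v : ℂ) ≠ 0 := by exact_mod_cast hU v hv'
    rw [(hc v hv').2.1]
    simp only [hY, he, hD]
    push_cast
    field_simp
  have hYd : ∀ v ∈ Ioo (u 0) (u 1), HasDerivAt Y ((κ : ℂ) ^ 2 * p v * q v +
      b v * (e v * fourierZ F k v)) v := fun v hv => by
    have h1 := hasDerivAt_cexp_mul_fourierZ hu (G := W) (by simpa using hWo) hWper t k hv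
    have hYW : Y = fun v => e v * fourierZ W k v := by
      ext w
      simp only [hY, hW]
      rw [fourierZ_const_mul (fun v => (tilde u θ v : ℂ) * (tildeDeriv u v : ℂ))]
      ring
    rw [hYW]
    refine h1.congr_deriv ?_
    have hv' := Ioo_subset_Icc_self hv
    have h2 : (tilde u θ v : ℂ) ≠ 0 := by exact_mod_cast hT v hv'
    have h3 : (tildeDeriv u v : ℂ) ≠ 0 := by exact_mod_cast hU v hv'
    have hz1 := contDiffOn_dz isOpen_Ioo.uniqueDiffOn hP2
    have hz2 := contDiffOn_dz (n := 0) isOpen_Ioo.uniqueDiffOn (by simpa using hz1)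
    have hdP := hP2.differentiableOn (by simp)
    have hdz := hz1.differentiableOn (by simp)
    have hF : fourierZ F k v = (tilde u θ v : ℂ) * fourierZ (dz (dz P)) k v +
        (tildeDeriv u v : ℂ) * fourierZ (shearDeriv u t W) k v := by
      rw [← fourierZ_add (continuous_slice hz2.continuousOn hv)
        (continuous_slice (contDiffOn_shearDeriv hu Ioo_subset_Icc_self nhdsWithin_Ioo_eq hWo
          t).continuousOn hv)]
      simp only [fourierZ]
      congr 2
      ext z
      rw [← hP.equation z v hv]
      rfl
    have hzz : fourierZ (dz (dz P)) k v = Complex.I * k * (Complex.I * k * fourierZ P k v) := by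
      rw [← fourierZ_of_hasDerivAt (f' := dz P) (hP.periodic v hv') (fun z => by
        have := hasDerivAt_dz hdP z hv
        rwa [← dz_eq hdP z hv] at this) (continuous_slice hz1.continuousOn hv)]
      exact fourierZ_of_hasDerivAt (periodic_dz (hP.periodic v hv')) (fun z => by
        have := hasDerivAt_dz hdz z hv
        rwa [← dz_eq hdz z hv] at this) (continuous_slice hz2.continuousOn hv) k
    rw [hF, hzz, (hc v hv').1, (hc v hv').2.2, hκ2]
    simp only [hq, he]
    push_cast
    field_simp
    ring_nf
    simp only [Complex.I_sq]
    ring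
  have hY0 : ∀ v, (∀ z, D z v = 0) → Y v = 0 := fun v hv => by simp [hY, fourierZ, hv]
  have hofR : ∀ {f : ℝ → ℝ} {f' v : ℝ}, HasDerivAt f f' v →
      HasDerivAt (fun v => ((κ : ℂ)) * (f v : ℂ)) (κ * f') v := fun h =>
    h.ofReal_comp.const_mul _
  have hcR : ∀ {f : ℝ → ℝ}, Continuous f → ContinuousOn (fun v => (κ : ℂ) * (f v : ℂ))
      (Icc (u 0) (u 1)) := fun hf => by fun_prop
  -- In the derivative of Y - κX₁q the Riccati equation removes κ²pq and leaves -κρX₁(Y - κX₁q) plus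
  -- the source; the second factor is analogous with the opposite sign.
  refine ⟨fun v => Y v - (κ : ℂ) * X₁ v * q v, fun v => Y v + (κ : ℂ) * X₂ v * q v,
    ⟨hYc.sub ((hcR hX.cont₁).mul hqc), hYc.add ((hcR hX.cont₂).mul hqc), ?_, ?_,
      fun v hv => ?_, fun v hv => ?_⟩, fun v hv => ?_⟩
  · simp [hX.left, hY0 _ hP.boundary_left]
  · simp [hX.right, hY0 _ hP.boundary_right]
  · refine ((hYd v hv).sub ((hofR (hX.deriv₁ v hv)).mul (hqd v hv))).congr_deriv ?_
    simp only [he]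
    push_cast
    ring
  · refine ((hYd v hv).add ((hofR (hX.deriv₂ v hv)).mul (hqd v hv))).congr_deriv ?_
    simp only [he]
    push_cast
    ring
  · have h1 : (κ : ℂ) ≠ 0 := by exact_mod_cast hκ0.ne'
    have h2 : ((X₁ v + X₂ v : ℝ) : ℂ) ≠ 0 := by exact_mod_cast (hX.pos v hv).ne'
    have h3 : ((κ * (X₁ v + X₂ v) : ℝ) : ℂ) ≠ 0 := by
      rw [Complex.ofReal_mul]; exact mul_ne_zero h1 h2
    rw [eq_div_iff h3]
    simp only [hq, he]
    push_cast
    ring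

/-! ### Gevrey cut-off functions -/

lemma IsGevreyCutoff.exists_gevreyOn {s α β : ℝ} {Υ : ℝ → ℝ} (h : IsGevreyCutoff s α β Υ) :
    ∃ L M : ℝ, 0 ≤ L ∧ 0 ≤ M ∧ GevreyOn s univ L M Υ := by
  obtain ⟨L, M, hb⟩ := h.gevrey
  refine ⟨|L|, |M|, abs_nonneg _, abs_nonneg _, fun v _ => h.smooth.contDiffAt, fun m v _ => ?_⟩
  refine (hb m v).trans (mul_le_mul_of_nonneg_right ?_ (gevreyWeight_pos s m).le)
  rw [← abs_pow, ← abs_mul]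
  exact le_abs_self _

lemma GevreyOn.comp_affine {s A M N c : ℝ} (hs : 0 < s) (hs1 : s ≤ 1) (hA : 0 ≤ A) (hM : 0 ≤ M)
    (hN : 0 ≤ N) {f : ℝ → ℝ} (hf : GevreyOn s univ A M f) :
    GevreyOn s univ A (8 * N * M) (fun x => f (N * x + c)) := by
  refine GevreyOn.comp_of_deriv (y := fun x => N * x + c) (g := fun _ => N) hs hs1 hN hA hM
    isOpen_univ (fun v _ => mem_univ _) (fun v _ => ?_) ⟨fun _ _ => contDiffAt_const, fun m v _ => ?_⟩ hf
  · simpa using ((hasDerivAt_id v).const_mul N).add_const c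
  · rw [iteratedDeriv_const]
    have := gevreyWeight_pos s m
    split_ifs with h
    · subst h; simp [gevreyWeight_zero, abs_of_nonneg hN]
    · simp only [norm_zero]; positivity

/-- Integration lowers the order of differentiation by one and only changes constants; order zero is
supplied by the bound B. -/
lemma GevreyOn.of_deriv {s A M B : ℝ} (hs : 0 < s) (hs1 : s ≤ 1) (hA : 0 ≤ A) (hM : 0 ≤ M)
    (hB : 0 ≤ B) {f g : ℝ → ℝ} (hf : ∀ x, |f x| ≤ B) (hd : ∀ x, HasDerivAt f (g x) x)
    (hg : GevreyOn s univ A M g) : GevreyOn s univ (4 * A + B) (M + 1) f := by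
  have hd' : deriv f = g := funext fun x => (hd x).deriv
  have hsm : ContDiff ℝ ∞ f := contDiff_infty_iff_deriv.mpr ⟨fun x => (hd x).differentiableAt,
    contDiff_iff_contDiffAt.mpr fun x => by rw [hd']; exact hg.smooth x (mem_univ x)⟩
  refine ⟨fun v _ => hsm.contDiffAt, fun m v _ => ?_⟩
  rcases m with _ | m
  · simpa [gevreyWeight_zero] using (hf v).trans (by linarith)
  · rw [iteratedDeriv_succ', hd']
    have h1 := hg.bound m v (mem_univ v)
    have h2 := gevreyWeight_le_succ hs hs1 m
    have h3 := gevreyWeight_pos s m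
    have h4 := gevreyWeight_pos s (m + 1)
    have h5 : M ^ m ≤ (M + 1) ^ (m + 1) :=
      (pow_le_pow_left₀ hM (by linarith) m).trans
        (pow_le_pow_right₀ (by linarith) (Nat.le_succ m))
    calc _ ≤ A * M ^ m * gevreyWeight s m := h1
      _ ≤ A * (M + 1) ^ (m + 1) * (4 * gevreyWeight s (m + 1)) := by gcongr
      _ ≤ _ := by
        have : 0 ≤ B * (M + 1) ^ (m + 1) * gevreyWeight s (m + 1) := by positivity
        linarith

/-- A Gevrey bump function can be rescaled and integrated to a Gevrey cut-off function which
equals one on a given interval. -/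
theorem IsGevreyCutoff.exists_eq_one {s α β α' β' a b : ℝ} (hs : 0 < s) (hs1 : s ≤ 1)
    {Υ : ℝ → ℝ} (h : IsGevreyCutoff s α' β' Υ) {x₀ : ℝ} (hx₀ : Υ x₀ ≠ 0) (hαa : α < a)
    (hab : a ≤ b) (hbβ : b < β) :
    ∃ χ : ℝ → ℝ, IsGevreyCutoff s α β χ ∧ ∀ v ∈ Icc a b, χ v = 1 := by
  obtain ⟨L, M, hL, hM, hΥ⟩ := h.exists_gevreyOn
  set R : ℝ := |α'| + |β'| + 1 with hR
  have hR0 : 0 < R := by positivity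
  have hsupp : ∀ x, Υ x ≠ 0 → |x| ≤ R := fun x hx => by
    have hx' := h.supp (subset_tsupport _ hx)
    rw [abs_le]
    constructor <;> linarith [hx'.1, hx'.2, neg_abs_le α', le_abs_self β', abs_nonneg α',
      abs_nonneg β']
  obtain ⟨ε, hε, hεα, hεβ⟩ : ∃ ε : ℝ, 0 < ε ∧ α < a - 2 * ε ∧ b + 2 * ε < β :=
    ⟨min (a - α) (β - b) / 4, by have := lt_min (sub_pos.mpr hαa) (sub_pos.mpr hbβ); positivity,
      by linarith [min_le_left (a - α) (β - b)], by linarith [min_le_right (a - α) (β - b)]⟩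
  set N := R / ε with hN
  have hN0 : 0 < N := by positivity
  -- The square is nonnegative, so its primitive is monotone with positive total increase; the
  -- scaling N = R/ε confines its support to [-ε, ε].
  set ψ : ℝ → ℝ := fun x => Υ (N * x) * Υ (N * x) with hψ
  have hψ0 : ∀ x, ε < |x| → ψ x = 0 := fun x hx => by
    have : Υ (N * x) = 0 := by
      by_contra hne
      have := hsupp _ hne
      rw [abs_mul, abs_of_pos hN0, hN, div_mul_eq_mul_div, div_le_iff₀ hε] at this
      nlinarith
    simp [hψ, this]
  have hψnn : ∀ x, 0 ≤ ψ x := fun x => mul_self_nonneg _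
  have hΥN : ∀ c, GevreyOn s univ L (8 * N * M) (fun x => Υ (N * x + c)) := fun c =>
    hΥ.comp_affine hs hs1 hL hM hN0.le
  have hMN : 0 ≤ 8 * N * M := by positivity
  have hψg : ∀ c, GevreyOn s univ (8 * L * L) (8 * N * M) (fun x => ψ (x + c)) := fun c => by
    simpa only [hψ, mul_add] using (hΥN (N * c)).mul hs hs1 hL hL hMN (hΥN (N * c))
  have hψc : Continuous ψ := by
    have := h.smooth.continuous
    fun_prop
  set Φ : ℝ → ℝ := fun x => ∫ y in (0 : ℝ)..x, ψ y with hΦ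
  have hΦd : ∀ x, HasDerivAt Φ (ψ x) x := fun x =>
    intervalIntegral.integral_hasDerivAt_right (hψc.intervalIntegrable _ _)
      (hψc.stronglyMeasurableAtFilter _ _) hψc.continuousAt
  have hsub : ∀ x y, Φ y - Φ x = ∫ z in x..y, ψ z := fun x y =>
    intervalIntegral.integral_interval_sub_left (hψc.intervalIntegrable _ _)
      (hψc.intervalIntegrable _ _)
  have hright : ∀ x, ε ≤ x → Φ x = Φ ε := fun x hx => by
    rw [← sub_eq_zero, hsub, intervalIntegral.integral_of_le hx]
    exact setIntegral_eq_zero_of_forall_eq_zero fun z hz =>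
      hψ0 z (hz.1.trans_le (le_abs_self z))
  have hleft : ∀ x, x ≤ -ε → Φ x = Φ (-ε) := fun x hx => by
    rw [eq_comm, ← sub_eq_zero, hsub, intervalIntegral.integral_of_le hx,
      integral_Ioc_eq_integral_Ioo]
    exact setIntegral_eq_zero_of_forall_eq_zero fun z hz =>
      hψ0 z (by linarith [hz.2, neg_abs_le z])
  have hmono : Monotone Φ := monotone_of_deriv_nonneg (fun x => (hΦd x).differentiableAt)
    fun x => by rw [(hΦd x).deriv]; exact hψnn x
  have hI : 0 < Φ ε - Φ (-ε) := by
    rw [hsub]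
    refine intervalIntegral.integral_pos (by linarith) hψc.continuousOn (fun x _ => hψnn x)
      ⟨x₀ / N, ?_, ?_⟩
    · have := hsupp x₀ hx₀
      rw [mem_Icc, ← abs_le, abs_div, abs_of_pos hN0, div_le_iff₀ hN0, hN,
        mul_div_cancel₀ _ hε.ne']
      exact this
    · simp only [hψ]
      rw [mul_div_cancel₀ _ hN0.ne']
      exact mul_self_pos.mpr hx₀
  set I := Φ ε - Φ (-ε) with hIdef
  have hrange : ∀ x, Φ x ∈ Icc (Φ (-ε)) (Φ ε) := fun x => by
    constructor
    · rcases le_total x (-ε) with hx | hx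
      · exact (hleft x hx).ge
      · exact hmono hx
    · rcases le_total x ε with hx | hx
      · exact hmono hx
      · exact (hright x hx).le
  -- A difference of two translated steps: on [a, b] the first has reached Φ(ε) while the second is
  -- still at Φ(-ε), and outside [a - 2ε, b + 2ε] they agree.
  set χ : ℝ → ℝ := fun x => I⁻¹ * (Φ (x + (ε - a)) - Φ (x + (-ε - b))) with hχ
  have hχd : ∀ x, HasDerivAt χ (I⁻¹ * (ψ (x + (ε - a)) - ψ (x + (-ε - b)))) x := fun x =>
    ((hΦd _).comp_add_const x _ |>.sub ((hΦd _).comp_add_const x _)).const_mul _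
  have hχb : ∀ x, |χ x| ≤ 1 := fun x => by
    have h1 := hrange (x + (ε - a))
    have h2 := hrange (x + (-ε - b))
    rw [hχ, abs_mul, abs_of_pos (inv_pos.mpr hI), inv_mul_le_iff₀ hI, abs_le]
    constructor <;> linarith [h1.1, h1.2, h2.1, h2.2]
  have hg := GevreyOn.of_deriv hs hs1 (by positivity) hMN zero_le_one hχb hχd
    (((hψg (ε - a)).sub (hψg (-ε - b))).const_mul I⁻¹)
  have hχ0 : ∀ x, x ∉ Icc (a - 2 * ε) (b + 2 * ε) → χ x = 0 := fun x hx => by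
    rw [mem_Icc, not_and_or, not_le, not_le] at hx
    rcases hx with hx | hx
    · simp only [hχ]
      rw [hleft (x + (ε - a)) (by linarith), hleft (x + (-ε - b)) (by linarith), sub_self, mul_zero]
    · simp only [hχ]
      rw [hright (x + (ε - a)) (by linarith), hright (x + (-ε - b)) (by linarith), sub_self,
        mul_zero]
  refine ⟨χ, ⟨contDiff_iff_contDiffAt.mpr fun x => hg.smooth x (mem_univ x),
    ⟨_, _, fun m v => hg.bound m v (mem_univ v)⟩, ?_⟩, fun v hv => ?_⟩
  · refine (closure_minimal (fun x hx => ?_) isClosed_Icc :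
      tsupport χ ⊆ Icc (a - 2 * ε) (b + 2 * ε)).trans
      fun x hx => ⟨hεα.trans_le hx.1, hx.2.trans_lt hεβ⟩
    by_contra hne
    exact hx (hχ0 x hne)
  · simp only [hχ]
    rw [hright (v + (ε - a)) (by linarith [hv.1]), hleft (v + (-ε - b)) (by linarith [hv.2]), ← hIdef,
      inv_mul_cancel₀ hI.ne']

lemma IsSource.continuous_fourierZ {a b : ℝ} {Ξ : ℝ → ℝ → ℂ} (h : IsSource a b Ξ) (k : ℤ) :
    Continuous (fourierZ Ξ k) :=
  continuous_const.mul (intervalIntegral.continuous_parametric_intervalIntegral_of_continuous'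
    (f := fun v z => Ξ z v * Complex.exp (-(Complex.I * (z : ℂ) * (k : ℂ))))
    ((h.continuous.comp continuous_swap).mul (by fun_prop)) 0 (2 * Real.pi))

lemma IsSource.hasCompactSupport_fourierZ {a b : ℝ} {Ξ : ℝ → ℝ → ℂ} (h : IsSource a b Ξ) (k : ℤ) :
    HasCompactSupport (fourierZ Ξ k) :=
  HasCompactSupport.intro (isCompact_Icc (a := a) (b := b)) fun v hv => by simp [fourierZ, fun z => h.supp z v hv]

/-! ### Assembly of the kernel. -/

/-- The kernel of `Υ 𝒯⁻¹ χ`, for two Gevrey cut-off functions `χ` and `Υ`. -/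
theorem Background.exists_kernel_of_cutoffs {u θ : ℝ → ℝ} {κ₀ K s₀ s : ℝ}
    (hbg : Background u θ κ₀ K s₀) (hκ₀ : 0 < κ₀) (hκ₀' : κ₀ ≤ 1 / 10) (hK : 1 < K)
    (hs : 1 / 2 < s) (hs1 : s ≤ 1) (hss₀ : s ≤ s₀) {χ Υ : ℝ → ℝ}
    (hχ : IsGevreyCutoff s (u 0) (u 1) χ) (hΥ : IsGevreyCutoff s (u 0) (u 1) Υ) :
    ∃ (C lam : ℝ) (𝒢 : ℝ → ℤ → ℝ → ℝ → ℂ), 0 < C ∧ 0 < lam ∧ KernelBound C lam s 𝒢 ∧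
      ∀ (a b t : ℝ) (Ξ F P : ℝ → ℝ → ℂ), IsSource a b Ξ →
        (∀ z, ∀ v ∈ Ioo (u 0) (u 1), F z v = (χ v : ℂ) * Ξ z v) → IsNeumannSolution u θ t F P →
        KernelRepresents 𝒢 t Ξ (fun z v => (Υ v : ℂ) * P z v) := by
  have hs0 : 0 < s := by linarith
  obtain ⟨δ, c, A, M, p, ρ, b, hR, hR', hbG, hcoeff⟩ :=
    hbg.exists_coeff hs0 hs1 hss₀ hK hκ₀ hκ₀'
  obtain ⟨L₁, M₁, hL₁, hM₁, hχG⟩ := hχ.exists_gevreyOn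
  obtain ⟨L₂, M₂, hL₂, hM₂, hΥG⟩ := hΥ.exists_gevreyOn
  have hA := hR.A_pos
  have hM := hR.M_nonneg
  have hM' : 0 ≤ M + M₁ + M₂ := by positivity
  have hh := (((hbG.mono hA.le hM le_rfl (by linarith : M ≤ M + M₁ + M₂)).mul hs0 hs1 hA.le hL₁ hM'
    ((hχG.mono_set (subset_univ _)).mono hL₁ hM₁ le_rfl
      (by linarith : M₁ ≤ M + M₁ + M₂))).mono (by positivity) hM'
      (by linarith : 8 * A * L₁ ≤ 8 * A * L₁ + L₂) le_rfl).ofReal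
  have hΥ' := ((hΥG.mono_set (subset_univ (Ioo (u 0) (u 1)))).mono hL₂ hM₂
    (by linarith [show 0 ≤ 8 * A * L₁ by positivity] : L₂ ≤ 8 * A * L₁ + L₂)
    (by linarith : M₂ ≤ M + M₁ + M₂)).ofReal
  have hts : ∀ {f g : ℝ → ℝ}, tsupport g ⊆ Ioo (u 0) (u 1) →
      tsupport (fun v => ((f v * g v : ℝ) : ℂ)) ⊆ Ioo (u 0) (u 1) := fun {f g} hg =>
    (closure_mono fun v hv => by
      simp only [Function.mem_support, ne_eq, Complex.ofReal_eq_zero, mul_eq_zero, not_or] at hv ⊢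
      exact hv.2).trans hg
  have hΥs : tsupport (fun v => (Υ v : ℂ)) ⊆ Ioo (u 0) (u 1) := by
    simpa using hts (f := fun _ => 1) hΥ.supp
  -- The source cut-off enters through h = bχ, with b = 1/ũ' from the rescaled equation.
  obtain ⟨C, lam, 𝒦, X₁, X₂, hC, hlam, hX, hbd, hrep⟩ := exists_kernel hs hs1 hR hR'
    (by positivity) hM' hh (hts hχ.supp) hΥ' hΥs
  have hk1 : ∀ k : ℤ, k ≠ 0 → 1 ≤ |(k : ℝ)| := fun k hk => by
    exact_mod_cast Int.one_le_abs hk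
  -- Time only translates both frequencies by kt, so the constants do not depend on it.
  refine ⟨C, lam, fun t k ξ η => 𝒦 |(k : ℝ)| (ξ - k * t) (η - k * t), hC, hlam, ?_, ?_⟩
  · intro t k ξ η hk
    simpa [sq_abs] using hbd |(k : ℝ)| (ξ - k * t) (η - k * t) (hk1 k hk)
  · intro a b' t Ξ F P hΞ hF hP k ξ hk
    obtain ⟨N₁, N₂, hN, hq⟩ := hP.exists_isFactorPair hbg hcoeff hk (hX _ (hk1 k hk))
    have hN' : IsFactorPair (u 0) (u 1) |(k : ℝ)| ρ (X₁ |(k : ℝ)|) (X₂ |(k : ℝ)|)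
        (fun v => ((b v * χ v : ℝ) : ℂ) * Complex.exp (-(Complex.I * ((k * t : ℝ) : ℂ) * v)) *
          fourierZ Ξ k v) N₁ N₂ := by
      have e : ∀ v ∈ Ioo (u 0) (u 1), (b v : ℂ) *
          (Complex.exp (-(Complex.I * ((k * t : ℝ) : ℂ) * v)) * fourierZ F k v) =
          ((b v * χ v : ℝ) : ℂ) * Complex.exp (-(Complex.I * ((k * t : ℝ) : ℂ) * v)) *
          fourierZ Ξ k v := fun v hv => by
        have : fourierZ F k v = (χ v : ℂ) * fourierZ Ξ k v := by
          rw [← fourierZ_const_mul (fun v => (χ v : ℂ))]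
          simp only [fourierZ, hF _ v hv]
        rw [this, Complex.ofReal_mul (b v)]
        ring
      exact ⟨hN.cont₁, hN.cont₂, hN.left, hN.right,
        fun v hv => (hN.deriv₁ v hv).congr_deriv (by rw [e v hv]),
        fun v hv => (hN.deriv₂ v hv).congr_deriv (by rw [e v hv])⟩
    obtain ⟨hi, he⟩ := hrep _ (hk1 k hk) _ _ N₁ N₂ (hΞ.continuous_fourierZ k)
      (hΞ.hasCompactSupport_fourierZ k) hN' ξ
    refine ⟨hi, Eq.trans ?_ he⟩
    unfold fourier
    congr 1
    ext v
    rw [fourierZ_const_mul (fun v => (Υ v : ℂ))]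
    by_cases hv : v ∈ Ioo (u 0) (u 1)
    · rw [← hq v (Ioo_subset_Icc_self hv)]
      have : Complex.exp (-(Complex.I * (v : ℂ) * (ξ : ℂ))) =
          Complex.exp (-(Complex.I * ((k * t : ℝ) : ℂ) * v)) *
          Complex.exp (-(Complex.I * v * ((ξ - k * t : ℝ) : ℂ))) := by
        rw [← Complex.exp_add]
        congr 1
        push_cast
        ring
      rw [this]
      ring
    · have : Υ v = 0 := by
        by_contra hne
        exact hv (hΥ.supp (subset_tsupport _ hne))
      simp [this]

end PressureKernel

theorem propositionC
    (u θ : ℝ → ℝ) (κ₀ K s₀ s : ℝ)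
    (hκ₀ : 0 < κ₀) (hκ₀' : κ₀ ≤ 1 / 10) (hK : 1 < K)
    (hs : 1 / 2 < s) (hss₀ : s ≤ s₀) (hs₀ : s₀ < 1)
    (hbg : PressureKernel.Background u θ κ₀ K s₀)
    (Υ : ℝ → ℝ) (hΥ : PressureKernel.IsGevreyCutoff s (u 0) (u 1) Υ) :
    -- the source is multiplied by the cut-off: the kernel does not depend on the source
    (∃ (C lam : ℝ) (𝒢 : ℝ → ℤ → ℝ → ℝ → ℂ), 0 < C ∧ 0 < lam ∧
      PressureKernel.KernelBound C lam s 𝒢 ∧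
      ∀ (a b : ℝ), u 0 < a → b < u 1 → ∀ (t : ℝ) (Ξ P : ℝ → ℝ → ℂ),
        PressureKernel.IsSource a b Ξ →
        PressureKernel.IsNeumannSolution u θ t (fun z v => Ξ z v * (Υ v : ℂ)) P →
        PressureKernel.KernelRepresents 𝒢 t Ξ (fun z v => (Υ v : ℂ) * P z v)) ∧
    -- the source is not cut off: the kernel depends on the source only through its support
    (∀ (a b : ℝ), u 0 < a → b < u 1 →
      ∃ (C lam : ℝ) (𝒢 : ℝ → ℤ → ℝ → ℝ → ℂ), 0 < C ∧ 0 < lam ∧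
        PressureKernel.KernelBound C lam s 𝒢 ∧
        ∀ (t : ℝ) (Ξ P : ℝ → ℝ → ℂ),
          PressureKernel.IsSource a b Ξ →
          PressureKernel.IsNeumannSolution u θ t Ξ P →
          PressureKernel.KernelRepresents 𝒢 t Ξ (fun z v => (Υ v : ℂ) * P z v)) := by
  have hs0 : 0 < s := by linarith
  have hs1 : s ≤ 1 := by linarith
  constructor
  -- Υ cuts off both the source and the solution, so the kernel does not see a or b.
  · obtain ⟨C, lam, 𝒢, hC, hlam, hb, hr⟩ :=
      hbg.exists_kernel_of_cutoffs hκ₀ hκ₀' hK hs hs1 hss₀ hΥ hΥ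
    exact ⟨C, lam, 𝒢, hC, hlam, hb, fun a b _ _ t Ξ P hΞ hP =>
      hr a b t Ξ _ P hΞ (fun z v _ => mul_comm _ _) hP⟩
  · intro a b ha hb
    -- The second cut-off is built from Υ and needs a point where Υ is nonzero; if there is none,
    -- the zero kernel represents the zero function.
    by_cases hΥ0 : ∀ v, Υ v = 0
    · refine ⟨1, 1, fun _ _ _ _ => 0, one_pos, one_pos, fun t k ξ η _ => ?_,
        fun t Ξ P _ _ k ξ _ => ?_⟩
      · rw [norm_zero, one_mul]
        positivity
      · simp [hΥ0, PressureKernel.fourier, PressureKernel.fourierZ]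
    · push Not at hΥ0
      obtain ⟨x₀, hx₀⟩ := hΥ0
      obtain ⟨χ, hχ, hχ1⟩ : ∃ χ : ℝ → ℝ, PressureKernel.IsGevreyCutoff s (u 0) (u 1) χ ∧
          ∀ v ∈ Icc a b, χ v = 1 := by
        rcases le_or_gt a b with hab | hab
        · exact hΥ.exists_eq_one hs0 hs1 hx₀ ha hab hb
        -- For b < a the interval is empty and the source vanishes, so any cut-off will do.
        · exact ⟨Υ, hΥ, by simp [Icc_eq_empty_of_lt hab]⟩
      obtain ⟨C, lam, 𝒢, hC, hlam, hbd, hr⟩ :=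
        hbg.exists_kernel_of_cutoffs hκ₀ hκ₀' hK hs hs1 hss₀ hχ hΥ
      refine ⟨C, lam, 𝒢, hC, hlam, hbd, fun t Ξ P hΞ hP =>
        hr a b t Ξ Ξ P hΞ (fun z v _ => ?_) hP⟩
      by_cases hv : v ∈ Icc a b
      · simp [hχ1 v hv]
      · simp [hΞ.supp z v hv]
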